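/- Let $M$ be a connected smooth three-dimensional manifold with a strongly pseudoconvex CR structure $T^{1,0}M\subset\mathbb{C}\otimes TM$ of CR dimension one (a smooth complex line subbundle with $T^{1,0}M\cap\overline{T^{1,0}M}=0$, closed under brackets), and let $\theta$ be a pseudohermitian structure on $M$, i.e. a smooth nowhere vanishing real $1$-form with $\ker\theta=T^{1,0}M\oplus\overline{T^{1,0}M}$, chosen so that the Levi form $L_\theta(Z,W)=i\,d\theta(Z,\overline W)$ on $T^{1,0}M$ is positive definite, where $d\theta(X,Y)=X\theta(Y)-Y\theta(X)-\theta([X,Y])$. Let $T$ be the Reeb vector field ($\theta(T)=1$, $i_T\,d\theta=0$) and give $M$ the Webster metric $g_\theta$, defined by $g_\theta(X,Y)=\operatorname{Re}L_\theta(Z,W)$, $g_\theta(X,T)=0$, $g_\theta(T,T)=1$ for $X=(Z+\overline Z)/\sqrt2$, $Y=(W+\overline W)/\sqrt2$, $Z,W\in T^{1,0}M$. Let $f\colon M\to\mathbb{R}^4$ be a smooth immersion which is isometric for $g_\theta$ and CR pluriharmonic, i.e. every point of $M$ has an open neighbourhood on which $f$ is the real part of a CR map into $\mathbb{C}^4$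 (a smooth map whose complexified differential maps $T^{1,0}M$ into $T^{1,0}\mathbb{C}^4$). Then $f=\phi\circ\psi$, where $\phi\colon\mathbb{C}^2\to\mathbb{R}^4$ is an isometry (bijective and distance preserving) and $\psi$ is a local CR diffeomorphism of $M$ onto an open subset $U$ of one of the following two real hypersurfaces $\tilde M$ of $\mathbb{C}^2$, with the CR structure $T^{1,0}\tilde M=(\mathbb{C}\otimes T\tilde M)\cap T^{1,0}\mathbb{C}^2$: 1. the cylinder $\{(z,w)\in\mathbb{C}^2 : (\operatorname{Re}z)^2+(\operatorname{Re}w)^2=1\}$; 2. the sphere $\{(z,w)\in\mathbb{C}^2 : |z|^2+|w|^2=4\}$. That is, $\psi(M)=U$ and every point of $M$ has an open neighbourhood which $\psi$ maps by a CR diffeomorphism onto an open subset of $\tilde M$. If moreover $f$ is injective, then $\psi$ is a CR diffeomorphism of $M$ onto $U$. -/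

import Mathlib

open Set TopologicalSpace
open scoped Manifold ContDiff TensorProduct

noncomputable section

/-! ### Complexified real vector spaces -/

section Complexification

variable {V : Type*} [AddCommGroup V] [Module ℝ V]

/-- The real part `u` of a vector `u + i v` of the complexification `ℂ ⊗ V`. -/
def cRe : ℂ ⊗[ℝ] V →ₗ[ℝ] V :=
  (TensorProduct.lid ℝ V).toLinearMap ∘ₗ LinearMap.rTensor V Complex.reLm

/-- The imaginary part `v` of a vector `u + i v` of the complexification `ℂ ⊗ V`. -/
def cIm : ℂ ⊗[ℝ] V →ₗ[ℝ] V :=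
  (TensorProduct.lid ℝ V).toLinearMap ∘ₗ LinearMap.rTensor V Complex.imLm

/-- The conjugation `u + i v ↦ u - i v` of the complexification. -/
def cConj : ℂ ⊗[ℝ] V →ₗ[ℝ] ℂ ⊗[ℝ] V :=
  LinearMap.rTensor V Complex.conjAe.toLinearMap

/-- The vector `u + i v` of the complexification. -/
def cMk (u v : V) : ℂ ⊗[ℝ] V :=
  (1 : ℂ) ⊗ₜ[ℝ] u + Complex.I ⊗ₜ[ℝ] v

end Complexification

/-- Multiplication by `i` on a complex vector space, as a real linear map. -/
def mulI (V : Type*) [AddCommGroup V] [Module ℂ V] [Module ℝ V] [IsScalarTower ℝ ℂ V] :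
    V →ₗ[ℝ] V :=
  (LinearMap.lsmul ℂ V Complex.I).restrictScalars ℝ

/-- The holomorphic tangent space `T^{1,0}` of a complex vector space `V`: the `i`-eigenspace of the
complexified complex structure, i.e. the vectors `u - i (J u)` of `ℂ ⊗ V`. -/
def holTangent (V : Type*) [AddCommGroup V] [Module ℂ V] [Module ℝ V] [IsScalarTower ℝ ℂ V] :
    Submodule ℂ (ℂ ⊗[ℝ] V) :=
  LinearMap.ker ((mulI V).baseChange ℂ - Complex.I • LinearMap.id)

/-! ### CR manifolds -/

section CR

variable {E : Type*} [NormedAddCommGroup E] [NormedSpace ℝ E]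

section Fields

variable {M : Type*} [TopologicalSpace M] [ChartedSpace E M]

/-- A vector of the complexified tangent space of `M` at `x`. -/
abbrev CTangent (E : Type*) [NormedAddCommGroup E] [NormedSpace ℝ E]
    {M : Type*} [TopologicalSpace M] [ChartedSpace E M] (x : M) : Type _ :=
  ℂ ⊗[ℝ] TangentSpace 𝓘(ℝ, E) x

/-- The complex vector field `Z` is smooth on `U`: its real and imaginary parts are. -/
def SmoothCField [IsManifold 𝓘(ℝ, E) ∞ M] (Z : ∀ x : M, CTangent E x) (U : Set M) : Prop :=
  ContMDiffOn 𝓘(ℝ, E) 𝓘(ℝ, E).tangent ∞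
      (fun x => (⟨x, cRe (Z x)⟩ : TangentBundle 𝓘(ℝ, E) M)) U ∧
    ContMDiffOn 𝓘(ℝ, E) 𝓘(ℝ, E).tangent ∞
      (fun x => (⟨x, cIm (Z x)⟩ : TangentBundle 𝓘(ℝ, E) M)) U

/-- The complex bilinear extension of the Lie bracket to complex vector fields. -/
def cBracket (Z W : ∀ x : M, CTangent E x) (x : M) : CTangent E x :=
  cMk
    (VectorField.mlieBracket 𝓘(ℝ, E) (fun y => cRe (Z y)) (fun y => cRe (W y)) x
      - VectorField.mlieBracket 𝓘(ℝ, E) (fun y => cIm (Z y)) (fun y => cIm (W y)) x)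
    (VectorField.mlieBracket 𝓘(ℝ, E) (fun y => cRe (Z y)) (fun y => cIm (W y)) x
      + VectorField.mlieBracket 𝓘(ℝ, E) (fun y => cIm (Z y)) (fun y => cRe (W y)) x)

/-- The differential at `x` of a map from `M` to a real vector space. -/
def rDiff {F : Type*} [NormedAddCommGroup F] [NormedSpace ℝ F] (f : M → F) (x : M) :
    TangentSpace 𝓘(ℝ, E) x →L[ℝ] F :=
  mfderiv 𝓘(ℝ, E) 𝓘(ℝ, F) f x

/-- The complexified differential at `x` of a map from `M` to a real vector space. -/
def cDiff {F : Type*} [NormedAddCommGroup F] [NormedSpace ℝ F] (f : M → F) (x : M) :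
    CTangent E x →ₗ[ℂ] ℂ ⊗[ℝ] F :=
  (rDiff f x).toLinearMap.baseChange ℂ

end Fields

variable (E) in
/-- A CR structure of CR dimension `k` on a smooth manifold `M`: a smooth complex subbundle
`T^{1,0}M` of rank `k` of the complexified tangent bundle, which meets its conjugate trivially and is
closed under brackets. -/
structure CRStructure (k : ℕ) (M : Type*) [TopologicalSpace M] [ChartedSpace E M]
    [IsManifold 𝓘(ℝ, E) ∞ M] where
  /-- the fibre of `T^{1,0}M` at a point -/
  T10 : ∀ x : M, Submodule ℂ (CTangent E x)
  exists_frame : ∀ x : M, ∃ U : Set M, IsOpen U ∧ x ∈ U ∧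
    ∃ Z : Fin k → ∀ y : M, CTangent E y, (∀ i, SmoothCField (Z i) U) ∧
      ∀ y ∈ U, LinearIndependent ℂ (fun i => Z i y) ∧
        Submodule.span ℂ (range fun i => Z i y) = T10 y
  eq_zero_of_conj_mem : ∀ (x : M), ∀ Z ∈ T10 x, cConj Z ∈ T10 x → Z = 0
  bracket_mem : ∀ (U : Set M), IsOpen U → ∀ Z W : ∀ y : M, CTangent E y,
    SmoothCField Z U → SmoothCField W U →
    (∀ y ∈ U, Z y ∈ T10 y) → (∀ y ∈ U, W y ∈ T10 y) → ∀ y ∈ U, cBracket Z W y ∈ T10 y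

section OneForms

variable {M : Type*} [TopologicalSpace M] [ChartedSpace E M]

/-- The expression of a `1`-form in the preferred chart at `x`. -/
def chartForm (θ : ∀ y : M, TangentSpace 𝓘(ℝ, E) y →L[ℝ] ℝ) (x : M) (e : E) : E →L[ℝ] ℝ :=
  (θ ((extChartAt 𝓘(ℝ, E) x).symm e)).comp
    (mfderiv 𝓘(ℝ, E) 𝓘(ℝ, E) (extChartAt 𝓘(ℝ, E) x).symm e)

/-- The exterior derivative of a `1`-form, `dθ(u, v)` for `u v` in the tangent space at `x`, computed
in the preferred chart at `x`, with the normalization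
`dθ(X, Y) = X(θ(Y)) - Y(θ(X)) - θ([X, Y])`. -/
def dForm (θ : ∀ y : M, TangentSpace 𝓘(ℝ, E) y →L[ℝ] ℝ) (x : M)
    (u v : TangentSpace 𝓘(ℝ, E) x) : ℝ :=
  extDeriv (fun e => ContinuousAlternatingMap.ofSubsingleton ℝ E ℝ (0 : Fin 1) (chartForm θ x e))
    (extChartAt 𝓘(ℝ, E) x x)
    ![mfderiv 𝓘(ℝ, E) 𝓘(ℝ, E) (extChartAt 𝓘(ℝ, E) x) x u,
      mfderiv 𝓘(ℝ, E) 𝓘(ℝ, E) (extChartAt 𝓘(ℝ, E) x) x v]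

/-- The complex bilinear extension of `dθ`. -/
def cdForm (θ : ∀ y : M, TangentSpace 𝓘(ℝ, E) y →L[ℝ] ℝ) (x : M) (Z W : CTangent E x) : ℂ :=
  ⟨dForm θ x (cRe Z) (cRe W) - dForm θ x (cIm Z) (cIm W),
    dForm θ x (cRe Z) (cIm W) + dForm θ x (cIm Z) (cRe W)⟩

end OneForms

variable {k : ℕ} {M : Type*} [TopologicalSpace M] [ChartedSpace E M] [IsManifold 𝓘(ℝ, E) ∞ M]

/-- A pseudohermitian structure on a CR manifold: a smooth nowhere vanishing real `1`-form `θ` whose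
complexified kernel is `T^{1,0}M ⊕ T^{0,1}M`. -/
structure PseudohermitianStructure (S : CRStructure E k M) where
  /-- the `1`-form -/
  form : ∀ x : M, TangentSpace 𝓘(ℝ, E) x →L[ℝ] ℝ
  smooth : ContMDiff 𝓘(ℝ, E) (𝓘(ℝ, E).prod 𝓘(ℝ, E →L[ℝ] ℝ)) ∞
    (fun x => Bundle.TotalSpace.mk' (E →L[ℝ] ℝ)
      (E := fun x : M => TangentSpace 𝓘(ℝ, E) x →L[ℝ] Bundle.Trivial M ℝ x) x (form x))
  ne_zero : ∀ x, form x ≠ 0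
  ker_eq : ∀ (x : M) (Z : CTangent E x),
    (form x).toLinearMap.baseChange ℂ Z = 0 ↔ ∃ A ∈ S.T10 x, ∃ B ∈ S.T10 x, Z = A + cConj B

namespace PseudohermitianStructure

variable {S : CRStructure E k M} (θ : PseudohermitianStructure S)

/-- The Levi form `L_θ(Z, W) = i dθ(Z, W̄)`. -/
def levi (x : M) (Z W : CTangent E x) : ℂ :=
  Complex.I * cdForm θ.form x Z (cConj W)

/-- The Levi form of `θ` is positive definite on `T^{1,0}M`. -/
def LeviPosDef : Prop :=
  ∀ (x : M), ∀ Z ∈ S.T10 x, Z ≠ 0 → 0 < (θ.levi x Z Z).re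

/-- `T` is the Reeb vector at `x`: `θ(T) = 1` and `i_T dθ = 0`. -/
def IsReeb (x : M) (T : TangentSpace 𝓘(ℝ, E) x) : Prop :=
  θ.form x T = 1 ∧ ∀ v, dForm θ.form x T v = 0

/-- The Reeb vector field: the unique vector field satisfying `IsReeb`. -/
def reeb (x : M) : TangentSpace 𝓘(ℝ, E) x :=
  @Classical.epsilon _ ⟨0⟩ (θ.IsReeb x)

/-- For a real tangent vector `u`, the unique `Z` in `T^{1,0}M` such that
`u = (Z + Z̄) / √2 + θ(u) T`, where `T` is the Reeb vector. -/
def holPart (x : M) (u : TangentSpace 𝓘(ℝ, E) x) : CTangent E x :=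
  @Classical.epsilon _ ⟨0⟩ fun Z : CTangent E x =>
    Z ∈ S.T10 x ∧
      (1 / Real.sqrt 2) • (Z + cConj Z) = (1 : ℂ) ⊗ₜ[ℝ] (u - θ.form x u • θ.reeb x)

/-- The Webster metric: `g_θ(X, Y) = Re L_θ(Z, W)` for `X = (Z + Z̄) / √2`, `Y = (W + W̄) / √2` with
`Z, W` in `T^{1,0}M`, while the Reeb vector is a unit vector orthogonal to all such `X`. -/
def webster (x : M) (u v : TangentSpace 𝓘(ℝ, E) x) : ℝ :=
  (θ.levi x (θ.holPart x u) (θ.holPart x v)).re + θ.form x u * θ.form x v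

/-- `f` is a smooth immersion into a Euclidean space which is isometric for the Webster metric. -/
def IsIsometricImmersion {n : ℕ} (f : M → EuclideanSpace ℝ (Fin n)) : Prop :=
  ContMDiff 𝓘(ℝ, E) 𝓘(ℝ, EuclideanSpace ℝ (Fin n)) ∞ f ∧
    (∀ x, Function.Injective (rDiff (E := E) f x)) ∧
    ∀ (x : M) (u v : TangentSpace 𝓘(ℝ, E) x),
      inner ℝ (rDiff f x u) (rDiff f x v) = θ.webster x u v

end PseudohermitianStructure

namespace CRStructure

variable (S : CRStructure E k M)

/-- `F` is a CR map from the open subset `U` of `M` to `ℂⁿ`: it is smooth and its complexified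
differential maps `T^{1,0}M` into `T^{1,0}ℂⁿ`. -/
def IsCRMapOn {n : ℕ} (F : M → EuclideanSpace ℂ (Fin n)) (U : Set M) : Prop :=
  ContMDiffOn 𝓘(ℝ, E) 𝓘(ℝ, EuclideanSpace ℂ (Fin n)) ∞ F U ∧
    ∀ x ∈ U, ∀ Z ∈ S.T10 x, cDiff F x Z ∈ holTangent (EuclideanSpace ℂ (Fin n))

/-- `f` is CR pluriharmonic: it is smooth and locally the real part of a CR map into `ℂⁿ`. -/
def IsCRPluriharmonic {n : ℕ} (f : M → EuclideanSpace ℝ (Fin n)) : Prop :=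
  ContMDiff 𝓘(ℝ, E) 𝓘(ℝ, EuclideanSpace ℝ (Fin n)) ∞ f ∧
    ∀ x : M, ∃ U : Set M, IsOpen U ∧ x ∈ U ∧ ∃ F : M → EuclideanSpace ℂ (Fin n),
      S.IsCRMapOn F U ∧ ∀ y ∈ U, ∀ i, f y i = (F y i).re

end CRStructure

/-! ### Real hypersurfaces of `ℂ²` -/

/-- The holomorphic tangent space at `p` of the real hypersurface `{ρ = 0}` of `ℂ²`, where `ρ` has
nonzero differential along the hypersurface: the intersection of the complexified tangent space
`ker dρ_p` with `T^{1,0}ℂ²`. -/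
def hypersurfaceT10 (ρ : EuclideanSpace ℂ (Fin 2) → ℝ) (p : EuclideanSpace ℂ (Fin 2)) :
    Submodule ℂ (ℂ ⊗[ℝ] EuclideanSpace ℂ (Fin 2)) :=
  LinearMap.ker ((fderiv ℝ ρ p).toLinearMap.baseChange ℂ) ⊓ holTangent (EuclideanSpace ℂ (Fin 2))

/-- `U` is an open subset of the hypersurface `{ρ = 0}`. -/
def IsOpenInHypersurface (ρ : EuclideanSpace ℂ (Fin 2) → ℝ)
    (U : Set (EuclideanSpace ℂ (Fin 2))) : Prop :=
  ∃ O : Set (EuclideanSpace ℂ (Fin 2)), IsOpen O ∧ U = O ∩ {p | ρ p = 0}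

/-- `ψ` restricts to a CR diffeomorphism from the open subset `V` of `M` onto the open subset `U` of
the hypersurface `{ρ = 0}` of `ℂ²`: it is smooth with a smooth inverse, and its differential maps
`T^{1,0}M` onto the holomorphic tangent spaces of the hypersurface. -/
def CRStructure.IsCRDiffeo (S : CRStructure E k M) (ρ : EuclideanSpace ℂ (Fin 2) → ℝ)
    (ψ : M → EuclideanSpace ℂ (Fin 2)) (V : Set M) (U : Set (EuclideanSpace ℂ (Fin 2))) : Prop :=
  IsOpen V ∧ IsOpenInHypersurface ρ U ∧
    ContMDiffOn 𝓘(ℝ, E) 𝓘(ℝ, EuclideanSpace ℂ (Fin 2)) ∞ ψ V ∧ MapsTo ψ V U ∧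
    (∃ χ : EuclideanSpace ℂ (Fin 2) → M,
      ContMDiffOn 𝓘(ℝ, EuclideanSpace ℂ (Fin 2)) 𝓘(ℝ, E) ∞ χ U ∧ MapsTo χ U V ∧
        InvOn χ ψ V U) ∧
    ∀ x ∈ V, (S.T10 x).map (cDiff ψ x) = hypersurfaceT10 ρ (ψ x)

/-- `ψ` is a local CR diffeomorphism from `M` onto the open subset `U` of the hypersurface
`{ρ = 0}`: its image is `U`, and near every point it restricts to a CR diffeomorphism onto an open
subset of the hypersurface. -/
def CRStructure.IsLocalCRDiffeoOnto (S : CRStructure E k M) (ρ : EuclideanSpace ℂ (Fin 2) → ℝ)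
    (ψ : M → EuclideanSpace ℂ (Fin 2)) (U : Set (EuclideanSpace ℂ (Fin 2))) : Prop :=
  IsOpenInHypersurface ρ U ∧ range ψ = U ∧
    ∀ x : M, ∃ V : Set M, x ∈ V ∧ ∃ U' : Set (EuclideanSpace ℂ (Fin 2)), S.IsCRDiffeo ρ ψ V U'

/-- The defining function of the cylinder `(Re z)² + (Re w)² = 1`. -/
def cylinderFn (p : EuclideanSpace ℂ (Fin 2)) : ℝ :=
  (p 0).re ^ 2 + (p 1).re ^ 2 - 1

/-- The defining function of the sphere `|z|² + |w|² = 4`. -/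
def sphereFn (p : EuclideanSpace ℂ (Fin 2)) : ℝ :=
  ‖p 0‖ ^ 2 + ‖p 1‖ ^ 2 - 4

end CR

end

/-! Locally write `f + i g` for a CR map with real part `f`, let `T` be the Reeb field and `Z` a
generator of `T10` scaled so that `dθ(Re Z, Im Z) = 1`. Then `e₁ = Re Z`, `e₂ = -Im Z`, `e₃ = T` is
orthonormal for the Webster metric, and `dg(e₁) = -df(e₂)`, `dg(e₂) = df(e₁)`. The one part of `dg`
not read off from `df` is `n = dg(T)`. The conditions `d²g = 0`, combined with the isometry, force
`n` to be a unit normal of `f` (`AdaptedFrame.structureEquations`). The orthogonal complex structure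
`J` with `J df(e₁) = df(e₂)` and `J n = df(T)` is then parallel, so `f` is locally a CR immersion as
a real hypersurface of `(ℝ⁴, J)`.

The second fundamental form has a block `(p, q; q, r)` of trace `1` on the contact plane, an entry
`μ` on `T`, and no mixed entries. The Codazzi equations give `μ = 2(pr - q²)` and show that `μ` is
constant. Since `μ = 1/2 - 2((p - 1/2)² + q²)`, two cases remain. If `μ = 1/2`, the form is half the
metric and the image lies on a sphere of radius `2`. Otherwise the traceless part of the block never
vanishes; its derivatives are those of a rotating vector, and the integrability of that rotation
against the Gauss equation gives `μ = 0` (`mu_eq_zero`). Then the block is a projection, the plane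
spanned by `n` and the principal direction of curvature `1` is parallel and totally real, and the
image lies on a cylinder of radius `1` (`AdaptedFrame.exists_model`).

The local data `J`, `P`, `r` are determined by `f` (`IsModelAt.unique`), hence are the same on all
of the connected manifold, and `P f - r J df(T)` is constant, which yields a centre. An
identification of `(ℝ⁴, J)` with `ℂ²` turns `f` into the map `ψ`; local inverses come from a tubular
neighbourhood (`exists_local_inverse`). -/

noncomputable section

/-! ### Derivatives along vector fields in a normed space. -/

section DirectionalDerivative

variable {E F : Type*} [NormedAddCommGroup E] [NormedSpace ℝ E]
  [NormedAddCommGroup F] [NormedSpace ℝ F]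

/-- The derivative of `u` along the vector field `X`. -/
def dirD (X : E → E) (u : E → F) (x : E) : F := fderiv ℝ u x (X x)

variable {U : Set E} {X Y : E → E} {u v : E → F} {a : E → ℝ} {x : E}

theorem ContDiffOn.differentiableAt_of_isOpen (hu : ContDiffOn ℝ ∞ u U) (hU : IsOpen U)
    (hx : x ∈ U) : DifferentiableAt ℝ u x :=
  (hu.contDiffAt (hU.mem_nhds hx)).differentiableAt (by simp)

theorem ContDiffOn.dirD (hu : ContDiffOn ℝ ∞ u U) (hX : ContDiffOn ℝ ∞ X U) (hU : IsOpen U) :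
    ContDiffOn ℝ ∞ (dirD X u) U :=
  (hu.fderiv_of_isOpen hU (by simp)).clm_apply hX

theorem dirD_congr (hU : IsOpen U) (h : EqOn u v U) (hx : x ∈ U) : dirD X u x = dirD X v x := by
  unfold _root_.dirD
  rw [(h.eventuallyEq_of_mem (hU.mem_nhds hx)).fderiv_eq]

theorem dirD_const (c : F) : dirD X (fun _ => c) x = 0 := by
  simp [dirD]

theorem dirD_eq_zero_of_eqOn_const (hU : IsOpen U) {c : F} (h : ∀ y ∈ U, u y = c) (hx : x ∈ U) :
    dirD X u x = 0 := by
  rw [dirD_congr hU (v := fun _ => c) h hx, dirD_const]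

theorem dirD_add (hu : DifferentiableAt ℝ u x) (hv : DifferentiableAt ℝ v x) :
    dirD X (fun y => u y + v y) x = dirD X u x + dirD X v x := by
  simp [dirD, fderiv_fun_add hu hv]

theorem dirD_sub (hu : DifferentiableAt ℝ u x) (hv : DifferentiableAt ℝ v x) :
    dirD X (fun y => u y - v y) x = dirD X u x - dirD X v x := by
  simp [dirD, fderiv_fun_sub hu hv]

theorem dirD_neg : dirD X (fun y => - u y) x = - dirD X u x := by
  simp [dirD, fderiv_fun_neg]

theorem dirD_smul (ha : DifferentiableAt ℝ a x) (hv : DifferentiableAt ℝ v x) :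
    dirD X (fun y => a y • v y) x = dirD X a x • v x + a x • dirD X v x := by
  simp [dirD, fderiv_fun_smul ha hv, add_comm]

theorem dirD_mul {b : E → ℝ} (ha : DifferentiableAt ℝ a x) (hb : DifferentiableAt ℝ b x) :
    dirD X (fun y => a y * b y) x = dirD X a x * b x + a x * dirD X b x :=
  dirD_smul ha hb

theorem dirD_inner {F : Type*} [NormedAddCommGroup F] [InnerProductSpace ℝ F] {u v : E → F}
    (hu : DifferentiableAt ℝ u x) (hv : DifferentiableAt ℝ v x) :
    dirD X (fun y => inner ℝ (u y) (v y)) x =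
      inner ℝ (dirD X u x) (v x) + inner ℝ (u x) (dirD X v x) := by
  simp [dirD, fderiv_inner_apply ℝ hu hv, add_comm]

theorem dirD_clm {G : Type*} [NormedAddCommGroup G] [NormedSpace ℝ G] (L : F →L[ℝ] G)
    (hu : DifferentiableAt ℝ u x) : dirD X (fun y => L (u y)) x = L (dirD X u x) := by
  have := (L.hasFDerivAt.comp x hu.hasFDerivAt).fderiv
  simp only [Function.comp_def] at this
  simp [dirD, this]

/-- By symmetry of the second derivative only first derivatives of `u` survive. The bracket of two
fields enters the local computation solely through this identity. -/
theorem dirD_dirD_sub (hu : ContDiffOn ℝ ∞ u U) (hX : ContDiffOn ℝ ∞ X U)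
    (hY : ContDiffOn ℝ ∞ Y U) (hU : IsOpen U) (hx : x ∈ U) :
    dirD X (dirD Y u) x - dirD Y (dirD X u) x = fderiv ℝ u x (dirD X Y x - dirD Y X x) := by
  have hdu := (hu.fderiv_of_isOpen hU (m := ∞) (by simp)).differentiableAt_of_isOpen hU hx
  have key : ∀ {V W : E → E}, ContDiffOn ℝ ∞ W U →
      dirD V (dirD W u) x = fderiv ℝ (fderiv ℝ u) x (V x) (W x) + fderiv ℝ u x (dirD V W x) := by
    intro V W hW
    have := fderiv_clm_apply hdu (hW.differentiableAt_of_isOpen hU hx)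
    change fderiv ℝ (fun y => fderiv ℝ u y (W y)) x (V x) = _
    rw [this]
    simp [dirD, add_comm]
  have hsymm : IsSymmSndFDerivAt ℝ u x :=
    (hu.contDiffAt (hU.mem_nhds hx)).isSymmSndFDerivAt
      (by simpa using WithTop.coe_le_coe.2 (le_top (a := (2 : ℕ∞))))
  rw [key hY, key hX, hsymm.eq (X x) (Y x), map_sub]
  abel

end DirectionalDerivative

/-! ### Orthonormal frames of a four-dimensional space. -/

section OrthonormalFour

variable {F : Type*} [NormedAddCommGroup F] [InnerProductSpace ℝ F]

/-- Four orthonormal vectors. -/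
structure Orthonormal4 (a b c d : F) : Prop where
  aa : inner ℝ a a = 1
  bb : inner ℝ b b = 1
  cc : inner ℝ c c = 1
  dd : inner ℝ d d = 1
  ab : inner ℝ a b = 0
  ac : inner ℝ a c = 0
  ad : inner ℝ a d = 0
  bc : inner ℝ b c = 0
  bd : inner ℝ b d = 0
  cd : inner ℝ c d = 0

namespace Orthonormal4

variable {a b c d : F}

theorem orthonormal (h : Orthonormal4 a b c d) : Orthonormal ℝ ![a, b, c, d] := by
  have swap : ∀ {u v : F}, inner ℝ u v = 0 → inner ℝ v u = 0 := fun {u v} k => by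
    rw [real_inner_comm, k]
  rw [orthonormal_iff_ite]
  intro i j
  fin_cases i <;> fin_cases j
  exacts [h.aa, h.ab, h.ac, h.ad, swap h.ab, h.bb, h.bc, h.bd, swap h.ac, swap h.bc, h.cc, h.cd,
    swap h.ad, swap h.bd, swap h.cd, h.dd]

/-- The expansion of a vector of a four-dimensional space. -/
theorem expand (h : Orthonormal4 a b c d) (hF : Module.finrank ℝ F = 4) (v : F) :
    v = inner ℝ a v • a + inner ℝ b v • b + inner ℝ c v • c + inner ℝ d v • d := by
  have hcard : Fintype.card (Fin 4) = Module.finrank ℝ F := by simp [hF]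
  have : FiniteDimensional ℝ F := Module.finite_of_finrank_pos (by omega)
  let B := basisOfOrthonormalOfCardEqFinrank h.orthonormal hcard
  have hB : Orthonormal ℝ B := by
    rw [coe_basisOfOrthonormalOfCardEqFinrank]; exact h.orthonormal
  have := (B.toOrthonormalBasis hB).sum_repr' v
  simpa [Fin.sum_univ_four, B] using this.symm

end Orthonormal4

end OrthonormalFour

/-! ### Adapted frames and the compatibility conditions of the conjugate. -/

section AdaptedFrame

variable {E F : Type*} [NormedAddCommGroup E] [NormedSpace ℝ E]
  [NormedAddCommGroup F] [InnerProductSpace ℝ F]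

/-- An immersion `f` with a frame `e₁, e₂, e₃` that `f` maps to an orthonormal frame, and a conjugate
`g` of `f` along `e₁, e₂`, such that the form `⟨df, df(e₃)⟩` is a contact form with Reeb field `e₃`
and Levi form normalized by `e₁, e₂`. -/
structure AdaptedFrame (U : Set E) (f g : E → F) (e₁ e₂ e₃ : E → E) : Prop where
  isOpen : IsOpen U
  smooth_f : ContDiffOn ℝ ∞ f U
  smooth_g : ContDiffOn ℝ ∞ g U
  smooth_e₁ : ContDiffOn ℝ ∞ e₁ U
  smooth_e₂ : ContDiffOn ℝ ∞ e₂ U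
  smooth_e₃ : ContDiffOn ℝ ∞ e₃ U
  inner_11 : ∀ x ∈ U, inner ℝ (dirD e₁ f x) (dirD e₁ f x) = 1
  inner_22 : ∀ x ∈ U, inner ℝ (dirD e₂ f x) (dirD e₂ f x) = 1
  inner_33 : ∀ x ∈ U, inner ℝ (dirD e₃ f x) (dirD e₃ f x) = 1
  inner_12 : ∀ x ∈ U, inner ℝ (dirD e₁ f x) (dirD e₂ f x) = 0
  inner_13 : ∀ x ∈ U, inner ℝ (dirD e₁ f x) (dirD e₃ f x) = 0
  inner_23 : ∀ x ∈ U, inner ℝ (dirD e₂ f x) (dirD e₃ f x) = 0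
  conj_1 : ∀ x ∈ U, dirD e₁ g x = - dirD e₂ f x
  conj_2 : ∀ x ∈ U, dirD e₂ g x = dirD e₁ f x
  levi_12 : ∀ x ∈ U, inner ℝ (dirD e₂ f x) (dirD e₁ (dirD e₃ f) x)
    - inner ℝ (dirD e₁ f x) (dirD e₂ (dirD e₃ f) x) = -1
  reeb_1 : ∀ x ∈ U, inner ℝ (dirD e₁ f x) (dirD e₃ (dirD e₃ f) x) = 0
  reeb_2 : ∀ x ∈ U, inner ℝ (dirD e₂ f x) (dirD e₃ (dirD e₃ f) x) = 0

theorem inner_dirD_eq_neg {U : Set E} {X : E → E} {u v : E → F} {c : ℝ} {x : E} (hU : IsOpen U)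
    (hu : ContDiffOn ℝ ∞ u U) (hv : ContDiffOn ℝ ∞ v U)
    (h : ∀ y ∈ U, inner ℝ (u y) (v y) = c) (hx : x ∈ U) :
    inner ℝ (u x) (dirD X v x) = - inner ℝ (v x) (dirD X u x) := by
  have h1 := dirD_eq_zero_of_eqOn_const (X := X) hU h hx
  rw [dirD_inner (hu.differentiableAt_of_isOpen hU hx) (hv.differentiableAt_of_isOpen hU hx),
    real_inner_comm] at h1
  linarith

theorem inner_dirD_self {U : Set E} {X : E → E} {u : E → F} {c : ℝ} {x : E} (hU : IsOpen U)
    (hu : ContDiffOn ℝ ∞ u U) (h : ∀ y ∈ U, inner ℝ (u y) (u y) = c) (hx : x ∈ U) :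
    inner ℝ (u x) (dirD X u x) = 0 := by
  have := inner_dirD_eq_neg (X := X) hU hu hu h hx
  linarith

namespace AdaptedFrame

variable {U : Set E} {f g : E → F} {e₁ e₂ e₃ : E → E} {x : E}

theorem smooth_f₁ (h : AdaptedFrame U f g e₁ e₂ e₃) : ContDiffOn ℝ ∞ (dirD e₁ f) U :=
  h.smooth_f.dirD h.smooth_e₁ h.isOpen

theorem smooth_f₂ (h : AdaptedFrame U f g e₁ e₂ e₃) : ContDiffOn ℝ ∞ (dirD e₂ f) U :=
  h.smooth_f.dirD h.smooth_e₂ h.isOpen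

theorem smooth_f₃ (h : AdaptedFrame U f g e₁ e₂ e₃) : ContDiffOn ℝ ∞ (dirD e₃ f) U :=
  h.smooth_f.dirD h.smooth_e₃ h.isOpen

theorem smooth_normal (h : AdaptedFrame U f g e₁ e₂ e₃) : ContDiffOn ℝ ∞ (dirD e₃ g) U :=
  h.smooth_g.dirD h.smooth_e₃ h.isOpen

/-- The frame is independent because its image under `df` is orthonormal; for the same reason the
coordinates of `v` are inner products in `F`. -/
theorem expand (h : AdaptedFrame U f g e₁ e₂ e₃) (hE : Module.finrank ℝ E = 3) (hx : x ∈ U)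
    (v : E) :
    v = inner ℝ (dirD e₁ f x) (fderiv ℝ f x v) • e₁ x
      + inner ℝ (dirD e₂ f x) (fderiv ℝ f x v) • e₂ x
      + inner ℝ (dirD e₃ f x) (fderiv ℝ f x v) • e₃ x := by
  have swap : ∀ {u v : F}, inner ℝ u v = 0 → inner ℝ v u = 0 := fun {u v} k => by
    rw [real_inner_comm, k]
  have horth : Orthonormal ℝ ![dirD e₁ f x, dirD e₂ f x, dirD e₃ f x] := by
    rw [orthonormal_iff_ite]
    intro i j
    fin_cases i <;> fin_cases j
    exacts [h.inner_11 x hx, h.inner_12 x hx, h.inner_13 x hx, swap (h.inner_12 x hx),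
      h.inner_22 x hx, h.inner_23 x hx, swap (h.inner_13 x hx), swap (h.inner_23 x hx),
      h.inner_33 x hx]
  have hind : LinearIndependent ℝ ![e₁ x, e₂ x, e₃ x] := by
    refine LinearIndependent.of_comp (fderiv ℝ f x).toLinearMap ?_
    have hc : (fderiv ℝ f x).toLinearMap ∘ ![e₁ x, e₂ x, e₃ x]
        = ![dirD e₁ f x, dirD e₂ f x, dirD e₃ f x] := by
      funext i
      fin_cases i <;> rfl
    rw [hc]
    exact horth.linearIndependent
  have hcard : Fintype.card (Fin 3) = Module.finrank ℝ E := by simp [hE]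
  have : FiniteDimensional ℝ E := Module.finite_of_finrank_pos (by omega)
  let B := basisOfLinearIndependentOfCardEqFinrank hind hcard
  have hv := B.sum_repr v
  simp only [Fin.sum_univ_three, B, coe_basisOfLinearIndependentOfCardEqFinrank] at hv
  set c := (basisOfLinearIndependentOfCardEqFinrank hind hcard).repr v
  simp only [Matrix.cons_val_zero, Matrix.cons_val_one, Matrix.cons_val] at hv
  have hd : fderiv ℝ f x v = c 0 • dirD e₁ f x + c 1 • dirD e₂ f x + c 2 • dirD e₃ f x := by
    conv_lhs => rw [← hv]
    simp [dirD]
  rw [hd]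
  simp only [inner_add_right, inner_smul_right, h.inner_11 x hx, h.inner_12 x hx, h.inner_13 x hx,
    h.inner_22 x hx, h.inner_23 x hx, h.inner_33 x hx, swap (h.inner_12 x hx),
    swap (h.inner_13 x hx), swap (h.inner_23 x hx)]
  conv_lhs => rw [← hv]
  simp

theorem fderiv_apply (h : AdaptedFrame U f g e₁ e₂ e₃) (hE : Module.finrank ℝ E = 3) (hx : x ∈ U)
    {G : Type*} [NormedAddCommGroup G] [NormedSpace ℝ G] (u : E → G) (v : E) :
    fderiv ℝ u x v = inner ℝ (dirD e₁ f x) (fderiv ℝ f x v) • dirD e₁ u x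
      + inner ℝ (dirD e₂ f x) (fderiv ℝ f x v) • dirD e₂ u x
      + inner ℝ (dirD e₃ f x) (fderiv ℝ f x v) • dirD e₃ u x := by
  conv_lhs => rw [h.expand hE hx v]
  simp [dirD]

/-- The frame components of `[X, Y]` are found by letting the bracket act on `f`, and the result
then applies to any `u`. For `u = g` it encodes `d²g = 0`; for `u` a frame vector or the normal it
will give the Gauss and Codazzi equations. -/
theorem commutator (h : AdaptedFrame U f g e₁ e₂ e₃) (hE : Module.finrank ℝ E = 3) (hx : x ∈ U)
    {G : Type*} [NormedAddCommGroup G] [NormedSpace ℝ G] {u : E → G} (hu : ContDiffOn ℝ ∞ u U)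
    {X Y : E → E} (hX : ContDiffOn ℝ ∞ X U) (hY : ContDiffOn ℝ ∞ Y U) :
    dirD X (dirD Y u) x - dirD Y (dirD X u) x =
      inner ℝ (dirD e₁ f x) (dirD X (dirD Y f) x - dirD Y (dirD X f) x) • dirD e₁ u x
      + inner ℝ (dirD e₂ f x) (dirD X (dirD Y f) x - dirD Y (dirD X f) x) • dirD e₂ u x
      + inner ℝ (dirD e₃ f x) (dirD X (dirD Y f) x - dirD Y (dirD X f) x) • dirD e₃ u x := by
  rw [dirD_dirD_sub hu hX hY h.isOpen hx, dirD_dirD_sub h.smooth_f hX hY h.isOpen hx,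
    h.fderiv_apply hE hx]

theorem inner_f₁_dirD_f₁ (h : AdaptedFrame U f g e₁ e₂ e₃) (X : E → E) (hx : x ∈ U) :
    inner ℝ (dirD e₁ f x) (dirD X (dirD e₁ f) x) = 0 :=
  inner_dirD_self h.isOpen h.smooth_f₁ h.inner_11 hx

theorem inner_f₂_dirD_f₂ (h : AdaptedFrame U f g e₁ e₂ e₃) (X : E → E) (hx : x ∈ U) :
    inner ℝ (dirD e₂ f x) (dirD X (dirD e₂ f) x) = 0 :=
  inner_dirD_self h.isOpen h.smooth_f₂ h.inner_22 hx

theorem inner_f₃_dirD_f₃ (h : AdaptedFrame U f g e₁ e₂ e₃) (X : E → E) (hx : x ∈ U) :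
    inner ℝ (dirD e₃ f x) (dirD X (dirD e₃ f) x) = 0 :=
  inner_dirD_self h.isOpen h.smooth_f₃ h.inner_33 hx

theorem inner_f₂_dirD_f₁ (h : AdaptedFrame U f g e₁ e₂ e₃) (X : E → E) (hx : x ∈ U) :
    inner ℝ (dirD e₂ f x) (dirD X (dirD e₁ f) x) = -inner ℝ (dirD e₁ f x) (dirD X (dirD e₂ f) x) := by
  rw [inner_dirD_eq_neg h.isOpen h.smooth_f₁ h.smooth_f₂ h.inner_12 hx, neg_neg]

theorem inner_f₃_dirD_f₁ (h : AdaptedFrame U f g e₁ e₂ e₃) (X : E → E) (hx : x ∈ U) :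
    inner ℝ (dirD e₃ f x) (dirD X (dirD e₁ f) x) = -inner ℝ (dirD e₁ f x) (dirD X (dirD e₃ f) x) := by
  rw [inner_dirD_eq_neg h.isOpen h.smooth_f₁ h.smooth_f₃ h.inner_13 hx, neg_neg]

theorem inner_f₃_dirD_f₂ (h : AdaptedFrame U f g e₁ e₂ e₃) (X : E → E) (hx : x ∈ U) :
    inner ℝ (dirD e₃ f x) (dirD X (dirD e₂ f) x) = -inner ℝ (dirD e₂ f x) (dirD X (dirD e₃ f) x) := by
  rw [inner_dirD_eq_neg h.isOpen h.smooth_f₂ h.smooth_f₃ h.inner_23 hx, neg_neg]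

theorem dirD_conj_1 (h : AdaptedFrame U f g e₁ e₂ e₃) (X : E → E) (hx : x ∈ U) :
    dirD X (dirD e₁ g) x = - dirD X (dirD e₂ f) x := by
  rw [dirD_congr h.isOpen h.conj_1 hx, dirD_neg]

theorem dirD_conj_2 (h : AdaptedFrame U f g e₁ e₂ e₃) (X : E → E) (hx : x ∈ U) :
    dirD X (dirD e₂ g) x = dirD X (dirD e₁ f) x :=
  dirD_congr h.isOpen h.conj_2 hx

/-- The coefficient of `e₃` is `θ([e₁, e₂]) = -dθ(e₁, e₂) = 1`, which is what `levi_12` records. -/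
theorem commutator_12 (h : AdaptedFrame U f g e₁ e₂ e₃) (hE : Module.finrank ℝ E = 3) (hx : x ∈ U)
    {G : Type*} [NormedAddCommGroup G] [NormedSpace ℝ G] {u : E → G} (hu : ContDiffOn ℝ ∞ u U) :
    dirD e₁ (dirD e₂ u) x - dirD e₂ (dirD e₁ u) x =
      inner ℝ (dirD e₁ f x) (dirD e₁ (dirD e₂ f) x) • dirD e₁ u x
      + inner ℝ (dirD e₁ f x) (dirD e₂ (dirD e₂ f) x) • dirD e₂ u x + dirD e₃ u x := by
  rw [h.commutator hE hx hu h.smooth_e₁ h.smooth_e₂]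
  simp only [inner_sub_right, h.inner_f₁_dirD_f₁ _ hx, h.inner_f₂_dirD_f₂ _ hx,
    h.inner_f₂_dirD_f₁ _ hx, h.inner_f₃_dirD_f₁ _ hx, h.inner_f₃_dirD_f₂ _ hx]
  have := h.levi_12 x hx
  linear_combination (norm := module) (-this) • dirD e₃ u x

/-- There is no `e₃` term: the Reeb condition puts `[e₁, e₃]`, and likewise `[e₂, e₃]`, in the
contact plane. -/
theorem commutator_13 (h : AdaptedFrame U f g e₁ e₂ e₃) (hE : Module.finrank ℝ E = 3) (hx : x ∈ U)
    {G : Type*} [NormedAddCommGroup G] [NormedSpace ℝ G] {u : E → G} (hu : ContDiffOn ℝ ∞ u U) :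
    dirD e₁ (dirD e₃ u) x - dirD e₃ (dirD e₁ u) x =
      inner ℝ (dirD e₁ f x) (dirD e₁ (dirD e₃ f) x) • dirD e₁ u x
      + (inner ℝ (dirD e₂ f x) (dirD e₁ (dirD e₃ f) x)
          + inner ℝ (dirD e₁ f x) (dirD e₃ (dirD e₂ f) x)) • dirD e₂ u x := by
  rw [h.commutator hE hx hu h.smooth_e₁ h.smooth_e₃]
  simp only [inner_sub_right, h.inner_f₁_dirD_f₁ _ hx, h.inner_f₃_dirD_f₃ _ hx,
    h.inner_f₂_dirD_f₁ _ hx, h.inner_f₃_dirD_f₁ _ hx, h.reeb_1 x hx]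
  module

theorem commutator_23 (h : AdaptedFrame U f g e₁ e₂ e₃) (hE : Module.finrank ℝ E = 3) (hx : x ∈ U)
    {G : Type*} [NormedAddCommGroup G] [NormedSpace ℝ G] {u : E → G} (hu : ContDiffOn ℝ ∞ u U) :
    dirD e₂ (dirD e₃ u) x - dirD e₃ (dirD e₂ u) x =
      (inner ℝ (dirD e₁ f x) (dirD e₂ (dirD e₃ f) x)
          - inner ℝ (dirD e₁ f x) (dirD e₃ (dirD e₂ f) x)) • dirD e₁ u x
      + inner ℝ (dirD e₂ f x) (dirD e₂ (dirD e₃ f) x) • dirD e₂ u x := by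
  rw [h.commutator hE hx hu h.smooth_e₂ h.smooth_e₃]
  simp only [inner_sub_right, h.inner_f₂_dirD_f₂ _ hx, h.inner_f₃_dirD_f₃ _ hx,
    h.inner_f₃_dirD_f₂ _ hx, h.reeb_2 x hx]
  module

/-- The equation `d²g = 0` on the contact plane. -/
theorem normal_eq (h : AdaptedFrame U f g e₁ e₂ e₃) (hE : Module.finrank ℝ E = 3) (hx : x ∈ U) :
    dirD e₃ g x = dirD e₁ (dirD e₁ f) x + dirD e₂ (dirD e₂ f) x
      + inner ℝ (dirD e₁ f x) (dirD e₁ (dirD e₂ f) x) • dirD e₂ f x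
      - inner ℝ (dirD e₁ f x) (dirD e₂ (dirD e₂ f) x) • dirD e₁ f x := by
  have := h.commutator_12 hE hx h.smooth_g
  rw [h.dirD_conj_1 _ hx, h.dirD_conj_2 _ hx, h.conj_1 x hx, h.conj_2 x hx] at this
  linear_combination (norm := module) -this

/-- In `normal_eq` the connection term is exactly what removes the `f₁` component of the second
derivatives. -/
theorem inner_f₁_normal (h : AdaptedFrame U f g e₁ e₂ e₃) (hE : Module.finrank ℝ E = 3)
    (hx : x ∈ U) : inner ℝ (dirD e₁ f x) (dirD e₃ g x) = 0 := by
  rw [h.normal_eq hE hx]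
  simp only [inner_add_right, inner_sub_right, inner_smul_right, h.inner_f₁_dirD_f₁ _ hx,
    h.inner_11 x hx, h.inner_12 x hx]
  ring

theorem inner_f₂_normal (h : AdaptedFrame U f g e₁ e₂ e₃) (hE : Module.finrank ℝ E = 3)
    (hx : x ∈ U) : inner ℝ (dirD e₂ f x) (dirD e₃ g x) = 0 := by
  rw [h.normal_eq hE hx]
  simp only [inner_add_right, inner_sub_right, inner_smul_right, h.inner_f₂_dirD_f₂ _ hx,
    h.inner_f₂_dirD_f₁ _ hx, h.inner_22 x hx, real_inner_comm (dirD e₁ f x) (dirD e₂ f x),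
    h.inner_12 x hx]
  ring

/-- The equation `d²g = 0` on `e₁, e₃`. -/
theorem dirD_normal_1 (h : AdaptedFrame U f g e₁ e₂ e₃) (hE : Module.finrank ℝ E = 3)
    (hx : x ∈ U) : dirD e₁ (dirD e₃ g) x = - dirD e₃ (dirD e₂ f) x
      - inner ℝ (dirD e₁ f x) (dirD e₁ (dirD e₃ f) x) • dirD e₂ f x
      + (inner ℝ (dirD e₂ f x) (dirD e₁ (dirD e₃ f) x)
          + inner ℝ (dirD e₁ f x) (dirD e₃ (dirD e₂ f) x)) • dirD e₁ f x := by
  have := h.commutator_13 hE hx h.smooth_g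
  rw [h.dirD_conj_1 _ hx, h.conj_1 x hx, h.conj_2 x hx] at this
  linear_combination (norm := module) this

/-- The equation `d²g = 0` on `e₂, e₃`. -/
theorem dirD_normal_2 (h : AdaptedFrame U f g e₁ e₂ e₃) (hE : Module.finrank ℝ E = 3)
    (hx : x ∈ U) : dirD e₂ (dirD e₃ g) x = dirD e₃ (dirD e₁ f) x
      - (inner ℝ (dirD e₁ f x) (dirD e₂ (dirD e₃ f) x)
          - inner ℝ (dirD e₁ f x) (dirD e₃ (dirD e₂ f) x)) • dirD e₂ f x
      + inner ℝ (dirD e₂ f x) (dirD e₂ (dirD e₃ f) x) • dirD e₁ f x := by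
  have := h.commutator_23 hE hx h.smooth_g
  rw [h.dirD_conj_2 _ hx, h.conj_1 x hx, h.conj_2 x hx] at this
  linear_combination (norm := module) this

end AdaptedFrame
end AdaptedFrame

/-! ### The conjugate yields a unit normal; structure equations. -/

section StructureEquations

variable {E F : Type*} [NormedAddCommGroup E] [NormedSpace ℝ E]
  [NormedAddCommGroup F] [InnerProductSpace ℝ F]

/-- The structure equations of a real hypersurface of a complex plane, in an adapted orthonormal frame
`f₁, f₂ = i f₁, f₃ = i n, n`: here `w` is the connection form, and `p, q, r, μ` are the entries
`h₁₁, h₁₂, h₂₂, h₃₃` of the second fundamental form. -/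
structure StructureEquations (U : Set E) (e₁ e₂ e₃ : E → E) (f₁ f₂ f₃ n : E → F)
    (w₁ w₂ w₃ p q r μ : E → ℝ) : Prop where
  isOpen : IsOpen U
  smooth_e₁ : ContDiffOn ℝ ∞ e₁ U
  smooth_e₂ : ContDiffOn ℝ ∞ e₂ U
  smooth_e₃ : ContDiffOn ℝ ∞ e₃ U
  smooth_f₁ : ContDiffOn ℝ ∞ f₁ U
  smooth_f₂ : ContDiffOn ℝ ∞ f₂ U
  smooth_f₃ : ContDiffOn ℝ ∞ f₃ U
  smooth_n : ContDiffOn ℝ ∞ n U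
  smooth_w₁ : ContDiffOn ℝ ∞ w₁ U
  smooth_w₂ : ContDiffOn ℝ ∞ w₂ U
  smooth_w₃ : ContDiffOn ℝ ∞ w₃ U
  smooth_p : ContDiffOn ℝ ∞ p U
  smooth_q : ContDiffOn ℝ ∞ q U
  smooth_r : ContDiffOn ℝ ∞ r U
  smooth_μ : ContDiffOn ℝ ∞ μ U
  orth : ∀ x ∈ U, Orthonormal4 (f₁ x) (f₂ x) (f₃ x) (n x)
  trace : ∀ x ∈ U, p x + r x = 1
  D₁f₁ : ∀ x ∈ U, dirD e₁ f₁ x = w₁ x • f₂ x - q x • f₃ x + p x • n x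
  D₂f₁ : ∀ x ∈ U, dirD e₂ f₁ x = w₂ x • f₂ x - r x • f₃ x + q x • n x
  D₃f₁ : ∀ x ∈ U, dirD e₃ f₁ x = w₃ x • f₂ x
  D₁f₂ : ∀ x ∈ U, dirD e₁ f₂ x = -w₁ x • f₁ x + p x • f₃ x + q x • n x
  D₂f₂ : ∀ x ∈ U, dirD e₂ f₂ x = -w₂ x • f₁ x + q x • f₃ x + r x • n x
  D₃f₂ : ∀ x ∈ U, dirD e₃ f₂ x = -w₃ x • f₁ x
  D₁f₃ : ∀ x ∈ U, dirD e₁ f₃ x = q x • f₁ x - p x • f₂ x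
  D₂f₃ : ∀ x ∈ U, dirD e₂ f₃ x = r x • f₁ x - q x • f₂ x
  D₃f₃ : ∀ x ∈ U, dirD e₃ f₃ x = μ x • n x
  D₁n : ∀ x ∈ U, dirD e₁ n x = -p x • f₁ x - q x • f₂ x
  D₂n : ∀ x ∈ U, dirD e₂ n x = -q x • f₁ x - r x • f₂ x
  D₃n : ∀ x ∈ U, dirD e₃ n x = -μ x • f₃ x
  comm₁₂ : ∀ x ∈ U, ∀ u : E → F, ContDiffOn ℝ ∞ u U →
    dirD e₁ (dirD e₂ u) x - dirD e₂ (dirD e₁ u) x =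
      -w₁ x • dirD e₁ u x - w₂ x • dirD e₂ u x + dirD e₃ u x
  comm₁₃ : ∀ x ∈ U, ∀ u : E → F, ContDiffOn ℝ ∞ u U →
    dirD e₁ (dirD e₃ u) x - dirD e₃ (dirD e₁ u) x =
      q x • dirD e₁ u x - (p x + w₃ x) • dirD e₂ u x
  comm₂₃ : ∀ x ∈ U, ∀ u : E → F, ContDiffOn ℝ ∞ u U →
    dirD e₂ (dirD e₃ u) x - dirD e₃ (dirD e₂ u) x =
      (r x + w₃ x) • dirD e₁ u x - q x • dirD e₂ u x
  comm₁₂' : ∀ x ∈ U, ∀ u : E → ℝ, ContDiffOn ℝ ∞ u U →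
    dirD e₁ (dirD e₂ u) x - dirD e₂ (dirD e₁ u) x =
      -w₁ x * dirD e₁ u x - w₂ x * dirD e₂ u x + dirD e₃ u x
  fderiv_eq_zero : ∀ x ∈ U, ∀ u : E → F, dirD e₁ u x = 0 → dirD e₂ u x = 0 → dirD e₃ u x = 0 →
    fderiv ℝ u x = 0
  fderiv_eq_zero' : ∀ x ∈ U, ∀ u : E → ℝ, dirD e₁ u x = 0 → dirD e₂ u x = 0 → dirD e₃ u x = 0 →
    fderiv ℝ u x = 0

namespace AdaptedFrame

variable {U : Set E} {f g : E → F} {e₁ e₂ e₃ : E → E} {x : E}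

/-- The sum `⟨f₁, D₁f₃⟩ + ⟨f₂, D₂f₃⟩` is computed twice. By `normal_eq` it is `-⟨f₃, n⟩`. By
differentiating `⟨f₁, n⟩ = ⟨f₂, n⟩ = 0`, inserting the formulas for `D₁n`, `D₂n` and taking the `n`
component of `[e₁, e₂] f`, it is `+⟨n, f₃⟩`. -/
theorem inner_f₃_normal (h : AdaptedFrame U f g e₁ e₂ e₃) (hE : Module.finrank ℝ E = 3)
    (hx : x ∈ U) : inner ℝ (dirD e₃ f x) (dirD e₃ g x) = 0 := by
  have h1 : inner ℝ (dirD e₂ f x) (dirD e₁ (dirD e₃ g) x)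
      = -inner ℝ (dirD e₃ g x) (dirD e₁ (dirD e₂ f) x) :=
    inner_dirD_eq_neg h.isOpen h.smooth_f₂ h.smooth_normal (fun y hy => h.inner_f₂_normal hE hy) hx
  have h2 : inner ℝ (dirD e₁ f x) (dirD e₂ (dirD e₃ g) x)
      = -inner ℝ (dirD e₃ g x) (dirD e₂ (dirD e₁ f) x) :=
    inner_dirD_eq_neg h.isOpen h.smooth_f₁ h.smooth_normal (fun y hy => h.inner_f₁_normal hE hy) hx
  have h3 := congrArg (inner ℝ (dirD e₃ g x)) (h.commutator_12 hE hx h.smooth_f)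
  have h4 := congrArg (inner ℝ (dirD e₃ f x)) (h.normal_eq hE hx)
  rw [h.dirD_normal_1 hE hx] at h1
  rw [h.dirD_normal_2 hE hx] at h2
  have c1 := h.inner_f₁_normal hE hx
  have c2 := h.inner_f₂_normal hE hx
  have c3 := h.inner_12 x hx
  have c4 := h.inner_13 x hx
  have c5 := h.inner_23 x hx
  rw [real_inner_comm] at c1 c2 c3 c4 c5
  simp only [inner_add_right, inner_sub_right, inner_smul_right, inner_neg_right, c1, c2, c3, c4, c5,
    h.inner_12 x hx, h.inner_11 x hx, h.inner_22 x hx,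
    h.inner_f₁_dirD_f₁ _ hx, h.inner_f₂_dirD_f₂ _ hx, h.inner_f₃_dirD_f₁ _ hx,
    h.inner_f₃_dirD_f₂ _ hx] at h1 h2 h3 h4
  rw [real_inner_comm (dirD e₃ f x) (dirD e₃ g x)] at h3
  linarith

theorem structureEquations (h : AdaptedFrame U f g e₁ e₂ e₃) (hE : Module.finrank ℝ E = 3)
    (hF : Module.finrank ℝ F = 4) :
    StructureEquations U e₁ e₂ e₃ (dirD e₁ f) (dirD e₂ f) (dirD e₃ f) (dirD e₃ g)
      (fun x => inner ℝ (dirD e₂ f x) (dirD e₁ (dirD e₁ f) x))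
      (fun x => inner ℝ (dirD e₂ f x) (dirD e₂ (dirD e₁ f) x))
      (fun x => inner ℝ (dirD e₂ f x) (dirD e₃ (dirD e₁ f) x))
      (fun x => inner ℝ (dirD e₃ g x) (dirD e₁ (dirD e₁ f) x))
      (fun x => inner ℝ (dirD e₃ g x) (dirD e₁ (dirD e₂ f) x))
      (fun x => inner ℝ (dirD e₃ g x) (dirD e₂ (dirD e₂ f) x))
      (fun x => inner ℝ (dirD e₃ g x) (dirD e₃ (dirD e₃ f) x)) := by
  have hU := h.isOpen
  have s1 := h.smooth_f₁
  have s2 := h.smooth_f₂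
  have s3 := h.smooth_f₃
  have sn := h.smooth_normal
  have sk : ∀ x ∈ U, ∀ X : E → E,
      inner ℝ (dirD e₁ f x) (dirD X (dirD e₃ g) x) = -inner ℝ (dirD e₃ g x) (dirD X (dirD e₁ f) x) ∧
      inner ℝ (dirD e₂ f x) (dirD X (dirD e₃ g) x) = -inner ℝ (dirD e₃ g x) (dirD X (dirD e₂ f) x) ∧
      inner ℝ (dirD e₃ f x) (dirD X (dirD e₃ g) x) = -inner ℝ (dirD e₃ g x) (dirD X (dirD e₃ f) x) :=
    fun x hx X => ⟨inner_dirD_eq_neg hU s1 sn (fun y hy => h.inner_f₁_normal hE hy) hx,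
      inner_dirD_eq_neg hU s2 sn (fun y hy => h.inner_f₂_normal hE hy) hx,
      inner_dirD_eq_neg hU s3 sn (fun y hy => h.inner_f₃_normal hE hy) hx⟩
  -- These relations mix three sources: the derivatives of `⟨fᵢ, n⟩ = 0`, the formulas for `D₁n` and
  -- `D₂n` from `d²g = 0`, and the `n` components of the commutators on `f`. The last one, trace
  -- `1`, is the Levi normalization.
  have A : ∀ x ∈ U,
      inner ℝ (dirD e₂ f x) (dirD e₁ (dirD e₃ f) x)
        = -inner ℝ (dirD e₃ g x) (dirD e₁ (dirD e₁ f) x) ∧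
      inner ℝ (dirD e₁ f x) (dirD e₁ (dirD e₃ f) x)
        = inner ℝ (dirD e₃ g x) (dirD e₁ (dirD e₂ f) x) ∧
      inner ℝ (dirD e₁ f x) (dirD e₂ (dirD e₃ f) x)
        = inner ℝ (dirD e₃ g x) (dirD e₂ (dirD e₂ f) x) ∧
      inner ℝ (dirD e₂ f x) (dirD e₂ (dirD e₃ f) x)
        = -inner ℝ (dirD e₃ g x) (dirD e₁ (dirD e₂ f) x) ∧
      inner ℝ (dirD e₃ g x) (dirD e₂ (dirD e₁ f) x)
        = inner ℝ (dirD e₃ g x) (dirD e₁ (dirD e₂ f) x) ∧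
      inner ℝ (dirD e₃ g x) (dirD e₁ (dirD e₃ f) x) = 0 ∧
      inner ℝ (dirD e₃ g x) (dirD e₂ (dirD e₃ f) x) = 0 ∧
      inner ℝ (dirD e₃ g x) (dirD e₃ (dirD e₁ f) x) = 0 ∧
      inner ℝ (dirD e₃ g x) (dirD e₃ (dirD e₂ f) x) = 0 ∧
      inner ℝ (dirD e₃ g x) (dirD e₁ (dirD e₁ f) x)
        + inner ℝ (dirD e₃ g x) (dirD e₂ (dirD e₂ f) x) = 1 := by
    intro x hx
    have c1 := h.inner_f₁_normal hE hx
    have c2 := h.inner_f₂_normal hE hx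
    have c0 := h.inner_f₃_normal hE hx
    have c3 := h.inner_12 x hx
    have c4 := h.inner_13 x hx
    have c5 := h.inner_23 x hx
    rw [real_inner_comm] at c1 c2 c0 c3 c4 c5
    obtain ⟨a1, a2, a3⟩ := sk x hx e₁
    obtain ⟨b1, b2, b3⟩ := sk x hx e₂
    have k12 := congrArg (inner ℝ (dirD e₃ g x)) (h.commutator_12 hE hx h.smooth_f)
    have k13 := congrArg (inner ℝ (dirD e₃ g x)) (h.commutator_13 hE hx h.smooth_f)
    have k23 := congrArg (inner ℝ (dirD e₃ g x)) (h.commutator_23 hE hx h.smooth_f)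
    have l12 := h.levi_12 x hx
    rw [h.dirD_normal_1 hE hx] at a1 a2 a3
    rw [h.dirD_normal_2 hE hx] at b1 b2 b3
    simp only [inner_add_right, inner_sub_right, inner_smul_right, inner_neg_right, c1, c2, c3, c4,
      c5, c0, h.inner_12 x hx, h.inner_11 x hx, h.inner_22 x hx, h.reeb_1 x hx, h.reeb_2 x hx,
      h.inner_f₁_dirD_f₁ _ hx, h.inner_f₂_dirD_f₂ _ hx, h.inner_f₃_dirD_f₁ _ hx,
      h.inner_f₂_dirD_f₁ _ hx, h.inner_f₃_dirD_f₂ _ hx] at a1 a2 a3 b1 b2 b3 k12 k13 k23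
    refine ⟨?_, ?_, ?_, ?_, ?_, ?_, ?_, ?_, ?_, ?_⟩ <;> linarith
  have O : ∀ x ∈ U, Orthonormal4 (dirD e₁ f x) (dirD e₂ f x) (dirD e₃ f x) (dirD e₃ g x) := by
    intro x hx
    refine ⟨h.inner_11 x hx, h.inner_22 x hx, h.inner_33 x hx, ?_, h.inner_12 x hx, h.inner_13 x hx,
      h.inner_f₁_normal hE hx, h.inner_23 x hx, h.inner_f₂_normal hE hx, h.inner_f₃_normal hE hx⟩
    have c1 := h.inner_f₁_normal hE hx
    have c2 := h.inner_f₂_normal hE hx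
    rw [real_inner_comm] at c1 c2
    -- Only one of the two copies of `n` is expanded, so that `⟨n, n⟩` becomes `p + r`.
    nth_rewrite 2 [h.normal_eq hE hx]
    simp only [inner_add_right, inner_sub_right, inner_smul_right, c1, c2]
    have := (A x hx).2.2.2.2.2.2.2.2.2
    linarith
  refine
    { isOpen := hU
      smooth_e₁ := h.smooth_e₁
      smooth_e₂ := h.smooth_e₂
      smooth_e₃ := h.smooth_e₃
      smooth_f₁ := s1
      smooth_f₂ := s2
      smooth_f₃ := s3
      smooth_n := sn
      smooth_w₁ := s2.inner ℝ (s1.dirD h.smooth_e₁ hU)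
      smooth_w₂ := s2.inner ℝ (s1.dirD h.smooth_e₂ hU)
      smooth_w₃ := s2.inner ℝ (s1.dirD h.smooth_e₃ hU)
      smooth_p := sn.inner ℝ (s1.dirD h.smooth_e₁ hU)
      smooth_q := sn.inner ℝ (s2.dirD h.smooth_e₁ hU)
      smooth_r := sn.inner ℝ (s2.dirD h.smooth_e₂ hU)
      smooth_μ := sn.inner ℝ (s3.dirD h.smooth_e₃ hU)
      orth := O
      trace := fun x hx => (A x hx).2.2.2.2.2.2.2.2.2
      D₁f₁ := ?D₁f₁
      D₂f₁ := ?D₂f₁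
      D₃f₁ := ?D₃f₁
      D₁f₂ := ?D₁f₂
      D₂f₂ := ?D₂f₂
      D₃f₂ := ?D₃f₂
      D₁f₃ := ?D₁f₃
      D₂f₃ := ?D₂f₃
      D₃f₃ := ?D₃f₃
      D₁n := ?D₁n
      D₂n := ?D₂n
      D₃n := ?D₃n
      comm₁₂ := ?comm₁₂
      comm₁₃ := ?comm₁₃
      comm₂₃ := ?comm₂₃
      comm₁₂' := ?comm₁₂'
      fderiv_eq_zero := ?fderiv_eq_zero
      fderiv_eq_zero' := ?fderiv_eq_zero' }
  all_goals intro x hx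
  case fderiv_eq_zero =>
    intro u h1 h2 h3
    ext v
    rw [h.fderiv_apply hE hx, h1, h2, h3]
    simp
  case fderiv_eq_zero' =>
    intro u h1 h2 h3
    ext v
    rw [h.fderiv_apply hE hx, h1, h2, h3]
    simp
  all_goals obtain ⟨a1, a2, a3, a4, a5, a6, a7, a8, a9, a10⟩ := A x hx
  case comm₁₂ =>
    intro u hu
    rw [h.commutator_12 hE hx hu, h.inner_f₂_dirD_f₁ _ hx, h.inner_f₂_dirD_f₁ _ hx]
    module
  case comm₁₂' =>
    intro u hu
    rw [h.commutator_12 hE hx hu, h.inner_f₂_dirD_f₁ _ hx, h.inner_f₂_dirD_f₁ _ hx]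
    simp only [smul_eq_mul]
    ring
  case comm₁₃ =>
    intro u hu
    rw [h.commutator_13 hE hx hu, h.inner_f₂_dirD_f₁ _ hx, a1, a2]
    module
  case comm₂₃ =>
    intro u hu
    rw [h.commutator_23 hE hx hu, h.inner_f₂_dirD_f₁ _ hx, a3, a4]
    module
  all_goals
    obtain ⟨b1, b2, b3⟩ := sk x hx e₁
    obtain ⟨b4, b5, b6⟩ := sk x hx e₂
    obtain ⟨b7, b8, b9⟩ := sk x hx e₃
    have n1 := inner_dirD_self (X := e₁) hU sn (fun y hy => (O y hy).dd) hx
    have n2 := inner_dirD_self (X := e₂) hU sn (fun y hy => (O y hy).dd) hx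
    have n3 := inner_dirD_self (X := e₃) hU sn (fun y hy => (O y hy).dd) hx
    -- The twelve derivative formulas are expansions in the orthonormal frame `f₁, f₂, f₃, n`, with
    -- the components already computed.
    refine ((O x hx).expand hF _).trans ?_
    simp only [a1, a2, a3, a4, a5, a6, a7, a8, a9, b1, b2, b3, b4, b5, b6, b7, b8, b9, n1, n2, n3,
      h.reeb_1 x hx, h.reeb_2 x hx,
      h.inner_f₁_dirD_f₁ _ hx, h.inner_f₂_dirD_f₂ _ hx, h.inner_f₃_dirD_f₃ _ hx,
      h.inner_f₃_dirD_f₁ _ hx, h.inner_f₂_dirD_f₁ _ hx, h.inner_f₃_dirD_f₂ _ hx]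
    module

end AdaptedFrame
end StructureEquations

/-! ### Parallel complex structure, Gauss and Codazzi equations, the value of `μ`. -/

section LocalClassification

variable {E F : Type*} [NormedAddCommGroup E] [NormedSpace ℝ E]
  [NormedAddCommGroup F] [InnerProductSpace ℝ F]

/-- The linear map with `a ↦ b`, `b ↦ -a`, `d ↦ c`, `c ↦ -d`, for orthonormal `a, b, c, d`. -/
def quarterTurn (a b c d : F) : F →L[ℝ] F :=
  (innerSL ℝ a).smulRight b - (innerSL ℝ b).smulRight a
    + (innerSL ℝ d).smulRight c - (innerSL ℝ c).smulRight d

theorem quarterTurn_apply (a b c d v : F) :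
    quarterTurn a b c d v =
      inner ℝ a v • b - inner ℝ b v • a + inner ℝ d v • c - inner ℝ c v • d := by
  simp [quarterTurn]

/-- The symmetric linear map with matrix `(p, q; q, r)` on `a, b`, which fixes `d`. -/
def symmMap (a b d : F) (p q r : ℝ) : F →L[ℝ] F :=
  (innerSL ℝ a).smulRight (p • a + q • b) + (innerSL ℝ b).smulRight (q • a + r • b)
    + (innerSL ℝ d).smulRight d

theorem symmMap_apply (a b d v : F) (p q r : ℝ) :
    symmMap a b d p q r v =
      inner ℝ a v • (p • a + q • b) + inner ℝ b v • (q • a + r • b) + inner ℝ d v • d := by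
  simp [symmMap]

/-- A complex structure `J` of a Euclidean space together with a linear map `P` and a radius `r` such
that `{|P v| = r}` is the sphere of radius `2` or the cylinder of radius `1` over a totally real
plane. -/
structure HypersurfaceModel (J P : F →L[ℝ] F) (r : ℝ) : Prop where
  J_J : ∀ v, J (J v) = -v
  inner_J : ∀ u v, inner ℝ (J u) v = -inner ℝ u (J v)
  sphere_or_cylinder : (P = ContinuousLinearMap.id ℝ F ∧ r = 2) ∨
    (r = 1 ∧ (∀ v, P (P v) = P v) ∧ (∀ u v, inner ℝ (P u) v = inner ℝ u (P v)) ∧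
      ∀ v, P v - J (P (J v)) = v)

namespace Orthonormal4

variable {a b c d : F}

theorem ba (h : Orthonormal4 a b c d) : inner ℝ b a = 0 := by rw [real_inner_comm, h.ab]
theorem ca (h : Orthonormal4 a b c d) : inner ℝ c a = 0 := by rw [real_inner_comm, h.ac]
theorem da (h : Orthonormal4 a b c d) : inner ℝ d a = 0 := by rw [real_inner_comm, h.ad]
theorem cb (h : Orthonormal4 a b c d) : inner ℝ c b = 0 := by rw [real_inner_comm, h.bc]
theorem db (h : Orthonormal4 a b c d) : inner ℝ d b = 0 := by rw [real_inner_comm, h.bd]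
theorem dc (h : Orthonormal4 a b c d) : inner ℝ d c = 0 := by rw [real_inner_comm, h.cd]

theorem quarterTurn_quarterTurn (h : Orthonormal4 a b c d) (hF : Module.finrank ℝ F = 4) (v : F) :
    quarterTurn a b c d (quarterTurn a b c d v) = -v := by
  conv_rhs => rw [h.expand hF v]
  simp only [quarterTurn_apply, inner_add_right, inner_sub_right, inner_smul_right, h.aa, h.bb, h.cc,
    h.dd, h.ab, h.ac, h.ad, h.bc, h.bd, h.cd, h.ba, h.ca, h.da, h.cb, h.db, h.dc]
  module

theorem inner_quarterTurn (u v : F) :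
    inner ℝ (quarterTurn a b c d u) v = -inner ℝ u (quarterTurn a b c d v) := by
  simp only [quarterTurn_apply, inner_add_right, inner_sub_right, inner_smul_right, inner_add_left,
    inner_sub_left, inner_smul_left, real_inner_comm u, RCLike.conj_to_real]
  ring

theorem sphereModel (h : Orthonormal4 a b c d) (hF : Module.finrank ℝ F = 4) :
    HypersurfaceModel (quarterTurn a b c d) (ContinuousLinearMap.id ℝ F) 2 :=
  ⟨h.quarterTurn_quarterTurn hF, inner_quarterTurn, Or.inl ⟨rfl, rfl⟩⟩

/-- Trace `1` and determinant `0` make `(p, q; q, r)` a rank-one projection, by Cayley–Hamilton. The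
quarter turn rotates the plane of `a, b` and exchanges `c` and `d` up to sign, so it conjugates the
projection into the complementary one. -/
theorem cylinderModel (h : Orthonormal4 a b c d) (hF : Module.finrank ℝ F = 4) {p q r : ℝ}
    (htr : p + r = 1) (hdet : p * r = q ^ 2) :
    HypersurfaceModel (quarterTurn a b c d) (symmMap a b d p q r) 1 := by
  refine ⟨h.quarterTurn_quarterTurn hF, inner_quarterTurn, Or.inr ⟨rfl, fun v => ?_, fun u v => ?_,
    fun v => ?_⟩⟩
  · simp only [symmMap_apply, inner_add_right, inner_smul_right, h.aa, h.bb,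
      h.dd, h.ab, h.ad, h.bd, h.ba, h.da, h.db]
    obtain rfl : r = 1 - p := by linarith
    linear_combination (norm := module) (-inner ℝ a v * hdet) • a + (-inner ℝ b v * hdet) • b
  · simp only [symmMap_apply, inner_add_right, inner_smul_right, inner_add_left,
      inner_smul_left, real_inner_comm u, RCLike.conj_to_real]
    ring
  · conv_rhs => rw [h.expand hF v]
    simp only [symmMap_apply, quarterTurn_apply, inner_add_right, inner_sub_right, inner_smul_right,
      h.aa, h.bb, h.dd, h.ab, h.ac, h.ad, h.bc, h.bd, h.cd, h.ba, h.ca, h.da, h.cb, h.db, h.dc]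
    obtain rfl : r = 1 - p := by linarith
    module

end Orthonormal4

section Products

variable {U : Set E} {X : E → E} {x : E}

theorem dirD_inner_smul {u w : E → F} (v : F) (hu : DifferentiableAt ℝ u x)
    (hw : DifferentiableAt ℝ w x) :
    dirD X (fun y => inner ℝ (u y) v • w y) x =
      inner ℝ (dirD X u x) v • w x + inner ℝ (u x) v • dirD X w x := by
  rw [dirD_smul (hu.inner ℝ (differentiableAt_const v)) hw,
    dirD_inner hu (differentiableAt_const v), dirD_const]
  simp

theorem dirD_eq_neg_smul {u v : E → F} {a : E → ℝ} (hU : IsOpen U) (ha : ContDiffOn ℝ ∞ a U)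
    (hv : ContDiffOn ℝ ∞ v U) (h : ∀ y ∈ U, u y = -a y • v y) (hx : x ∈ U) :
    dirD X u x = -(dirD X a x • v x + a x • dirD X v x) := by
  have := dirD_congr (X := X) hU (u := u) (v := fun y => -(a y • v y)) (fun y hy => by rw [h y hy]; module) hx
  rw [this, dirD_neg, dirD_smul (ha.differentiableAt_of_isOpen hU hx)
    (hv.differentiableAt_of_isOpen hU hx)]

theorem dirD_eq_neg_smul_sub {u v w : E → F} {a b : E → ℝ} (hU : IsOpen U)
    (ha : ContDiffOn ℝ ∞ a U) (hb : ContDiffOn ℝ ∞ b U)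
    (hv : ContDiffOn ℝ ∞ v U) (hw : ContDiffOn ℝ ∞ w U)
    (h : ∀ y ∈ U, u y = -a y • v y - b y • w y) (hx : x ∈ U) :
    dirD X u x = -(dirD X a x • v x + a x • dirD X v x)
      - (dirD X b x • w x + b x • dirD X w x) := by
  have da := ha.differentiableAt_of_isOpen hU hx
  have db := hb.differentiableAt_of_isOpen hU hx
  have dv := hv.differentiableAt_of_isOpen hU hx
  have dw := hw.differentiableAt_of_isOpen hU hx
  have := dirD_congr (X := X) hU (u := u) (v := fun y => -(a y • v y) - b y • w y)
    (fun y hy => by rw [h y hy]; module) hx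
  rw [this, dirD_sub (da.fun_smul dv).fun_neg (db.fun_smul dw), dirD_neg, dirD_smul da dv, dirD_smul db dw]

theorem dirD_eq_smul_sub_add {u v w z : E → F} {a b c : E → ℝ} (hU : IsOpen U)
    (ha : ContDiffOn ℝ ∞ a U) (hb : ContDiffOn ℝ ∞ b U) (hc : ContDiffOn ℝ ∞ c U)
    (hv : ContDiffOn ℝ ∞ v U) (hw : ContDiffOn ℝ ∞ w U) (hz : ContDiffOn ℝ ∞ z U)
    (h : ∀ y ∈ U, u y = a y • v y - b y • w y + c y • z y) (hx : x ∈ U) :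
    dirD X u x = (dirD X a x • v x + a x • dirD X v x) - (dirD X b x • w x + b x • dirD X w x)
      + (dirD X c x • z x + c x • dirD X z x) := by
  have da := ha.differentiableAt_of_isOpen hU hx
  have db := hb.differentiableAt_of_isOpen hU hx
  have dc := hc.differentiableAt_of_isOpen hU hx
  have dv := hv.differentiableAt_of_isOpen hU hx
  have dw := hw.differentiableAt_of_isOpen hU hx
  have dz := hz.differentiableAt_of_isOpen hU hx
  rw [dirD_congr hU h hx, dirD_add ((da.fun_smul dv).fun_sub (db.fun_smul dw)) (dc.fun_smul dz),
    dirD_sub (da.fun_smul dv) (db.fun_smul dw), dirD_smul da dv, dirD_smul db dw, dirD_smul dc dz]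

end Products

namespace StructureEquations

variable {U : Set E} {e₁ e₂ e₃ : E → E} {f₁ f₂ f₃ n : E → F} {w₁ w₂ w₃ p q r μ : E → ℝ} {x : E}

/-- The complex structure is parallel. -/
theorem fderiv_quarterTurn (h : StructureEquations U e₁ e₂ e₃ f₁ f₂ f₃ n w₁ w₂ w₃ p q r μ)
    (hx : x ∈ U) (v : F) :
    fderiv ℝ (fun y => quarterTurn (f₁ y) (f₂ y) (f₃ y) (n y) v) x = 0 := by
  have d1 := h.smooth_f₁.differentiableAt_of_isOpen h.isOpen hx
  have d2 := h.smooth_f₂.differentiableAt_of_isOpen h.isOpen hx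
  have d3 := h.smooth_f₃.differentiableAt_of_isOpen h.isOpen hx
  have dn := h.smooth_n.differentiableAt_of_isOpen h.isOpen hx
  have c := differentiableAt_const (𝕜 := ℝ) (x := x) v
  have key : ∀ X : E → E, dirD X (fun y => quarterTurn (f₁ y) (f₂ y) (f₃ y) (n y) v) x =
      (inner ℝ (dirD X f₁ x) v • f₂ x + inner ℝ (f₁ x) v • dirD X f₂ x)
      - (inner ℝ (dirD X f₂ x) v • f₁ x + inner ℝ (f₂ x) v • dirD X f₁ x)
      + (inner ℝ (dirD X n x) v • f₃ x + inner ℝ (n x) v • dirD X f₃ x)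
      - (inner ℝ (dirD X f₃ x) v • n x + inner ℝ (f₃ x) v • dirD X n x) := by
    intro X
    simp only [quarterTurn_apply]
    rw [dirD_sub ((((d1.inner ℝ c).fun_smul d2).fun_sub ((d2.inner ℝ c).fun_smul d1)).fun_add
        ((dn.inner ℝ c).fun_smul d3)) ((d3.inner ℝ c).fun_smul dn),
      dirD_add (((d1.inner ℝ c).fun_smul d2).fun_sub ((d2.inner ℝ c).fun_smul d1)) ((dn.inner ℝ c).fun_smul d3),
      dirD_sub ((d1.inner ℝ c).fun_smul d2) ((d2.inner ℝ c).fun_smul d1),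
      dirD_inner_smul v d1 d2, dirD_inner_smul v d2 d1, dirD_inner_smul v dn d3,
      dirD_inner_smul v d3 dn]
  refine h.fderiv_eq_zero x hx _ ?_ ?_ ?_
  · rw [key, h.D₁f₁ x hx, h.D₁f₂ x hx, h.D₁f₃ x hx, h.D₁n x hx]
    simp only [inner_add_left, inner_sub_left, inner_smul_left, RCLike.conj_to_real]
    module
  · rw [key, h.D₂f₁ x hx, h.D₂f₂ x hx, h.D₂f₃ x hx, h.D₂n x hx]
    simp only [inner_add_left, inner_sub_left, inner_smul_left, RCLike.conj_to_real]
    module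
  · rw [key, h.D₃f₁ x hx, h.D₃f₂ x hx, h.D₃f₃ x hx, h.D₃n x hx]
    simp only [inner_smul_left, RCLike.conj_to_real]
    module

theorem dirD_r (h : StructureEquations U e₁ e₂ e₃ f₁ f₂ f₃ n w₁ w₂ w₃ p q r μ)
    (hx : x ∈ U) (X : E → E) : dirD X r x = -dirD X p x := by
  have := dirD_eq_zero_of_eqOn_const (X := X) h.isOpen h.trace hx
  rw [dirD_add (h.smooth_p.differentiableAt_of_isOpen h.isOpen hx)
    (h.smooth_r.differentiableAt_of_isOpen h.isOpen hx)] at this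
  linarith

/-- The Codazzi equation for `e₁, e₃`. -/
theorem codazzi₁₃ (h : StructureEquations U e₁ e₂ e₃ f₁ f₂ f₃ n w₁ w₂ w₃ p q r μ) (hx : x ∈ U) :
    dirD e₁ μ x = 0 ∧ dirD e₃ p x = q x * (μ x + 2 * w₃ x) ∧
      dirD e₃ q x = -q x ^ 2 + p x * r x + w₃ x * (r x - p x) - μ x * p x := by
  -- The Codazzi equations are the tangential components of the commutator identity applied to the
  -- normal.
  have k := h.comm₁₃ x hx n h.smooth_n
  rw [dirD_eq_neg_smul h.isOpen h.smooth_μ h.smooth_f₃ h.D₃n hx,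
    dirD_eq_neg_smul_sub h.isOpen h.smooth_p h.smooth_q h.smooth_f₁ h.smooth_f₂ h.D₁n hx,
    h.D₁n x hx, h.D₂n x hx, h.D₁f₃ x hx, h.D₃f₁ x hx, h.D₃f₂ x hx] at k
  have o := h.orth x hx
  have k1 := congrArg (inner ℝ (f₁ x)) k
  have k2 := congrArg (inner ℝ (f₂ x)) k
  have k3 := congrArg (inner ℝ (f₃ x)) k
  simp only [inner_add_right, inner_sub_right, inner_smul_right, inner_neg_right, o.aa, o.bb, o.cc,
    o.ab, o.ac, o.bc, o.ba, o.ca, o.cb] at k1 k2 k3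
  refine ⟨?_, ?_, ?_⟩ <;> linarith

/-- The Codazzi equation for `e₂, e₃`. -/
theorem codazzi₂₃ (h : StructureEquations U e₁ e₂ e₃ f₁ f₂ f₃ n w₁ w₂ w₃ p q r μ) (hx : x ∈ U) :
    dirD e₂ μ x = 0 ∧
      dirD e₃ q x = μ x * r x + w₃ x * (r x - p x) - p x * r x + q x ^ 2 := by
  have k := h.comm₂₃ x hx n h.smooth_n
  rw [dirD_eq_neg_smul h.isOpen h.smooth_μ h.smooth_f₃ h.D₃n hx,
    dirD_eq_neg_smul_sub h.isOpen h.smooth_q h.smooth_r h.smooth_f₁ h.smooth_f₂ h.D₂n hx,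
    h.D₁n x hx, h.D₂n x hx, h.D₂f₃ x hx, h.D₃f₁ x hx, h.D₃f₂ x hx] at k
  have o := h.orth x hx
  have k1 := congrArg (inner ℝ (f₁ x)) k
  have k3 := congrArg (inner ℝ (f₃ x)) k
  simp only [inner_add_right, inner_sub_right, inner_smul_right, inner_neg_right, o.aa, o.cc,
    o.ab, o.ac, o.ca, o.cb] at k1 k3
  refine ⟨?_, ?_⟩ <;> linarith

/-- The Codazzi equation for `e₁, e₂`. -/
theorem codazzi₁₂ (h : StructureEquations U e₁ e₂ e₃ f₁ f₂ f₃ n w₁ w₂ w₃ p q r μ) (hx : x ∈ U) :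
    dirD e₂ p x = dirD e₁ q x + w₁ x * (p x - r x) + 2 * w₂ x * q x ∧
      dirD e₁ p x + dirD e₂ q x = 2 * w₁ x * q x - w₂ x * (p x - r x) := by
  have k := h.comm₁₂ x hx n h.smooth_n
  rw [dirD_eq_neg_smul_sub h.isOpen h.smooth_p h.smooth_q h.smooth_f₁ h.smooth_f₂ h.D₁n hx,
    dirD_eq_neg_smul_sub h.isOpen h.smooth_q h.smooth_r h.smooth_f₁ h.smooth_f₂ h.D₂n hx,
    h.D₁n x hx, h.D₂n x hx, h.D₃n x hx, h.D₁f₁ x hx, h.D₁f₂ x hx, h.D₂f₁ x hx, h.D₂f₂ x hx,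
    h.dirD_r hx] at k
  have o := h.orth x hx
  have k1 := congrArg (inner ℝ (f₁ x)) k
  have k2 := congrArg (inner ℝ (f₂ x)) k
  simp only [inner_add_right, inner_sub_right, inner_smul_right, inner_neg_right, o.aa, o.bb, o.ad,
    o.bd, o.ab, o.ac, o.bc, o.ba] at k1 k2
  refine ⟨?_, ?_⟩ <;> linarith

/-- The Gauss equation for `e₁, e₂`. -/
theorem gauss₁₂ (h : StructureEquations U e₁ e₂ e₃ f₁ f₂ f₃ n w₁ w₂ w₃ p q r μ) (hx : x ∈ U) :
    dirD e₁ w₂ x - dirD e₂ w₁ x + w₁ x ^ 2 + w₂ x ^ 2 - w₃ x = -2 * (p x * r x - q x ^ 2) := by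
  -- The Gauss equation is the `f₂` component of the commutator identity applied to `f₁`.
  have k := h.comm₁₂ x hx f₁ h.smooth_f₁
  rw [dirD_eq_smul_sub_add h.isOpen h.smooth_w₁ h.smooth_q h.smooth_p h.smooth_f₂ h.smooth_f₃
      h.smooth_n h.D₁f₁ hx,
    dirD_eq_smul_sub_add h.isOpen h.smooth_w₂ h.smooth_r h.smooth_q h.smooth_f₂ h.smooth_f₃
      h.smooth_n h.D₂f₁ hx,
    h.D₁n x hx, h.D₂n x hx, h.D₁f₁ x hx, h.D₁f₂ x hx, h.D₂f₁ x hx, h.D₂f₂ x hx, h.D₁f₃ x hx,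
    h.D₂f₃ x hx, h.D₃f₁ x hx] at k
  have o := h.orth x hx
  have k2 := congrArg (inner ℝ (f₂ x)) k
  simp only [inner_add_right, inner_sub_right, inner_smul_right, o.bb, o.bd, o.bc, o.ba] at k2
  linarith

/-- Both Codazzi equations involving `e₃` compute the derivative of `q` along `e₃`. Their difference
contains `μ (p + r) = μ`. -/
theorem mu_eq (h : StructureEquations U e₁ e₂ e₃ f₁ f₂ f₃ n w₁ w₂ w₃ p q r μ) (hx : x ∈ U) :
    μ x = 2 * (p x * r x - q x ^ 2) := by
  have h1 := (h.codazzi₁₃ hx).2.2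
  have h2 := (h.codazzi₂₃ hx).2
  have h3 := h.trace x hx
  linear_combination h1 - h2 + (-μ x) * h3

/-- The derivatives along `e₁` and `e₂` vanish by Codazzi, and the bracket of `e₁` and `e₂` reaches
`e₃`. -/
theorem fderiv_mu (h : StructureEquations U e₁ e₂ e₃ f₁ f₂ f₃ n w₁ w₂ w₃ p q r μ) (hx : x ∈ U) :
    fderiv ℝ μ x = 0 := by
  have h1 : ∀ y ∈ U, dirD e₁ μ y = 0 := fun y hy => (h.codazzi₁₃ hy).1
  have h2 : ∀ y ∈ U, dirD e₂ μ y = 0 := fun y hy => (h.codazzi₂₃ hy).1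
  have k := h.comm₁₂' x hx μ h.smooth_μ
  rw [dirD_eq_zero_of_eqOn_const h.isOpen h1 hx, dirD_eq_zero_of_eqOn_const h.isOpen h2 hx,
    h1 x hx, h2 x hx] at k
  exact h.fderiv_eq_zero' x hx μ (h1 x hx) (h2 x hx) (by linarith)

/-- Off the umbilical points the second fundamental form rotates at twice the speed of the frame. -/
theorem dirD_shape (h : StructureEquations U e₁ e₂ e₃ f₁ f₂ f₃ n w₁ w₂ w₃ p q r μ) (hx : x ∈ U)
    (hμ : μ x ≠ 1 / 2) :
    dirD e₁ p x = 2 * (w₁ x * q x) ∧ dirD e₂ p x = 2 * (w₂ x * q x) ∧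
    dirD e₁ q x = -2 * (w₁ x * (p x - 1 / 2)) ∧ dirD e₂ q x = -2 * (w₂ x * (p x - 1 / 2)) ∧
    dirD e₃ p x = (2 * w₃ x + μ x) * q x ∧ dirD e₃ q x = -(2 * w₃ x + μ x) * (p x - 1 / 2) := by
  have dp := h.smooth_p.differentiableAt_of_isOpen h.isOpen hx
  have dq := h.smooth_q.differentiableAt_of_isOpen h.isOpen hx
  have hr : r x = 1 - p x := by linarith [h.trace x hx]
  have hm := h.mu_eq hx
  -- As `μ = 1/2 - 2((p - 1/2)² + q²)` is constant, `(p - 1/2, q)` has constant length; this is the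
  -- derivative of that fact.
  have rot : ∀ X : E → E, (p x - 1 / 2) * dirD X p x + q x * dirD X q x = 0 := by
    intro X
    have e := dirD_congr (X := X) h.isOpen (u := μ)
      (v := fun y => 2 * (p y * (1 - p y) - q y * q y)) (fun y hy => by
        rw [h.mu_eq hy, show r y = 1 - p y by linarith [h.trace y hy]]; ring) hx
    have e0 : dirD X μ x = 0 := by simp [dirD, h.fderiv_mu hx]
    have d1p := (differentiableAt_const (1 : ℝ) (𝕜 := ℝ)).fun_sub dp
    rw [e0, dirD_mul (differentiableAt_const _) ((dp.fun_mul d1p).fun_sub (dq.fun_mul dq)), dirD_const,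
      dirD_sub (dp.fun_mul d1p) (dq.fun_mul dq), dirD_mul dp d1p, dirD_mul dq dq,
      dirD_sub (differentiableAt_const _) dp, dirD_const] at e
    linarith
  obtain ⟨c1, c2⟩ := h.codazzi₁₂ hx
  obtain ⟨-, c3, c4⟩ := h.codazzi₁₃ hx
  rw [hr] at c1 c2 c4 hm
  have hs : (p x - 1 / 2) ^ 2 + q x ^ 2 ≠ 0 := by
    intro h0
    apply hμ
    linarith
  have r1 := rot e₁
  have r2 := rot e₂
  -- Along `e₁` and `e₂`, the equations `r1, r2, c1, c2` form a linear system for four derivatives.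
  -- It is solved after multiplication by the squared length, nonzero by `hs`. The `e₃` derivatives
  -- are read off from Codazzi.
  refine ⟨?_, ?_, ?_, ?_, ?_, ?_⟩
  · refine mul_left_cancel₀ hs ?_
    linear_combination (p x - 1 / 2) * r1 + q x ^ 2 * c2 + (p x - 1 / 2) * q x * c1 - q x * r2
  · refine mul_left_cancel₀ hs ?_
    linear_combination (p x - 1 / 2) * r2 + q x ^ 2 * c1 - (p x - 1 / 2) * q x * c2 + q x * r1
  · refine mul_left_cancel₀ hs ?_
    linear_combination q x * r1 - (p x - 1 / 2) ^ 2 * c1 - (p x - 1 / 2) * q x * c2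
      + (p x - 1 / 2) * r2
  · refine mul_left_cancel₀ hs ?_
    linear_combination q x * r2 + (p x - 1 / 2) ^ 2 * c2 - (p x - 1 / 2) * q x * c1
      - (p x - 1 / 2) * r1
  · linarith
  · linarith

/-- Let `Ω = e₁w₂ - e₂w₁ + w₁² + w₂² - w₃`. Applying the commutator of `e₁` and `e₂` to the rotating
vector `(p - 1/2, q)`, which is nonzero, gives `2Ω = μ`, the term `μ` being the excess speed along
`e₃` in `dirD_shape`. The Gauss equation gives `Ω = -μ`. Hence `3μ = 0`. -/
theorem mu_eq_zero (h : StructureEquations U e₁ e₂ e₃ f₁ f₂ f₃ n w₁ w₂ w₃ p q r μ) (hx : x ∈ U)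
    (hμ : ∀ y ∈ U, μ y ≠ 1 / 2) : μ x = 0 := by
  have dp := h.smooth_p.differentiableAt_of_isOpen h.isOpen hx
  have dq := h.smooth_q.differentiableAt_of_isOpen h.isOpen hx
  have d1 := h.smooth_w₁.differentiableAt_of_isOpen h.isOpen hx
  have d2 := h.smooth_w₂.differentiableAt_of_isOpen h.isOpen hx
  have ds := dp.fun_sub (differentiableAt_const (1 / 2 : ℝ))
  have hr : r x = 1 - p x := by linarith [h.trace x hx]
  have hm := h.mu_eq hx
  have hs : (p x - 1 / 2) ^ 2 + q x ^ 2 ≠ 0 := by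
    intro h0
    apply hμ x hx
    rw [hr] at hm
    linarith
  obtain ⟨a1, a2, a3, a4, a5, a6⟩ := h.dirD_shape hx (hμ x hx)
  have kp := h.comm₁₂' x hx p h.smooth_p
  have kq := h.comm₁₂' x hx q h.smooth_q
  rw [dirD_congr h.isOpen (fun y hy => (h.dirD_shape hy (hμ y hy)).2.1) hx,
    dirD_congr h.isOpen (fun y hy => (h.dirD_shape hy (hμ y hy)).1) hx,
    dirD_mul (differentiableAt_const _) (d2.fun_mul dq), dirD_mul (differentiableAt_const _) (d1.fun_mul dq),
    dirD_mul d2 dq, dirD_mul d1 dq, dirD_const, dirD_const, a1, a2, a3, a4, a5] at kp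
  rw [dirD_congr h.isOpen (fun y hy => (h.dirD_shape hy (hμ y hy)).2.2.2.1) hx,
    dirD_congr h.isOpen (fun y hy => (h.dirD_shape hy (hμ y hy)).2.2.1) hx,
    dirD_mul (differentiableAt_const _) (d2.fun_mul ds), dirD_mul (differentiableAt_const _) (d1.fun_mul ds),
    dirD_mul d2 ds, dirD_mul d1 ds, dirD_sub dp (differentiableAt_const _),
    dirD_sub dp (differentiableAt_const _), dirD_const, dirD_const, dirD_const, dirD_const,
    a1, a2, a3, a4, a6] at kq
  have hg := h.gauss₁₂ hx
  refine mul_left_cancel₀ hs ?_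
  linear_combination (-1 / 3 : ℝ) * (q x * kp) + (1 / 3 : ℝ) * ((p x - 1 / 2) * kq)
    + (2 / 3 : ℝ) * ((p x - 1 / 2) ^ 2 + q x ^ 2) * hg
    - (-2 / 3 : ℝ) * ((p x - 1 / 2) ^ 2 + q x ^ 2) * hm

end StructureEquations
end LocalClassification

/-! ### The local models: sphere and cylinder. -/

section LocalModel

variable {E F : Type*} [NormedAddCommGroup E] [NormedSpace ℝ E]
  [NormedAddCommGroup F] [InnerProductSpace ℝ F]

namespace StructureEquations

variable {U : Set E} {e₁ e₂ e₃ : E → E} {f₁ f₂ f₃ n : E → F} {w₁ w₂ w₃ p q r μ : E → ℝ} {x : E}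

/-- If no point is umbilical, the plane spanned by the normal and the principal direction of
curvature `1` is parallel. -/
theorem fderiv_symmMap (h : StructureEquations U e₁ e₂ e₃ f₁ f₂ f₃ n w₁ w₂ w₃ p q r μ)
    (hx : x ∈ U) (hμ : ∀ y ∈ U, μ y ≠ 1 / 2) (v : F) :
    fderiv ℝ (fun y => symmMap (f₁ y) (f₂ y) (n y) (p y) (q y) (r y) v) x = 0 := by
  have d1 := h.smooth_f₁.differentiableAt_of_isOpen h.isOpen hx
  have d2 := h.smooth_f₂.differentiableAt_of_isOpen h.isOpen hx
  have dn := h.smooth_n.differentiableAt_of_isOpen h.isOpen hx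
  have dp := h.smooth_p.differentiableAt_of_isOpen h.isOpen hx
  have dq := h.smooth_q.differentiableAt_of_isOpen h.isOpen hx
  have dr := h.smooth_r.differentiableAt_of_isOpen h.isOpen hx
  have c := differentiableAt_const (𝕜 := ℝ) (x := x) v
  have key : ∀ X : E → E,
      dirD X (fun y => symmMap (f₁ y) (f₂ y) (n y) (p y) (q y) (r y) v) x =
      inner ℝ (dirD X f₁ x) v • (p x • f₁ x + q x • f₂ x)
      + inner ℝ (f₁ x) v • (dirD X p x • f₁ x + p x • dirD X f₁ x
          + (dirD X q x • f₂ x + q x • dirD X f₂ x))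
      + (inner ℝ (dirD X f₂ x) v • (q x • f₁ x + r x • f₂ x)
      + inner ℝ (f₂ x) v • (dirD X q x • f₁ x + q x • dirD X f₁ x
          + (dirD X r x • f₂ x + r x • dirD X f₂ x)))
      + (inner ℝ (dirD X n x) v • n x + inner ℝ (n x) v • dirD X n x) := by
    intro X
    have k1 := (dp.fun_smul d1).fun_add (dq.fun_smul d2)
    have k2 := (dq.fun_smul d1).fun_add (dr.fun_smul d2)
    simp only [symmMap_apply]
    rw [dirD_add (((d1.inner ℝ c).fun_smul k1).fun_add ((d2.inner ℝ c).fun_smul k2))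
        ((dn.inner ℝ c).fun_smul dn),
      dirD_add ((d1.inner ℝ c).fun_smul k1) ((d2.inner ℝ c).fun_smul k2),
      dirD_inner_smul v d1 k1, dirD_inner_smul v d2 k2, dirD_inner_smul v dn dn,
      dirD_add (dp.fun_smul d1) (dq.fun_smul d2), dirD_add (dq.fun_smul d1) (dr.fun_smul d2),
      dirD_smul dp d1, dirD_smul dq d2, dirD_smul dq d1, dirD_smul dr d2]
  have hm := h.mu_eq hx
  have hm0 := h.mu_eq_zero hx hμ
  obtain ⟨a1, a2, a3, a4, a5, a6⟩ := h.dirD_shape hx (hμ x hx)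
  have hr : r x = 1 - p x := by linarith [h.trace x hx]
  -- With `μ = 0` the formula for `μ` says that the block has determinant zero.
  have hd : q x * q x = p x * (1 - p x) := by rw [← hr]; linarith
  refine h.fderiv_eq_zero x hx _ ?_ ?_ ?_
  · rw [key, h.D₁f₁ x hx, h.D₁f₂ x hx, h.D₁n x hx, h.dirD_r hx, a1, a3, hr]
    simp only [inner_add_left, inner_sub_left, inner_smul_left, RCLike.conj_to_real]
    linear_combination (norm := module)
      hd • (inner ℝ (f₁ x) v • n x + inner ℝ (n x) v • f₁ x - inner ℝ (f₃ x) v • f₂ x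
        - inner ℝ (f₂ x) v • f₃ x)
  · rw [key, h.D₂f₁ x hx, h.D₂f₂ x hx, h.D₂n x hx, h.dirD_r hx, a2, a4, hr]
    simp only [inner_add_left, inner_sub_left, inner_smul_left, RCLike.conj_to_real]
    linear_combination (norm := module)
      hd • (inner ℝ (f₂ x) v • n x + inner ℝ (n x) v • f₂ x + inner ℝ (f₃ x) v • f₁ x
        + inner ℝ (f₁ x) v • f₃ x)
  · rw [key, h.D₃f₁ x hx, h.D₃f₂ x hx, h.D₃n x hx, h.dirD_r hx, a5, a6, hr, hm0]
    simp only [inner_smul_left, RCLike.conj_to_real]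
    module

theorem contDiffOn_quarterTurn
    (h : StructureEquations U e₁ e₂ e₃ f₁ f₂ f₃ n w₁ w₂ w₃ p q r μ) (v : F) :
    ContDiffOn ℝ ∞ (fun y => quarterTurn (f₁ y) (f₂ y) (f₃ y) (n y) v) U := by
  simp only [quarterTurn_apply]
  have c : ContDiffOn ℝ ∞ (fun _ : E => v) U := contDiffOn_const
  exact ((((h.smooth_f₁.inner ℝ c).smul h.smooth_f₂).sub ((h.smooth_f₂.inner ℝ c).smul
    h.smooth_f₁)).add ((h.smooth_n.inner ℝ c).smul h.smooth_f₃)).sub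
      ((h.smooth_f₃.inner ℝ c).smul h.smooth_n)

theorem contDiffOn_symmMap
    (h : StructureEquations U e₁ e₂ e₃ f₁ f₂ f₃ n w₁ w₂ w₃ p q r μ) (v : F) :
    ContDiffOn ℝ ∞ (fun y => symmMap (f₁ y) (f₂ y) (n y) (p y) (q y) (r y) v) U := by
  simp only [symmMap_apply]
  have c : ContDiffOn ℝ ∞ (fun _ : E => v) U := contDiffOn_const
  exact (((h.smooth_f₁.inner ℝ c).smul ((h.smooth_p.smul h.smooth_f₁).add
      (h.smooth_q.smul h.smooth_f₂))).add
    ((h.smooth_f₂.inner ℝ c).smul ((h.smooth_q.smul h.smooth_f₁).add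
      (h.smooth_r.smul h.smooth_f₂)))).add ((h.smooth_n.inner ℝ c).smul h.smooth_n)

end StructureEquations

theorem eq_of_fderiv_eq_zero {U : Set E} {u : E → F} (hU : IsOpen U) (hU' : IsPreconnected U)
    (hu : ContDiffOn ℝ ∞ u U) (h : ∀ x ∈ U, fderiv ℝ u x = 0) {x y : E} (hx : x ∈ U) (hy : y ∈ U) :
    u x = u y :=
  hU.is_const_of_fderiv_eq_zero hU' (hu.differentiableOn (by simp)) h hx hy

namespace AdaptedFrame

variable {U W : Set E} {f g : E → F} {e₁ e₂ e₃ : E → E}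

theorem mono (h : AdaptedFrame U f g e₁ e₂ e₃) (hW : IsOpen W) (hWU : W ⊆ U) :
    AdaptedFrame W f g e₁ e₂ e₃ :=
  ⟨hW, h.2.mono hWU, h.3.mono hWU, h.4.mono hWU, h.5.mono hWU, h.6.mono hWU,
    fun x hx => h.7 x (hWU hx), fun x hx => h.8 x (hWU hx), fun x hx => h.9 x (hWU hx),
    fun x hx => h.10 x (hWU hx), fun x hx => h.11 x (hWU hx), fun x hx => h.12 x (hWU hx),
    fun x hx => h.13 x (hWU hx), fun x hx => h.14 x (hWU hx), fun x hx => h.15 x (hWU hx),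
    fun x hx => h.16 x (hWU hx), fun x hx => h.17 x (hWU hx)⟩

/-- Locally, the immersion is complex tangential for a constant complex structure `J`, and its
image lies on a sphere or on a cylinder with normal `-J f₃`. -/
theorem exists_model (h : AdaptedFrame U f g e₁ e₂ e₃) (hE : Module.finrank ℝ E = 3)
    (hF : Module.finrank ℝ F = 4) {x₀ : E} (hx₀ : x₀ ∈ U) :
    ∃ W ⊆ U, IsOpen W ∧ x₀ ∈ W ∧ ∃ (J P : F →L[ℝ] F) (r : ℝ), HypersurfaceModel J P r ∧
      ∀ x ∈ W, J (dirD e₁ f x) = dirD e₂ f x ∧ P (J (dirD e₃ f x)) = J (dirD e₃ f x) ∧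
        fderiv ℝ (fun y => P (f y) - r • J (dirD e₃ f y)) x = 0 := by
  obtain ⟨ε, hε, hball⟩ := Metric.isOpen_iff.1 h.isOpen x₀ hx₀
  -- A ball is connected, so a vanishing differential on it means constancy.
  set W := Metric.ball x₀ ε
  have hxW : x₀ ∈ W := Metric.mem_ball_self hε
  have hWc : IsPreconnected W := (convex_ball x₀ ε).isPreconnected
  have hA := h.mono Metric.isOpen_ball hball
  have hS := hA.structureEquations hE hF
  set μ : E → ℝ := fun x => inner ℝ (dirD e₃ g x) (dirD e₃ (dirD e₃ f) x) with hμdef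
  set w₁ : E → ℝ := fun x => inner ℝ (dirD e₂ f x) (dirD e₁ (dirD e₁ f) x)
  set w₂ : E → ℝ := fun x => inner ℝ (dirD e₂ f x) (dirD e₂ (dirD e₁ f) x)
  set w₃ : E → ℝ := fun x => inner ℝ (dirD e₂ f x) (dirD e₃ (dirD e₁ f) x)
  set p : E → ℝ := fun x => inner ℝ (dirD e₃ g x) (dirD e₁ (dirD e₁ f) x)
  set q : E → ℝ := fun x => inner ℝ (dirD e₃ g x) (dirD e₁ (dirD e₂ f) x)
  set r : E → ℝ := fun x => inner ℝ (dirD e₃ g x) (dirD e₂ (dirD e₂ f) x)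
  clear_value μ w₁ w₂ w₃ p q r
  set f₁ := dirD e₁ f with hf₁
  set f₂ := dirD e₂ f with hf₂
  set f₃ := dirD e₃ f with hf₃
  set n := dirD e₃ g
  refine ⟨W, hball, Metric.isOpen_ball, hxW, quarterTurn (f₁ x₀) (f₂ x₀) (f₃ x₀) (n x₀), ?_⟩
  have hJ : ∀ x ∈ W, quarterTurn (f₁ x₀) (f₂ x₀) (f₃ x₀) (n x₀)
      = quarterTurn (f₁ x) (f₂ x) (f₃ x) (n x) := fun x hx => by
    ext1 v
    exact eq_of_fderiv_eq_zero hS.isOpen hWc (hS.contDiffOn_quarterTurn v)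
      (fun y hy => hS.fderiv_quarterTurn hy v) hxW hx
  have hJ1 : ∀ x ∈ W, quarterTurn (f₁ x₀) (f₂ x₀) (f₃ x₀) (n x₀) (f₁ x) = f₂ x := fun x hx => by
    have o := hS.orth x hx
    rw [hJ x hx, quarterTurn_apply, o.aa, o.ba, o.ca, o.da]
    module
  have hJ3 : ∀ x ∈ W, quarterTurn (f₁ x₀) (f₂ x₀) (f₃ x₀) (n x₀) (f₃ x) = -n x := fun x hx => by
    have o := hS.orth x hx
    rw [hJ x hx, quarterTurn_apply, o.ac, o.bc, o.cc, o.dc]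
    module
  have hμc : ∀ x ∈ W, μ x = μ x₀ := fun x hx =>
    eq_of_fderiv_eq_zero hS.isOpen hWc hS.smooth_μ (fun y hy => hS.fderiv_mu hy) hx hxW
  -- Since `J f₃ = -n`, the function under study is `P f + R n`. Its constancy says that `P` is `R`
  -- times the shape operator on tangent vectors.
  have hdir : ∀ (P : F →L[ℝ] F) (R : ℝ) (X : E → E), ∀ x ∈ W,
      dirD X (fun y => P (f y) - R • quarterTurn (f₁ x₀) (f₂ x₀) (f₃ x₀) (n x₀) (f₃ y)) x
        = P (dirD X f x) + R • dirD X n x := by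
    intro P R X x hx
    have df := hA.smooth_f.differentiableAt_of_isOpen hS.isOpen hx
    have dn := hS.smooth_n.differentiableAt_of_isOpen hS.isOpen hx
    have cR := differentiableAt_const (𝕜 := ℝ) (x := x) R
    have e : EqOn (fun y => P (f y) - R • quarterTurn (f₁ x₀) (f₂ x₀) (f₃ x₀) (n x₀) (f₃ y))
      (fun y => P (f y) + R • n y) W := fun y hy => by
        simp only [hJ3 y hy, smul_neg, sub_neg_eq_add]
    rw [dirD_congr hS.isOpen e hx,
      dirD_add (u := fun y => P (f y)) (P.differentiableAt.comp x df) (cR.fun_smul dn),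
      dirD_clm P df, dirD_smul cR dn,
      dirD_const]
    simp
  have hfin : ∀ (P : F →L[ℝ] F) (R : ℝ), (∀ x ∈ W, P (n x) = n x) →
      (∀ x ∈ W, P (f₁ x) + R • dirD e₁ n x = 0) → (∀ x ∈ W, P (f₂ x) + R • dirD e₂ n x = 0) →
      (∀ x ∈ W, P (f₃ x) + R • dirD e₃ n x = 0) →
      ∀ x ∈ W, quarterTurn (f₁ x₀) (f₂ x₀) (f₃ x₀) (n x₀) (f₁ x) = f₂ x ∧
        P (quarterTurn (f₁ x₀) (f₂ x₀) (f₃ x₀) (n x₀) (f₃ x)) =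
          quarterTurn (f₁ x₀) (f₂ x₀) (f₃ x₀) (n x₀) (f₃ x) ∧
        fderiv ℝ (fun y => P (f y)
          - R • quarterTurn (f₁ x₀) (f₂ x₀) (f₃ x₀) (n x₀) (f₃ y)) x = 0 := by
    intro P R h0 h1 h2 h3 x hx
    refine ⟨hJ1 x hx, ?_, hS.fderiv_eq_zero x hx _ ?_ ?_ ?_⟩
    · rw [hJ3 x hx, map_neg, h0 x hx]
    · rw [hdir P R e₁ x hx]; exact h1 x hx
    · rw [hdir P R e₂ x hx]; exact h2 x hx
    · rw [hdir P R e₃ x hx]; exact h3 x hx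
  -- The value `1/2` makes the sum of squares `(p - 1/2)² + q²` vanish, so all three principal
  -- curvatures are `1/2`. Any other value excludes umbilical points throughout the ball.
  by_cases hcase : μ x₀ = 1 / 2
  · refine ⟨ContinuousLinearMap.id ℝ F, 2, (hS.orth x₀ hxW).sphereModel hF, ?_⟩
    have hpq : ∀ x ∈ W, p x = 1 / 2 ∧ q x = 0 ∧ r x = 1 / 2 := by
      intro x hx
      have h1 := hS.mu_eq hx
      rw [hμc x hx, hcase] at h1
      have h2 := hS.trace x hx
      have h3 : r x = 1 - p x := by linarith
      rw [h3] at h1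
      have h4 : (p x - 1 / 2) ^ 2 + q x ^ 2 = 0 := by linarith
      have h5 : (p x - 1 / 2) ^ 2 = 0 := by nlinarith [sq_nonneg (p x - 1 / 2), sq_nonneg (q x)]
      have h6 : q x ^ 2 = 0 := by nlinarith [sq_nonneg (p x - 1 / 2), sq_nonneg (q x)]
      rw [sq_eq_zero_iff] at h5 h6
      exact ⟨by linarith, h6, by linarith⟩
    apply hfin
    · intro x hx; rfl
    · intro x hx
      obtain ⟨a1, a2, a3⟩ := hpq x hx
      rw [hS.D₁n x hx, a1, a2, ContinuousLinearMap.id_apply]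
      module
    · intro x hx
      obtain ⟨a1, a2, a3⟩ := hpq x hx
      rw [hS.D₂n x hx, a2, a3, ContinuousLinearMap.id_apply]
      module
    · intro x hx
      rw [hS.D₃n x hx, hμc x hx, hcase, ContinuousLinearMap.id_apply]
      module
  · have hμ : ∀ y ∈ W, μ y ≠ 1 / 2 := fun y hy => by rw [hμc y hy]; exact hcase
    have hP : ∀ x ∈ W, symmMap (f₁ x₀) (f₂ x₀) (n x₀) (p x₀) (q x₀) (r x₀)
        = symmMap (f₁ x) (f₂ x) (n x) (p x) (q x) (r x) := fun x hx => by
      ext1 v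
      exact eq_of_fderiv_eq_zero hS.isOpen hWc (hS.contDiffOn_symmMap v)
        (fun y hy => hS.fderiv_symmMap hy hμ v) hxW hx
    have hdet : p x₀ * r x₀ = q x₀ ^ 2 := by
      have h1 := hS.mu_eq hxW
      rw [hS.mu_eq_zero hxW hμ] at h1
      linarith
    refine ⟨symmMap (f₁ x₀) (f₂ x₀) (n x₀) (p x₀) (q x₀) (r x₀), 1,
      (hS.orth x₀ hxW).cylinderModel hF (hS.trace x₀ hxW) hdet, ?_⟩
    apply hfin
    · intro x hx
      have o := hS.orth x hx
      rw [hP x hx, symmMap_apply, o.ad, o.bd, o.dd]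
      module
    · intro x hx
      have o := hS.orth x hx
      rw [hP x hx, symmMap_apply, o.aa, o.ba, o.da, hS.D₁n x hx]
      module
    · intro x hx
      have o := hS.orth x hx
      rw [hP x hx, symmMap_apply, o.ab, o.bb, o.db, hS.D₂n x hx]
      module
    · intro x hx
      have o := hS.orth x hx
      rw [hP x hx, symmMap_apply, o.ac, o.bc, o.dc, hS.D₃n x hx, hS.mu_eq_zero hx hμ]
      module

end AdaptedFrame
end LocalModel

/-! ### Real and imaginary parts in a complexification. -/

section Complexification

variable {V W : Type*} [AddCommGroup V] [Module ℝ V] [AddCommGroup W] [Module ℝ W]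

@[simp] theorem cRe_tmul (z : ℂ) (v : V) : cRe (z ⊗ₜ[ℝ] v) = z.re • v := by simp [cRe]
@[simp] theorem cIm_tmul (z : ℂ) (v : V) : cIm (z ⊗ₜ[ℝ] v) = z.im • v := by simp [cIm]

theorem one_tmul_cRe_add (Z : ℂ ⊗[ℝ] V) :
    (1 : ℂ) ⊗ₜ[ℝ] cRe Z + Complex.I ⊗ₜ[ℝ] cIm Z = Z := by
  induction Z using TensorProduct.induction_on with
  | zero => simp
  | add x y hx hy =>
    rw [map_add, map_add, TensorProduct.tmul_add, TensorProduct.tmul_add]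
    conv_rhs => rw [← hx, ← hy]
    abel
  | tmul z v =>
    simp only [cRe_tmul, cIm_tmul]
    rw [← TensorProduct.smul_tmul, ← TensorProduct.smul_tmul, ← TensorProduct.add_tmul]
    congr 1
    apply Complex.ext <;> simp

theorem complexification_ext {Z Z' : ℂ ⊗[ℝ] V} (h1 : cRe Z = cRe Z') (h2 : cIm Z = cIm Z') :
    Z = Z' := by
  rw [← one_tmul_cRe_add Z, ← one_tmul_cRe_add Z', h1, h2]

theorem cRe_smul (c : ℂ) (Z : ℂ ⊗[ℝ] V) : cRe (c • Z) = c.re • cRe Z - c.im • cIm Z := by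
  induction Z using TensorProduct.induction_on with
  | zero => simp
  | add x y hx hy => simp only [smul_add, map_add, hx, hy]; abel
  | tmul z v => simp [TensorProduct.smul_tmul', sub_smul, mul_smul]

theorem cIm_smul (c : ℂ) (Z : ℂ ⊗[ℝ] V) : cIm (c • Z) = c.re • cIm Z + c.im • cRe Z := by
  induction Z using TensorProduct.induction_on with
  | zero => simp
  | add x y hx hy => simp only [smul_add, map_add, hx, hy]; abel
  | tmul z v => simp [TensorProduct.smul_tmul', add_smul, mul_smul]

@[simp] theorem cRe_cConj (Z : ℂ ⊗[ℝ] V) : cRe (cConj Z) = cRe Z := by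
  induction Z using TensorProduct.induction_on with
  | zero => simp
  | add x y hx hy => simp only [map_add, hx, hy]
  | tmul z v => simp [cConj]

@[simp] theorem cIm_cConj (Z : ℂ ⊗[ℝ] V) : cIm (cConj Z) = -cIm Z := by
  induction Z using TensorProduct.induction_on with
  | zero => simp
  | add x y hx hy => simp only [map_add, hx, hy, neg_add]
  | tmul z v => simp [cConj]

theorem cRe_baseChange (L : V →ₗ[ℝ] W) (Z : ℂ ⊗[ℝ] V) : cRe (L.baseChange ℂ Z) = L (cRe Z) := by
  induction Z using TensorProduct.induction_on with
  | zero => simp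
  | add x y hx hy => simp only [map_add, hx, hy]
  | tmul z v => simp

theorem cIm_baseChange (L : V →ₗ[ℝ] W) (Z : ℂ ⊗[ℝ] V) : cIm (L.baseChange ℂ Z) = L (cIm Z) := by
  induction Z using TensorProduct.induction_on with
  | zero => simp
  | add x y hx hy => simp only [map_add, hx, hy]
  | tmul z v => simp

theorem baseChange_eq_zero_iff (L : V →ₗ[ℝ] W) (Z : ℂ ⊗[ℝ] V) :
    L.baseChange ℂ Z = 0 ↔ L (cRe Z) = 0 ∧ L (cIm Z) = 0 := by
  constructor
  · intro h
    rw [← cRe_baseChange, ← cIm_baseChange, h]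
    simp
  · rintro ⟨h1, h2⟩
    apply complexification_ext
    · rw [cRe_baseChange, h1, map_zero]
    · rw [cIm_baseChange, h2, map_zero]

theorem mem_holTangent_iff {V : Type*} [AddCommGroup V] [Module ℂ V] [Module ℝ V]
    [IsScalarTower ℝ ℂ V] (Z : ℂ ⊗[ℝ] V) :
    Z ∈ holTangent V ↔ cIm Z = -(Complex.I • cRe Z) := by
  have hm : ∀ v : V, mulI V v = Complex.I • v := fun v => rfl
  have hII : ∀ v : V, Complex.I • Complex.I • v = -v := fun v => by
    rw [smul_smul, Complex.I_mul_I, neg_one_smul]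
  rw [holTangent, LinearMap.mem_ker, LinearMap.sub_apply, sub_eq_zero, LinearMap.smul_apply,
    LinearMap.id_apply]
  constructor
  · intro h
    have := congrArg cRe h
    rw [cRe_baseChange, cRe_smul, hm] at this
    simp only [Complex.I_re, Complex.I_im, zero_smul, one_smul, zero_sub] at this
    rw [this, neg_neg]
  · intro h
    apply complexification_ext
    · rw [cRe_baseChange, cRe_smul, hm, h]
      simp
    · rw [cIm_baseChange, cIm_smul, hm, h]
      simp [hII]

end Complexification

/-! ### Pointwise linear algebra of the pseudohermitian structure. -/

section Pointwise

variable {E : Type*} [NormedAddCommGroup E] [NormedSpace ℝ E]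
variable {M : Type*} [TopologicalSpace M] [ChartedSpace E M]

theorem map_swap_two (η : E [⋀^Fin 2]→L[ℝ] ℝ) (a b : E) : η ![a, b] = -η ![b, a] := by
  have h := η.toAlternatingMap.map_swap ![b, a] (i := 0) (j := 1) (by simp)
  refine Eq.trans (congrArg η ?_) h
  funext i
  fin_cases i <;> rfl

section dForm

variable (θ : ∀ y : M, TangentSpace 𝓘(ℝ, E) y →L[ℝ] ℝ) (x : M)

theorem dForm_eq (u v : TangentSpace 𝓘(ℝ, E) x) :
    dForm θ x u v =
      (extDeriv (fun e => ContinuousAlternatingMap.ofSubsingleton ℝ E ℝ (0 : Fin 1)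
        (chartForm θ x e)) (extChartAt 𝓘(ℝ, E) x x))
        ![mfderiv 𝓘(ℝ, E) 𝓘(ℝ, E) (extChartAt 𝓘(ℝ, E) x) x u,
          mfderiv 𝓘(ℝ, E) 𝓘(ℝ, E) (extChartAt 𝓘(ℝ, E) x) x v] := rfl

theorem dForm_add_left (u u' v : TangentSpace 𝓘(ℝ, E) x) :
    dForm θ x (u + u') v = dForm θ x u v + dForm θ x u' v := by
  rw [dForm_eq, dForm_eq, dForm_eq, map_add]
  exact ContinuousAlternatingMap.vecCons_add _ _ _ _

theorem dForm_smul_left (c : ℝ) (u v : TangentSpace 𝓘(ℝ, E) x) :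
    dForm θ x (c • u) v = c * dForm θ x u v := by
  rw [dForm_eq, dForm_eq, map_smul]
  exact ContinuousAlternatingMap.vecCons_smul _ _ _ _

theorem dForm_self (u : TangentSpace 𝓘(ℝ, E) x) : dForm θ x u u = 0 := by
  rw [dForm_eq]
  exact ContinuousAlternatingMap.map_eq_zero_of_eq _ _ (i := 0) (j := 1) rfl (by simp)

theorem dForm_swap (u v : TangentSpace 𝓘(ℝ, E) x) : dForm θ x u v = -dForm θ x v u :=
  map_swap_two _ _ _

theorem dForm_add_right (u v v' : TangentSpace 𝓘(ℝ, E) x) :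
    dForm θ x u (v + v') = dForm θ x u v + dForm θ x u v' := by
  rw [dForm_swap, dForm_add_left, dForm_swap θ x u, dForm_swap θ x u]
  ring

theorem dForm_smul_right (c : ℝ) (u v : TangentSpace 𝓘(ℝ, E) x) :
    dForm θ x u (c • v) = c * dForm θ x u v := by
  rw [dForm_swap, dForm_smul_left, dForm_swap θ x u]
  ring

theorem dForm_neg_left (u v : TangentSpace 𝓘(ℝ, E) x) : dForm θ x (-u) v = -dForm θ x u v := by
  have := dForm_smul_left θ x (-1) u v
  rwa [neg_one_smul, neg_one_mul] at this

theorem dForm_neg_right (u v : TangentSpace 𝓘(ℝ, E) x) : dForm θ x u (-v) = -dForm θ x u v := by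
  rw [dForm_swap, dForm_neg_left, dForm_swap θ x u]

end dForm

variable [IsManifold 𝓘(ℝ, E) ∞ M] {k : ℕ} {S : CRStructure E k M}

namespace CRStructure

/-- A purely imaginary vector is minus its conjugate, so it lies in `T10` together with its
conjugate. Consequently a vector of `T10` is known from its real part. -/
theorem eq_zero_of_cRe_eq_zero {x : M} {Z : CTangent E x} (hZ : Z ∈ S.T10 x) (h : cRe Z = 0) :
    Z = 0 := by
  refine S.eq_zero_of_conj_mem x Z hZ ?_
  have : cConj Z = -Z := by
    apply complexification_ext
    · rw [cRe_cConj, map_neg, h, neg_zero]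
    · rw [cIm_cConj, map_neg]
  rw [this]
  exact neg_mem hZ

theorem eq_of_cRe_eq {x : M} {Z W : CTangent E x} (hZ : Z ∈ S.T10 x) (hW : W ∈ S.T10 x)
    (h : cRe Z = cRe W) : Z = W :=
  sub_eq_zero.1 (eq_zero_of_cRe_eq_zero (sub_mem hZ hW) (by rw [map_sub, h, sub_self]))

end CRStructure

namespace PseudohermitianStructure

variable (θ : PseudohermitianStructure S) {x : M}

theorem form_of_mem {Z : CTangent E x} (hZ : Z ∈ S.T10 x) :
    θ.form x (cRe Z) = 0 ∧ θ.form x (cIm Z) = 0 := by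
  have := (θ.ker_eq x Z).2 ⟨Z, hZ, 0, zero_mem _, by simp⟩
  exact (baseChange_eq_zero_iff _ _).1 this

theorem exists_of_form_eq_zero {v : TangentSpace 𝓘(ℝ, E) x} (hv : θ.form x v = 0) :
    ∃ Z ∈ S.T10 x, v = cRe Z := by
  obtain ⟨A, hA, B, hB, h⟩ := (θ.ker_eq x ((1 : ℂ) ⊗ₜ[ℝ] v)).1
    ((baseChange_eq_zero_iff _ _).2 (by simp [hv]))
  refine ⟨A + B, add_mem hA hB, ?_⟩
  have := congrArg cRe h
  simpa using this

theorem levi_re (Z W : CTangent E x) :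
    (θ.levi x Z W).re = dForm θ.form x (cRe Z) (cIm W) - dForm θ.form x (cIm Z) (cRe W) := by
  simp only [levi, cdForm, Complex.mul_re, Complex.I_re, Complex.I_im, cRe_cConj, cIm_cConj,
    dForm_neg_right]
  ring

theorem levi_self_re (Z : CTangent E x) :
    (θ.levi x Z Z).re = 2 * dForm θ.form x (cRe Z) (cIm Z) := by
  rw [levi_re, dForm_swap θ.form x (cIm Z)]
  ring

/-- Positivity makes `dθ` nondegenerate on the contact plane, here two-dimensional. A vector `v`
with `θ(v) = 1` can therefore be corrected within that plane so that `dθ(T, ·)` kills the plane; it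
kills `T` by alternation. -/
theorem exists_isReeb {S : CRStructure E 1 M} (θ : PseudohermitianStructure S)
    (hθ : θ.LeviPosDef) (x : M) : ∃ T, θ.IsReeb x T := by
  obtain ⟨U, -, hxU, Z, -, hZ⟩ := S.exists_frame x
  obtain ⟨hli, hspan⟩ := hZ x hxU
  have hZ0 : Z 0 x ≠ 0 := hli.ne_zero 0
  have hmem : Z 0 x ∈ S.T10 x := hspan ▸ Submodule.subset_span ⟨0, rfl⟩
  have hd := hθ x _ hmem hZ0
  rw [levi_self_re] at hd
  set X := cRe (Z 0 x)
  set Y := cIm (Z 0 x)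
  obtain ⟨v₀, hv₀⟩ : ∃ v, θ.form x v ≠ 0 := by
    by_contra! h
    exact θ.ne_zero x (ContinuousLinearMap.ext h)
  set d := dForm θ.form x X Y
  have hd0 : d ≠ 0 := fun h => by rw [h] at hd; simp at hd
  obtain ⟨v, hv⟩ : ∃ v, θ.form x v = 1 := ⟨(θ.form x v₀)⁻¹ • v₀, by simp [hv₀]⟩
  obtain ⟨hX, hY⟩ := θ.form_of_mem hmem
  set a := -(dForm θ.form x v Y / d)
  set b := dForm θ.form x v X / d
  have hTX : dForm θ.form x (v + a • X + b • Y) X = 0 := by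
    rw [dForm_add_left, dForm_add_left, dForm_smul_left, dForm_smul_left, dForm_self,
      dForm_swap θ.form x Y X]
    change _ + _ + b * -d = 0
    simp only [b]
    field_simp
    ring
  have hTY : dForm θ.form x (v + a • X + b • Y) Y = 0 := by
    rw [dForm_add_left, dForm_add_left, dForm_smul_left, dForm_smul_left, dForm_self]
    change _ + a * d + _ = 0
    simp only [a]
    field_simp
    ring
  have hT1 : θ.form x (v + a • X + b • Y) = 1 := by
    rw [map_add, map_add, map_smul, map_smul, hX, hY, hv]; simp
  refine ⟨v + a • X + b • Y, hT1, fun w => ?_⟩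
  obtain ⟨W, hW, hw⟩ := θ.exists_of_form_eq_zero (x := x)
    (v := w - θ.form x w • (v + a • X + b • Y)) (by
      rw [map_sub, map_smul, hT1]; simp)
  rw [← hspan, show (range fun i => Z i x) = {Z 0 x} by
    rw [range_unique]; rfl, Submodule.mem_span_singleton] at hW
  obtain ⟨c, rfl⟩ := hW
  have hw' : w = θ.form x w • (v + a • X + b • Y) + (c.re • X + (-c.im) • Y) := by
    rw [cRe_smul] at hw
    rw [← sub_eq_iff_eq_add', hw, neg_smul, sub_eq_add_neg]
  rw [hw', dForm_add_right, dForm_smul_right, dForm_self, dForm_add_right, dForm_smul_right,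
    dForm_smul_right, hTX, hTY]
  simp

theorem isReeb_reeb {S : CRStructure E 1 M} (θ : PseudohermitianStructure S)
    (hθ : θ.LeviPosDef) (x : M) : θ.IsReeb x (θ.reeb x) :=
  @Classical.epsilon_spec _ (θ.IsReeb x) (θ.exists_isReeb hθ x)

/-- The defining condition fixes the real part of `Z`, hence `Z`; so the chosen value equals any
witness. -/
theorem holPart_eq {S : CRStructure E 1 M} (θ : PseudohermitianStructure S)
    {u : TangentSpace 𝓘(ℝ, E) x} {Z : CTangent E x} (hZ : Z ∈ S.T10 x)
    (hu : (1 / Real.sqrt 2) • (Z + cConj Z) = (1 : ℂ) ⊗ₜ[ℝ] (u - θ.form x u • θ.reeb x)) :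
    θ.holPart x u = Z := by
  have hs : (1 / Real.sqrt 2) ≠ 0 := by positivity
  have key := @Classical.epsilon_spec _ (fun Z : CTangent E x => Z ∈ S.T10 x ∧
      (1 / Real.sqrt 2) • (Z + cConj Z) = (1 : ℂ) ⊗ₜ[ℝ] (u - θ.form x u • θ.reeb x)) ⟨Z, hZ, hu⟩
  refine CRStructure.eq_of_cRe_eq key.1 hZ ?_
  have h2 := smul_right_injective _ hs (key.2.trans hu.symm)
  have h3 := congrArg cRe h2
  simp only [map_add, cRe_cConj, ← two_smul ℝ] at h3
  exact smul_right_injective _ (two_ne_zero (α := ℝ)) h3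

/-- The factor comes from `(Z + Z̄) / √2 = √2 Re Z`. -/
theorem holPart_cRe {S : CRStructure E 1 M} (θ : PseudohermitianStructure S)
    {Z : CTangent E x} (hZ : Z ∈ S.T10 x) :
    θ.holPart x (Real.sqrt 2 • cRe Z) = Z := by
  apply θ.holPart_eq hZ
  have h2 : (1 / Real.sqrt 2) * 2 = Real.sqrt 2 := by
    rw [one_div_mul_eq_div, Real.div_sqrt]
  apply complexification_ext
  · rw [map_smul, map_add, cRe_cConj, ← two_smul ℝ, smul_smul, h2, map_smul, (θ.form_of_mem hZ).1]
    simp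
  · rw [map_smul, map_add, cIm_cConj]
    simp

theorem holPart_reeb {S : CRStructure E 1 M} (θ : PseudohermitianStructure S)
    (hθ : θ.LeviPosDef) : θ.holPart x (θ.reeb x) = 0 := by
  apply θ.holPart_eq (zero_mem _)
  rw [(θ.isReeb_reeb hθ x).1]
  simp

theorem webster_reeb {S : CRStructure E 1 M} (θ : PseudohermitianStructure S)
    (hθ : θ.LeviPosDef) (v : TangentSpace 𝓘(ℝ, E) x) :
    θ.webster x v (θ.reeb x) = θ.form x v := by
  have h0 : ∀ w : TangentSpace 𝓘(ℝ, E) x, dForm θ.form x w 0 = 0 := fun w => by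
    have := dForm_smul_right θ.form x 0 w 0
    rwa [zero_smul, zero_mul] at this
  rw [webster, θ.holPart_reeb hθ, levi_re, map_zero, map_zero, h0, h0, (θ.isReeb_reeb hθ x).1]
  simp

theorem webster_cRe {S : CRStructure E 1 M} (θ : PseudohermitianStructure S)
    {Z W : CTangent E x} (hZ : Z ∈ S.T10 x) (hW : W ∈ S.T10 x) :
    θ.webster x (Real.sqrt 2 • cRe Z) (Real.sqrt 2 • cRe W) =
      dForm θ.form x (cRe Z) (cIm W) - dForm θ.form x (cIm Z) (cRe W) := by
  rw [webster, θ.holPart_cRe hZ, θ.holPart_cRe hW, levi_re, map_smul, (θ.form_of_mem hZ).1]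
  simp

end PseudohermitianStructure
end Pointwise

/-! ### Passing from the manifold to a chart. -/

section Charts

variable {E : Type*} [NormedAddCommGroup E] [NormedSpace ℝ E]
variable {M : Type*} [TopologicalSpace M] [ChartedSpace E M]

/-- The image of an open set in the preferred chart at `x₀`. -/
def chartImage (x₀ : M) (U : Set M) : Set E :=
  (extChartAt 𝓘(ℝ, E) x₀).target ∩ (extChartAt 𝓘(ℝ, E) x₀).symm ⁻¹' U

theorem isOpen_chartImage (x₀ : M) {U : Set M} (hU : IsOpen U) :
    IsOpen (chartImage (E := E) x₀ U) :=
  (continuousOn_extChartAt_symm x₀).isOpen_inter_preimage (isOpen_extChartAt_target x₀) hU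

theorem mem_chartImage {x₀ y : M} {U : Set M} (hy : y ∈ (extChartAt 𝓘(ℝ, E) x₀).source)
    (hU : y ∈ U) : extChartAt 𝓘(ℝ, E) x₀ y ∈ chartImage (E := E) x₀ U :=
  ⟨(extChartAt 𝓘(ℝ, E) x₀).map_source hy, by
    rw [mem_preimage, (extChartAt 𝓘(ℝ, E) x₀).left_inv hy]; exact hU⟩

/-- The expression of a vector field in the preferred chart at `x₀`. -/
def chartField (x₀ : M) (X : ∀ y : M, TangentSpace 𝓘(ℝ, E) y) (e : E) : E :=
  mfderiv 𝓘(ℝ, E) 𝓘(ℝ, E) (extChartAt 𝓘(ℝ, E) x₀) ((extChartAt 𝓘(ℝ, E) x₀).symm e)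
    (X ((extChartAt 𝓘(ℝ, E) x₀).symm e))

variable [IsManifold 𝓘(ℝ, E) ∞ M]

theorem contDiffOn_chartField (x₀ : M) {X : ∀ y : M, TangentSpace 𝓘(ℝ, E) y} {U : Set M}
    (hU : IsOpen U) (hX : ContMDiffOn 𝓘(ℝ, E) 𝓘(ℝ, E).tangent ∞
      (fun x => (⟨x, X x⟩ : TangentBundle 𝓘(ℝ, E) M)) U) :
    ContDiffOn ℝ ∞ (chartField x₀ X) (chartImage (E := E) x₀ U) := by
  have : IsManifold 𝓘(ℝ, E) 1 M := .of_le (n := ∞) (by simp)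
  rw [← contMDiffOn_iff_contDiffOn]
  have h1 : ContMDiffOn 𝓘(ℝ, E) 𝓘(ℝ, E) ∞
      (fun y => (mfderiv 𝓘(ℝ, E) 𝓘(ℝ, E) (extChartAt 𝓘(ℝ, E) x₀) y (X y) : E))
      (U ∩ (extChartAt 𝓘(ℝ, E) x₀).source) := by
    intro y hy
    have hys : y ∈ (chartAt E x₀).source := by simpa using hy.2
    -- Smoothness of a section is smoothness of its fibre coordinate in the trivialization at `x₀`.
    -- Over the chart domain that coordinate is the image under the differential of the chart.
    have h2 := (hX.contMDiffAt (hU.mem_nhds hy.1))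
    have h3 := ((trivializationAt E (TangentSpace 𝓘(ℝ, E)) x₀).contMDiffAt_section_iff
      (x₀ := y) (by simpa using hys)).1 h2
    refine (h3.congr_of_eventuallyEq ?_).contMDiffWithinAt
    filter_upwards [(chartAt E x₀).open_source.mem_nhds hys] with z hz
    have h4 := TangentBundle.continuousLinearMapAt_trivializationAt (I := 𝓘(ℝ, E)) hz
    refine (DFunLike.congr_fun h4 (X z)).symm.trans ?_
    rw [Bundle.Trivialization.continuousLinearMapAt_apply,
      Bundle.Trivialization.linearMapAt_apply, if_pos (by simpa using hz)]
  refine h1.comp ((contMDiffOn_extChartAt_symm x₀).mono inter_subset_left) ?_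
  intro e he
  exact ⟨he.2, (extChartAt 𝓘(ℝ, E) x₀).map_target he.1⟩

variable {F : Type*} [NormedAddCommGroup F] [NormedSpace ℝ F]

theorem contDiffOn_comp_chart_symm (x₀ : M) {u : M → F} {U : Set M}
    (hu : ContMDiffOn 𝓘(ℝ, E) 𝓘(ℝ, F) ∞ u U) :
    ContDiffOn ℝ ∞ (u ∘ (extChartAt 𝓘(ℝ, E) x₀).symm) (chartImage (E := E) x₀ U) := by
  rw [← contMDiffOn_iff_contDiffOn]
  exact hu.comp ((contMDiffOn_extChartAt_symm x₀).mono inter_subset_left) fun e he => he.2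

/-- This is the bridge that turns differentials on `M` into Fréchet derivatives in one fixed chart,
where the local theory lives. -/
theorem fderiv_comp_chart_symm {x₀ y : M} {u : M → F} {U : Set M} (hU : IsOpen U)
    (hu : ContMDiffOn 𝓘(ℝ, E) 𝓘(ℝ, F) ∞ u U) (hy : y ∈ U)
    (hys : y ∈ (extChartAt 𝓘(ℝ, E) x₀).source) (v : TangentSpace 𝓘(ℝ, E) y) :
    fderiv ℝ (u ∘ (extChartAt 𝓘(ℝ, E) x₀).symm) (extChartAt 𝓘(ℝ, E) x₀ y)
      (mfderiv 𝓘(ℝ, E) 𝓘(ℝ, E) (extChartAt 𝓘(ℝ, E) x₀) y v) = rDiff u y v := by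
  have : IsManifold 𝓘(ℝ, E) 1 M := .of_le (n := ∞) (by simp)
  have h1 := (contDiffOn_comp_chart_symm x₀ hu).differentiableAt_of_isOpen
    (isOpen_chartImage x₀ hU) (mem_chartImage hys hy)
  have h2 : MDifferentiableAt 𝓘(ℝ, E) 𝓘(ℝ, E) (extChartAt 𝓘(ℝ, E) x₀) y :=
    mdifferentiableAt_extChartAt (by simpa using hys)
  have h3 := mfderiv_comp y h1.mdifferentiableAt h2
  have h4 : (u ∘ (extChartAt 𝓘(ℝ, E) x₀).symm) ∘ (extChartAt 𝓘(ℝ, E) x₀) =ᶠ[nhds y] u := by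
    filter_upwards [(isOpen_extChartAt_source x₀).mem_nhds hys] with z hz
    exact congrArg u ((extChartAt 𝓘(ℝ, E) x₀).left_inv hz)
  rw [h4.mfderiv_eq, mfderiv_eq_fderiv] at h3
  exact (DFunLike.congr_fun h3 v).symm

theorem mfderiv_chart_symm_apply {x₀ : M} {e : E} (he : e ∈ (extChartAt 𝓘(ℝ, E) x₀).target) (w : E) :
    mfderiv 𝓘(ℝ, E) 𝓘(ℝ, E) (extChartAt 𝓘(ℝ, E) x₀) ((extChartAt 𝓘(ℝ, E) x₀).symm e)
      (mfderiv 𝓘(ℝ, E) 𝓘(ℝ, E) (extChartAt 𝓘(ℝ, E) x₀).symm e w) = w := by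
  have : IsManifold 𝓘(ℝ, E) 1 M := .of_le (n := ∞) (by simp)
  have h := mfderiv_extChartAt_comp_mfderivWithin_extChartAt_symm (I := 𝓘(ℝ, E)) he
  simp only [modelWithCornersSelf_coe, range_id, mfderivWithin_univ] at h
  exact DFunLike.congr_fun h w

theorem chartForm_apply {F : Type*} [NormedAddCommGroup F] [InnerProductSpace ℝ F]
    {θ : ∀ y : M, TangentSpace 𝓘(ℝ, E) y →L[ℝ] ℝ} {U : Set M} (hU : IsOpen U) {f n : M → F}
    (hf : ContMDiffOn 𝓘(ℝ, E) 𝓘(ℝ, F) ∞ f U)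
    (h : ∀ (y : M) (v : TangentSpace 𝓘(ℝ, E) y), θ y v = inner ℝ (rDiff f y v) (n y))
    (x : M) {e : E} (he : e ∈ chartImage (E := E) x U) (w : E) :
    chartForm θ x e w = inner ℝ (fderiv ℝ (f ∘ (extChartAt 𝓘(ℝ, E) x).symm) e w)
      ((n ∘ (extChartAt 𝓘(ℝ, E) x).symm) e) := by
  have h1 := fderiv_comp_chart_symm (x₀ := x) hU hf he.2 ((extChartAt 𝓘(ℝ, E) x).map_target he.1)
    (mfderiv 𝓘(ℝ, E) 𝓘(ℝ, E) (extChartAt 𝓘(ℝ, E) x).symm e w)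
  rw [mfderiv_chart_symm_apply he.1, (extChartAt 𝓘(ℝ, E) x).right_inv he.1] at h1
  rw [h1]
  exact h _ _

/-- The exterior derivative of the `1`-form `⟨df, n⟩`. -/
theorem dForm_eq_inner {F : Type*} [NormedAddCommGroup F] [InnerProductSpace ℝ F]
    {θ : ∀ y : M, TangentSpace 𝓘(ℝ, E) y →L[ℝ] ℝ} {U : Set M} (hU : IsOpen U) {f n : M → F}
    (hf : ContMDiffOn 𝓘(ℝ, E) 𝓘(ℝ, F) ∞ f U) (hn : ContMDiffOn 𝓘(ℝ, E) 𝓘(ℝ, F) ∞ n U)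
    (h : ∀ (y : M) (v : TangentSpace 𝓘(ℝ, E) y), θ y v = inner ℝ (rDiff f y v) (n y))
    {x : M} (hx : x ∈ U) (u v : TangentSpace 𝓘(ℝ, E) x) :
    dForm θ x u v = inner ℝ (rDiff f x v) (rDiff n x u) - inner ℝ (rDiff f x u) (rDiff n x v) := by
  set φ := extChartAt 𝓘(ℝ, E) x
  set U' := chartImage (E := E) x U
  have hU' : IsOpen U' := isOpen_chartImage x hU
  have hxs : x ∈ φ.source := mem_extChartAt_source x
  have hx' : φ x ∈ U' := mem_chartImage hxs hx
  have hf' := contDiffOn_comp_chart_symm x hf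
  have hn' := contDiffOn_comp_chart_symm x hn
  set f' := f ∘ φ.symm
  set n' := n ∘ φ.symm
  have hdf' : DifferentiableAt ℝ (fderiv ℝ f') (φ x) :=
    (hf'.fderiv_of_isOpen hU' (m := ∞) (by simp)).differentiableAt_of_isOpen hU' hx'
  have hdn' : DifferentiableAt ℝ n' (φ x) := hn'.differentiableAt_of_isOpen hU' hx'
  have hform : EqOn (chartForm θ x) (fun e => (innerSL ℝ (n' e)).comp (fderiv ℝ f' e)) U' := by
    intro e he
    ext w
    rw [chartForm_apply hU hf h x he w]
    exact real_inner_comm _ _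
  have hdiff : DifferentiableAt ℝ (chartForm θ x) (φ x) := by
    refine DifferentiableAt.congr_of_eventuallyEq ?_ (hform.eventuallyEq_of_mem (hU'.mem_nhds hx'))
    exact ((innerSL ℝ (E := F)).differentiableAt.comp (φ x) hdn').clm_comp hdf'
  have hdalt : DifferentiableAt ℝ (fun e => ContinuousAlternatingMap.ofSubsingleton ℝ E ℝ (0 : Fin 1)
      (chartForm θ x e)) (φ x) :=
    (ContinuousAlternatingMap.ofSubsingletonLIE (𝕜 := ℝ) (E := E) (F := ℝ)
      (0 : Fin 1)).toContinuousLinearEquiv.differentiableAt.comp (φ x) hdiff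
  have key : ∀ a b : E, fderiv ℝ (fun e => chartForm θ x e b) (φ x) a =
      inner ℝ (fderiv ℝ (fderiv ℝ f') (φ x) a b) (n' (φ x))
        + inner ℝ (fderiv ℝ f' (φ x) b) (fderiv ℝ n' (φ x) a) := by
    intro a b
    have e1 : (fun e => chartForm θ x e b) =ᶠ[nhds (φ x)]
        fun e => inner ℝ (fderiv ℝ f' e b) (n' e) := by
      filter_upwards [hU'.mem_nhds hx'] with e he using chartForm_apply hU hf h x he b
    have hb := hdf'.clm_apply (differentiableAt_const b)
    rw [e1.fderiv_eq, fderiv_inner_apply ℝ hb hdn',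
      fderiv_clm_apply hdf' (differentiableAt_const b)]
    simp [add_comm]
  -- The second derivative of `f'` is symmetric, so it cancels in the alternation and only the
  -- derivatives of `n'` remain.
  have hsymm : IsSymmSndFDerivAt ℝ f' (φ x) :=
    (hf'.contDiffAt (hU'.mem_nhds hx')).isSymmSndFDerivAt
      (by simpa using WithTop.coe_le_coe.2 (le_top (a := (2 : ℕ∞))))
  have hab : ∀ a b : E, extDeriv (fun e => ContinuousAlternatingMap.ofSubsingleton ℝ E ℝ (0 : Fin 1)
        (chartForm θ x e)) (φ x) ![a, b] =
      inner ℝ (fderiv ℝ f' (φ x) b) (fderiv ℝ n' (φ x) a)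
        - inner ℝ (fderiv ℝ f' (φ x) a) (fderiv ℝ n' (φ x) b) := by
    intro a b
    rw [extDeriv_apply hdalt, Fin.sum_univ_two]
    have e1 := key a b
    have e2 := key b a
    rw [hsymm.eq b a] at e2
    simp only [ContinuousAlternatingMap.ofSubsingleton_apply_apply, Fin.removeNth, Fin.succAbove]
    simp
    rw [e1, e2]
    ring
  rw [dForm_eq, ← fderiv_comp_chart_symm hU hf hx hxs u, ← fderiv_comp_chart_symm hU hf hx hxs v,
    ← fderiv_comp_chart_symm hU hn hx hxs u, ← fderiv_comp_chart_symm hU hn hx hxs v]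
  exact hab _ _

end Charts

/-! ### Coordinatewise real and imaginary parts on `ℂⁿ`. -/

section Coordinates

/-- The coordinatewise real part. -/
def reCLM (n : ℕ) : EuclideanSpace ℂ (Fin n) →L[ℝ] EuclideanSpace ℝ (Fin n) :=
  LinearMap.toContinuousLinearMap
    { toFun := fun p => WithLp.toLp 2 fun i => (p i).re
      map_add' := fun p q => by ext i; simp
      map_smul' := fun c p => by ext i; simp }

/-- The coordinatewise imaginary part. -/
def imCLM (n : ℕ) : EuclideanSpace ℂ (Fin n) →L[ℝ] EuclideanSpace ℝ (Fin n) :=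
  LinearMap.toContinuousLinearMap
    { toFun := fun p => WithLp.toLp 2 fun i => (p i).im
      map_add' := fun p q => by ext i; simp
      map_smul' := fun c p => by ext i; simp }

@[simp] theorem reCLM_apply (n : ℕ) (p : EuclideanSpace ℂ (Fin n)) (i : Fin n) :
    reCLM n p i = (p i).re := rfl
@[simp] theorem imCLM_apply (n : ℕ) (p : EuclideanSpace ℂ (Fin n)) (i : Fin n) :
    imCLM n p i = (p i).im := rfl

theorem reCLM_neg_I_smul (n : ℕ) (p : EuclideanSpace ℂ (Fin n)) :
    reCLM n (-(Complex.I • p)) = imCLM n p := by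
  ext i; simp

theorem imCLM_neg_I_smul (n : ℕ) (p : EuclideanSpace ℂ (Fin n)) :
    imCLM n (-(Complex.I • p)) = -reCLM n p := by
  ext i; simp

end Coordinates

/-! ### Constant fields in a chart and smoothness of `θ(X)`. -/

section Frame

variable {E : Type*} [NormedAddCommGroup E] [NormedSpace ℝ E]
variable {M : Type*} [TopologicalSpace M] [ChartedSpace E M]

theorem rDiff_clm_comp {F G : Type*} [NormedAddCommGroup F] [NormedSpace ℝ F]
    [NormedAddCommGroup G] [NormedSpace ℝ G] (L : F →L[ℝ] G) {u : M → F} {x : M}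
    (hu : MDifferentiableAt 𝓘(ℝ, E) 𝓘(ℝ, F) u x) (v : TangentSpace 𝓘(ℝ, E) x) :
    rDiff (fun y => L (u y)) x v = L (rDiff u x v) := by
  have h := mfderiv_comp x (L.differentiableAt (x := u x)).mdifferentiableAt hu
  rw [mfderiv_eq_fderiv, L.fderiv] at h
  exact DFunLike.congr_fun h v

variable [IsManifold 𝓘(ℝ, E) ∞ M]

/-- A vector field which is constant in the preferred chart at `x₀`. -/
def constField (x₀ : M) (v : E) (y : M) : TangentSpace 𝓘(ℝ, E) y :=
  (trivializationAt E (TangentSpace 𝓘(ℝ, E)) x₀).symmL ℝ y v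

theorem contMDiffOn_constField (x₀ : M) (v : E) :
    ContMDiffOn 𝓘(ℝ, E) 𝓘(ℝ, E).tangent ∞
      (fun x => (⟨x, constField x₀ v x⟩ : TangentBundle 𝓘(ℝ, E) M))
      (extChartAt 𝓘(ℝ, E) x₀).source := by
  have : IsManifold 𝓘(ℝ, E) 1 M := .of_le (n := ∞) (by simp)
  intro y hy
  have hb : ∀ z ∈ (extChartAt 𝓘(ℝ, E) x₀).source,
      z ∈ (trivializationAt E (TangentSpace 𝓘(ℝ, E)) x₀).baseSet := fun z hz => by simpa using hz
  refine (((trivializationAt E (TangentSpace 𝓘(ℝ, E)) x₀).contMDiffAt_section_iff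
    (hb y hy)).2 ?_).contMDiffWithinAt
  refine (contMDiffAt_const (c := v)).congr_of_eventuallyEq ?_
  filter_upwards [(isOpen_extChartAt_source x₀).mem_nhds hy] with z hz
  have h := Bundle.Trivialization.continuousLinearMapAt_symmL (R := ℝ)
    (trivializationAt E (TangentSpace 𝓘(ℝ, E)) x₀) (hb z hz) v
  rw [Bundle.Trivialization.continuousLinearMapAt_apply,
    Bundle.Trivialization.linearMapAt_apply, if_pos (hb z hz)] at h
  exact h

theorem chartField_constField {x₀ y : M} (v : E) (hy : y ∈ (extChartAt 𝓘(ℝ, E) x₀).source) :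
    (mfderiv 𝓘(ℝ, E) 𝓘(ℝ, E) (extChartAt 𝓘(ℝ, E) x₀) y (constField x₀ v y) : E) = v := by
  have : IsManifold 𝓘(ℝ, E) 1 M := .of_le (n := ∞) (by simp)
  have hys : y ∈ (chartAt E x₀).source := by simpa using hy
  have h4 := TangentBundle.continuousLinearMapAt_trivializationAt (I := 𝓘(ℝ, E)) hys
  refine (DFunLike.congr_fun h4 (constField x₀ v y)).symm.trans ?_
  exact Bundle.Trivialization.continuousLinearMapAt_symmL _ (by simpa using hys) v

theorem constField_surjective (x₀ : M) (w : TangentSpace 𝓘(ℝ, E) x₀) :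
    ∃ v : E, constField x₀ v x₀ = w :=
  ⟨(trivializationAt E (TangentSpace 𝓘(ℝ, E)) x₀).continuousLinearMapAt ℝ x₀ w,
    Bundle.Trivialization.symmL_continuousLinearMapAt _ (by simp) w⟩

theorem contMDiffOn_form_apply {k : ℕ} {S : CRStructure E k M} (θ : PseudohermitianStructure S)
    {X : ∀ y : M, TangentSpace 𝓘(ℝ, E) y} {U : Set M} (hU : IsOpen U)
    (hX : ContMDiffOn 𝓘(ℝ, E) 𝓘(ℝ, E).tangent ∞
      (fun x => (⟨x, X x⟩ : TangentBundle 𝓘(ℝ, E) M)) U) :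
    ContMDiffOn 𝓘(ℝ, E) 𝓘(ℝ, ℝ) ∞ (fun x => θ.form x (X x)) U := by
  intro y hy
  have h1 := hX.contMDiffAt (hU.mem_nhds hy)
  have h2 := ContMDiffAt.clm_bundle_apply (θ.smooth y) h1
  rw [Bundle.contMDiffAt_totalSpace] at h2
  exact h2.2.contMDiffWithinAt

end Frame

/-! ### Local conjugates and metric identities along `T10`. -/

section Frame

variable {E : Type*} [NormedAddCommGroup E] [NormedSpace ℝ E]
variable {M : Type*} [TopologicalSpace M] [ChartedSpace E M] [IsManifold 𝓘(ℝ, E) ∞ M]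

namespace CRStructure

/-- Locally a CR structure of CR dimension one is spanned by one smooth vector field. -/
theorem exists_generator (S : CRStructure E 1 M) (x₀ : M) :
    ∃ U : Set M, IsOpen U ∧ x₀ ∈ U ∧ ∃ Z : ∀ y : M, CTangent E y, SmoothCField Z U ∧
      ∀ y ∈ U, Z y ≠ 0 ∧ S.T10 y = Submodule.span ℂ {Z y} := by
  obtain ⟨U, hU, hx, Z, hZ, h⟩ := S.exists_frame x₀
  refine ⟨U, hU, hx, Z 0, hZ 0, fun y hy => ⟨(h y hy).1.ne_zero 0, ?_⟩⟩
  rw [← (h y hy).2, range_unique]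
  rfl

/-- The conjugate is the imaginary part of a local CR map `F`; the two equations are the imaginary
and real parts of `dF(Im Z) = -i dF(Re Z)`. -/
theorem IsCRPluriharmonic.exists_conjugate {k n : ℕ} {S : CRStructure E k M}
    {f : M → EuclideanSpace ℝ (Fin n)} (h : S.IsCRPluriharmonic f) (x₀ : M) :
    ∃ U : Set M, IsOpen U ∧ x₀ ∈ U ∧ ∃ g : M → EuclideanSpace ℝ (Fin n),
      ContMDiffOn 𝓘(ℝ, E) 𝓘(ℝ, EuclideanSpace ℝ (Fin n)) ∞ g U ∧
      ∀ y ∈ U, ∀ Z ∈ S.T10 y, rDiff g y (cRe Z) = rDiff f y (cIm Z) ∧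
        rDiff g y (cIm Z) = -rDiff f y (cRe Z) := by
  obtain ⟨U, hU, hx, F, ⟨hF, hCR⟩, hre⟩ := h.2 x₀
  refine ⟨U, hU, hx, fun y => imCLM n (F y),
    (imCLM n).contDiff.contMDiff.comp_contMDiffOn hF, fun y hy Z hZ => ?_⟩
  have hd : MDifferentiableAt 𝓘(ℝ, E) 𝓘(ℝ, EuclideanSpace ℂ (Fin n)) F y :=
    (hF.contMDiffAt (hU.mem_nhds hy)).mdifferentiableAt (by simp)
  have hre' : f =ᶠ[nhds y] fun y => reCLM n (F y) := by
    filter_upwards [hU.mem_nhds hy] with z hz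
    ext i
    exact hre z hz i
  have hf : rDiff (E := E) f y = rDiff (fun y => reCLM n (F y)) y := hre'.mfderiv_eq
  have hm := (mem_holTangent_iff _).1 (hCR y hy Z hZ)
  rw [cDiff, cIm_baseChange, cRe_baseChange] at hm
  change rDiff F y (cIm Z) = -(Complex.I • rDiff F y (cRe Z)) at hm
  rw [hf, rDiff_clm_comp _ hd, rDiff_clm_comp _ hd, rDiff_clm_comp _ hd, rDiff_clm_comp _ hd, hm,
    reCLM_neg_I_smul, imCLM_neg_I_smul]
  exact ⟨rfl, rfl⟩

end CRStructure

namespace PseudohermitianStructure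

variable {S : CRStructure E 1 M} {θ : PseudohermitianStructure S} {n : ℕ}
  {f : M → EuclideanSpace ℝ (Fin n)} {x : M}

namespace IsIsometricImmersion

theorem inner_reeb (hf : θ.IsIsometricImmersion f) (hθ : θ.LeviPosDef)
    (v : TangentSpace 𝓘(ℝ, E) x) :
    inner ℝ (rDiff f x v) (rDiff f x (θ.reeb x)) = θ.form x v := by
  rw [hf.2.2, θ.webster_reeb hθ]

theorem inner_reeb_reeb (hf : θ.IsIsometricImmersion f) (hθ : θ.LeviPosDef) :
    inner ℝ (rDiff f x (θ.reeb x)) (rDiff f x (θ.reeb x)) = 1 := by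
  rw [hf.inner_reeb hθ, (θ.isReeb_reeb hθ x).1]

theorem inner_cRe (hf : θ.IsIsometricImmersion f) {Z W : CTangent E x} (hZ : Z ∈ S.T10 x)
    (hW : W ∈ S.T10 x) : inner ℝ (rDiff f x (cRe Z)) (rDiff f x (cRe W)) =
      (dForm θ.form x (cRe Z) (cIm W) - dForm θ.form x (cIm Z) (cRe W)) / 2 := by
  have h := hf.2.2 x (Real.sqrt 2 • cRe Z) (Real.sqrt 2 • cRe W)
  rw [θ.webster_cRe hZ hW, map_smul, map_smul, inner_smul_left, inner_smul_right, ← mul_assoc,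
    RCLike.conj_to_real, Real.mul_self_sqrt (by norm_num)] at h
  linarith

theorem inner_cRe_cRe (hf : θ.IsIsometricImmersion f) {Z : CTangent E x} (hZ : Z ∈ S.T10 x) :
    inner ℝ (rDiff f x (cRe Z)) (rDiff f x (cRe Z)) = dForm θ.form x (cRe Z) (cIm Z) := by
  rw [hf.inner_cRe hZ hZ, dForm_swap θ.form x (cIm Z)]
  ring

theorem inner_cRe_cIm (hf : θ.IsIsometricImmersion f) {Z : CTangent E x} (hZ : Z ∈ S.T10 x) :
    inner ℝ (rDiff f x (cRe Z)) (rDiff f x (cIm Z)) = 0 := by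
  -- The vector `-i Z` has real part `Im Z` and imaginary part `-Re Z`.
  have h := hf.inner_cRe hZ (Submodule.smul_mem _ (-Complex.I) hZ)
  rw [cRe_smul, cIm_smul] at h
  simpa [dForm_neg_right, dForm_self] using h

theorem inner_cIm_cIm (hf : θ.IsIsometricImmersion f) {Z : CTangent E x} (hZ : Z ∈ S.T10 x) :
    inner ℝ (rDiff f x (cIm Z)) (rDiff f x (cIm Z)) = dForm θ.form x (cRe Z) (cIm Z) := by
  have hZ' := Submodule.smul_mem _ (-Complex.I) hZ
  have h := hf.inner_cRe hZ' hZ'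
  rw [cRe_smul, cIm_smul] at h
  simp only [Complex.neg_re, Complex.neg_im, Complex.I_re, Complex.I_im, neg_zero, zero_smul,
    zero_sub, zero_add, neg_smul, one_smul, neg_neg, dForm_neg_left,
    dForm_swap θ.form x (cIm Z)] at h
  linarith

theorem dForm_pos (hθ : θ.LeviPosDef) {Z : CTangent E x} (hZ : Z ∈ S.T10 x) (h0 : Z ≠ 0) :
    0 < dForm θ.form x (cRe Z) (cIm Z) := by
  have := hθ x Z hZ h0
  rw [levi_self_re] at this
  linarith

/-- The Reeb vector in terms of a vector `v` with `θ(v) ≠ 0`. -/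
theorem reeb_eq (hf : θ.IsIsometricImmersion f) (hθ : θ.LeviPosDef) {Z : CTangent E x}
    (h0 : Z ≠ 0) (hZ : S.T10 x = Submodule.span ℂ {Z}) {v : TangentSpace 𝓘(ℝ, E) x}
    (hv : θ.form x v ≠ 0) :
    θ.reeb x = (θ.form x v)⁻¹ • (v
      - (inner ℝ (rDiff f x (cRe Z)) (rDiff f x v)
          / inner ℝ (rDiff f x (cRe Z)) (rDiff f x (cRe Z))) • cRe Z
      - (inner ℝ (rDiff f x (cIm Z)) (rDiff f x v)
          / inner ℝ (rDiff f x (cRe Z)) (rDiff f x (cRe Z))) • cIm Z) := by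
  have hmem : Z ∈ S.T10 x := hZ ▸ Submodule.mem_span_singleton_self Z
  obtain ⟨W, hW, hw⟩ := θ.exists_of_form_eq_zero (x := x) (v := v - θ.form x v • θ.reeb x) (by
      rw [map_sub, map_smul, (θ.isReeb_reeb hθ x).1]; simp)
  rw [hZ, Submodule.mem_span_singleton] at hW
  obtain ⟨c, rfl⟩ := hW
  rw [cRe_smul] at hw
  have hv' : v = θ.form x v • θ.reeb x + (c.re • cRe Z - c.im • cIm Z) := by rw [← hw]; abel
  have hpos := dForm_pos hθ hmem h0
  have h1 := hf.inner_cRe_cRe hmem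
  have h2 := hf.inner_cRe_cIm hmem
  have h3 := hf.inner_cIm_cIm hmem
  have h2' : inner ℝ (rDiff f x (cIm Z)) (rDiff f x (cRe Z)) = 0 := by rw [real_inner_comm, h2]
  have r1 := hf.inner_reeb hθ (cRe Z)
  have r2 := hf.inner_reeb hθ (cIm Z)
  rw [(θ.form_of_mem hmem).1] at r1
  rw [(θ.form_of_mem hmem).2] at r2
  have i1 : inner ℝ (rDiff f x (cRe Z)) (rDiff f x v) = c.re * dForm θ.form x (cRe Z) (cIm Z) := by
    rw [hv', map_add, map_sub, map_smul, map_smul, map_smul, inner_add_right, inner_sub_right,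
      inner_smul_right, inner_smul_right, inner_smul_right, r1, h1, h2]
    ring
  have i2 : inner ℝ (rDiff f x (cIm Z)) (rDiff f x v)
      = -c.im * dForm θ.form x (cRe Z) (cIm Z) := by
    rw [hv', map_add, map_sub, map_smul, map_smul, map_smul, inner_add_right, inner_sub_right,
      inner_smul_right, inner_smul_right, inner_smul_right, r2, h2', h3]
    ring
  rw [i1, i2, h1, mul_div_cancel_right₀ _ hpos.ne', mul_div_cancel_right₀ _ hpos.ne',
    eq_inv_smul_iff₀ hv]
  linear_combination (norm := module) -hw

end IsIsometricImmersion
end PseudohermitianStructure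
end Frame

section Complexification

variable {V : Type*} [AddCommGroup V] [Module ℝ V]

theorem cRe_ofReal_smul (c : ℝ) (Z : ℂ ⊗[ℝ] V) : cRe ((c : ℂ) • Z) = c • cRe Z := by
  rw [cRe_smul]; simp

theorem cIm_ofReal_smul (c : ℝ) (Z : ℂ ⊗[ℝ] V) : cIm ((c : ℂ) • Z) = c • cIm Z := by
  rw [cIm_smul]; simp

end Complexification

/-! ### Existence of adapted frames. -/

section ExistsAdaptedFrame

variable {E : Type*} [NormedAddCommGroup E] [NormedSpace ℝ E]
variable {M : Type*} [TopologicalSpace M] [ChartedSpace E M]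

theorem chartImage_mono (x₀ : M) {U V : Set M} (h : U ⊆ V) :
    chartImage (E := E) x₀ U ⊆ chartImage x₀ V := fun _ he => ⟨he.1, h he.2⟩

variable [IsManifold 𝓘(ℝ, E) ∞ M]

section

variable {F : Type*} [NormedAddCommGroup F] [NormedSpace ℝ F]

theorem dirD_chartField {x₀ : M} {u : M → F} {U : Set M} (hU : IsOpen U)
    (hu : ContMDiffOn 𝓘(ℝ, E) 𝓘(ℝ, F) ∞ u U) (X : ∀ y : M, TangentSpace 𝓘(ℝ, E) y) {e : E}
    (he : e ∈ chartImage (E := E) x₀ U) :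
    dirD (chartField x₀ X) (u ∘ (extChartAt 𝓘(ℝ, E) x₀).symm) e =
      rDiff u ((extChartAt 𝓘(ℝ, E) x₀).symm e) (X ((extChartAt 𝓘(ℝ, E) x₀).symm e)) := by
  have h := fderiv_comp_chart_symm hU hu he.2 ((extChartAt 𝓘(ℝ, E) x₀).map_target he.1)
    (X ((extChartAt 𝓘(ℝ, E) x₀).symm e))
  rw [(extChartAt 𝓘(ℝ, E) x₀).right_inv he.1] at h
  exact h

/-- A function is smooth if its expression in a chart is. -/
theorem contMDiffOn_of_chart {x₀ : M} {u : M → F} {U : Set M}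
    (hUs : U ⊆ (extChartAt 𝓘(ℝ, E) x₀).source)
    (h : ContDiffOn ℝ ∞ (u ∘ (extChartAt 𝓘(ℝ, E) x₀).symm) (chartImage (E := E) x₀ U)) :
    ContMDiffOn 𝓘(ℝ, E) 𝓘(ℝ, F) ∞ u U := by
  have h1 := (contMDiffOn_iff_contDiffOn.2 h).comp
    ((contMDiffOn_extChartAt (I := 𝓘(ℝ, E)) (n := ∞) (x := x₀)).mono
      (hUs.trans (by rw [extChartAt_source])))
    (fun y hy => mem_chartImage (hUs hy) hy)
  exact h1.congr fun y hy => congrArg u ((extChartAt 𝓘(ℝ, E) x₀).left_inv (hUs hy)).symm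

end

namespace PseudohermitianStructure

variable {S : CRStructure E 1 M} {θ : PseudohermitianStructure S} {n : ℕ}
  {f : M → EuclideanSpace ℝ (Fin n)}

namespace IsIsometricImmersion

/-- A generator is divided by the square root of `dθ(Re Z, Im Z)`. This function is smooth because
the isometry identifies it with `|df(Re Z)|²`. -/
theorem exists_unit_generator (hf : θ.IsIsometricImmersion f) (hθ : θ.LeviPosDef) (x₀ : M) :
    ∃ U : Set M, IsOpen U ∧ x₀ ∈ U ∧ U ⊆ (extChartAt 𝓘(ℝ, E) x₀).source ∧
      ∃ Z : ∀ y : M, CTangent E y,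
        ContDiffOn ℝ ∞ (chartField x₀ fun y => cRe (Z y)) (chartImage (E := E) x₀ U) ∧
        ContDiffOn ℝ ∞ (chartField x₀ fun y => cIm (Z y)) (chartImage (E := E) x₀ U) ∧
        ∀ y ∈ U, Z y ≠ 0 ∧ S.T10 y = Submodule.span ℂ {Z y} ∧
          dForm θ.form y (cRe (Z y)) (cIm (Z y)) = 1 := by
  obtain ⟨U₀, hU₀, hx₀, Z₀, ⟨hR, hI⟩, hZ₀⟩ := S.exists_generator x₀
  set U := U₀ ∩ (extChartAt 𝓘(ℝ, E) x₀).source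
  have hU : IsOpen U := hU₀.inter (isOpen_extChartAt_source x₀)
  have hmem : ∀ y ∈ U, Z₀ y ∈ S.T10 y := fun y hy =>
    (hZ₀ y hy.1).2 ▸ Submodule.mem_span_singleton_self _
  have hpos : ∀ y ∈ U, 0 < dForm θ.form y (cRe (Z₀ y)) (cIm (Z₀ y)) := fun y hy =>
    dForm_pos hθ (hmem y hy) (hZ₀ y hy.1).1
  set a : M → ℝ := fun y => (Real.sqrt (dForm θ.form y (cRe (Z₀ y)) (cIm (Z₀ y))))⁻¹
  have ha : ∀ y ∈ U, a y ≠ 0 := fun y hy => (inv_pos.2 (Real.sqrt_pos.2 (hpos y hy))).ne'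
  have cR := contDiffOn_chartField x₀ hU (hR.mono inter_subset_left)
  have cI := contDiffOn_chartField x₀ hU (hI.mono inter_subset_left)
  have hfU := hf.1.contMDiffOn (s := U)
  have sf := contDiffOn_comp_chart_symm x₀ hfU
  have hO := isOpen_chartImage (E := E) x₀ hU
  have hl : ∀ e ∈ chartImage (E := E) x₀ U,
      dForm θ.form ((extChartAt 𝓘(ℝ, E) x₀).symm e) (cRe (Z₀ ((extChartAt 𝓘(ℝ, E) x₀).symm e)))
        (cIm (Z₀ ((extChartAt 𝓘(ℝ, E) x₀).symm e))) =
      inner ℝ (dirD (chartField x₀ fun y => cRe (Z₀ y)) (f ∘ (extChartAt 𝓘(ℝ, E) x₀).symm) e)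
        (dirD (chartField x₀ fun y => cRe (Z₀ y)) (f ∘ (extChartAt 𝓘(ℝ, E) x₀).symm) e) := by
    intro e he
    rw [dirD_chartField hU hfU _ he, hf.inner_cRe_cRe (hmem _ he.2)]
  have sa : ContDiffOn ℝ ∞ (fun e => a ((extChartAt 𝓘(ℝ, E) x₀).symm e))
      (chartImage (E := E) x₀ U) := by
    have s1 := sf.dirD cR hO
    refine ContDiffOn.inv ?_ fun e he => (Real.sqrt_pos.2 (hpos _ he.2)).ne'
    exact ((s1.inner ℝ s1).congr hl).sqrt fun e he => (hpos _ he.2).ne'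
  refine ⟨U, hU, ⟨hx₀, mem_extChartAt_source x₀⟩, inter_subset_right,
    fun y => (a y : ℂ) • Z₀ y, ?_, ?_, fun y hy => ⟨?_, ?_, ?_⟩⟩
  · refine (sa.smul cR).congr fun e he => ?_
    have : cRe ((a ((extChartAt 𝓘(ℝ, E) x₀).symm e) : ℂ) • Z₀ ((extChartAt 𝓘(ℝ, E) x₀).symm e))
        = a ((extChartAt 𝓘(ℝ, E) x₀).symm e) • cRe (Z₀ ((extChartAt 𝓘(ℝ, E) x₀).symm e)) := by
      exact cRe_ofReal_smul _ _
    rw [chartField, this, map_smul]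
    rfl
  · refine (sa.smul cI).congr fun e he => ?_
    have : cIm ((a ((extChartAt 𝓘(ℝ, E) x₀).symm e) : ℂ) • Z₀ ((extChartAt 𝓘(ℝ, E) x₀).symm e))
        = a ((extChartAt 𝓘(ℝ, E) x₀).symm e) • cIm (Z₀ ((extChartAt 𝓘(ℝ, E) x₀).symm e)) := by
      exact cIm_ofReal_smul _ _
    rw [chartField, this, map_smul]
    rfl
  · exact smul_ne_zero (Complex.ofReal_ne_zero.2 (ha y hy)) (hZ₀ y hy.1).1
  · rw [(hZ₀ y hy.1).2, Submodule.span_singleton_smul_eq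
      (Complex.ofReal_ne_zero.2 (ha y hy)).isUnit]
  · have h := Real.mul_self_sqrt (hpos y hy).le
    have h' := (Real.sqrt_pos.2 (hpos y hy)).ne'
    simp only [cRe_smul, cIm_smul, Complex.ofReal_re, Complex.ofReal_im, zero_smul, sub_zero,
      add_zero, dForm_smul_left, dForm_smul_right, a]
    field_simp
    nlinarith

/-- The Reeb vector is chosen point by point, so its smoothness has to come from a formula.
`reeb_eq` supplies one, given a smooth field on which `θ` does not vanish; near `x₀` a field
constant in the chart serves. -/
theorem exists_smooth_reeb (hf : θ.IsIsometricImmersion f) (hθ : θ.LeviPosDef) (x₀ : M) :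
    ∃ U : Set M, IsOpen U ∧ x₀ ∈ U ∧ U ⊆ (extChartAt 𝓘(ℝ, E) x₀).source ∧
      ContDiffOn ℝ ∞ (chartField x₀ θ.reeb) (chartImage (E := E) x₀ U) := by
  obtain ⟨U₀, hU₀, hx₀, hs₀, Z, cR, cI, hZ⟩ := hf.exists_unit_generator hθ x₀
  obtain ⟨w, hw⟩ : ∃ w, θ.form x₀ w ≠ 0 := by
    by_contra! h
    exact θ.ne_zero x₀ (ContinuousLinearMap.ext h)
  obtain ⟨v, rfl⟩ := constField_surjective x₀ w
  have hV := contMDiffOn_constField x₀ v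
  have hθV := contMDiffOn_form_apply θ (isOpen_extChartAt_source x₀) hV
  set U := U₀ ∩ ((extChartAt 𝓘(ℝ, E) x₀).source ∩
    (fun y => θ.form y (constField x₀ v y)) ⁻¹' {0}ᶜ)
  have hU : IsOpen U := hU₀.inter
    (hθV.continuousOn.isOpen_inter_preimage (isOpen_extChartAt_source x₀) isOpen_compl_singleton)
  have hfU := hf.1.contMDiffOn (s := U)
  have sf := contDiffOn_comp_chart_symm x₀ hfU
  have hO := isOpen_chartImage (E := E) x₀ hU
  have sub : chartImage (E := E) x₀ U ⊆ chartImage x₀ U₀ := chartImage_mono x₀ inter_subset_left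
  have cV := contDiffOn_chartField x₀ hU (hV.mono (inter_subset_right.trans inter_subset_left))
  have sθ := contDiffOn_comp_chart_symm x₀
    (hθV.mono (inter_subset_right.trans inter_subset_left : U ⊆ _))
  have s1 := sf.dirD (cR.mono sub) hO
  have s2 := sf.dirD (cI.mono sub) hO
  have sV := sf.dirD cV hO
  refine ⟨U, hU, ⟨hx₀, mem_extChartAt_source x₀, hw⟩, inter_subset_left.trans hs₀, ?_⟩
  refine ((sθ.inv fun e he => he.2.2.2).smul ((cV.sub ((s1.inner ℝ sV).smul (cR.mono sub))).sub
    ((s2.inner ℝ sV).smul (cI.mono sub)))).congr fun e he => ?_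
  obtain ⟨h0, hspan, h1⟩ := hZ _ he.2.1
  simp only [Pi.smul_apply', Pi.inv_apply, Function.comp_apply]
  rw [dirD_chartField hU hfU _ he, dirD_chartField hU hfU _ he, dirD_chartField hU hfU _ he,
    chartField, hf.reeb_eq hθ h0 hspan he.2.2.2,
    hf.inner_cRe_cRe (hspan ▸ Submodule.mem_span_singleton_self _), h1, map_smul, map_sub, map_sub,
    map_smul, map_smul, div_one, div_one]
  rfl

/-- The image of the Reeb field is smooth. -/
theorem contMDiff_rDiff_reeb (hf : θ.IsIsometricImmersion f) (hθ : θ.LeviPosDef) :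
    ContMDiff 𝓘(ℝ, E) 𝓘(ℝ, EuclideanSpace ℝ (Fin n)) ∞ fun y => rDiff (E := E) f y (θ.reeb y) := by
  intro x₀
  obtain ⟨U, hU, hx, hs, h⟩ := hf.exists_smooth_reeb hθ x₀
  have hfU := hf.1.contMDiffOn (s := U)
  refine (contMDiffOn_of_chart hs ?_).contMDiffAt (hU.mem_nhds hx)
  exact ((contDiffOn_comp_chart_symm x₀ hfU).dirD h (isOpen_chartImage x₀ hU)).congr
    fun e he => (dirD_chartField hU hfU θ.reeb he).symm

/-- By the isometry `θ = ⟨df, df(T)⟩`, so `dForm_eq_inner` rewrites the Levi normalization and the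
Reeb condition as statements about derivatives of `df(T)`. The sign in `e₂ = -Im Z` makes `dθ(e₁,
e₂) = -1`. -/
theorem exists_adaptedFrame (hf : θ.IsIsometricImmersion f) (hθ : θ.LeviPosDef)
    (hpl : S.IsCRPluriharmonic f) (x₀ : M) :
    ∃ U : Set M, IsOpen U ∧ x₀ ∈ U ∧ U ⊆ (extChartAt 𝓘(ℝ, E) x₀).source ∧
      ∃ (Z : ∀ y : M, CTangent E y) (g : E → EuclideanSpace ℝ (Fin n)),
        (∀ y ∈ U, S.T10 y = Submodule.span ℂ {Z y}) ∧
        AdaptedFrame (chartImage (E := E) x₀ U) (f ∘ (extChartAt 𝓘(ℝ, E) x₀).symm) g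
          (chartField x₀ fun y => cRe (Z y)) (chartField x₀ fun y => -cIm (Z y))
          (chartField x₀ θ.reeb) := by
  obtain ⟨U₁, hU₁, hx₁, hs₁, Z, cR, cI, hZ⟩ := hf.exists_unit_generator hθ x₀
  obtain ⟨U₂, hU₂, hx₂, -, cT⟩ := hf.exists_smooth_reeb hθ x₀
  obtain ⟨U₃, hU₃, hx₃, g, hg, hfg⟩ := hpl.exists_conjugate x₀
  set U := U₁ ∩ U₂ ∩ U₃
  have hU : IsOpen U := (hU₁.inter hU₂).inter hU₃
  have k1 : U ⊆ U₁ := fun y hy => hy.1.1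
  have k2 : U ⊆ U₂ := fun y hy => hy.1.2
  have k3 : U ⊆ U₃ := fun y hy => hy.2
  have hfU := hf.1.contMDiffOn (s := U)
  have hgU := hg.mono k3
  have hnU := (hf.contMDiff_rDiff_reeb hθ).contMDiffOn (s := U)
  have hO := isOpen_chartImage (E := E) x₀ hU
  have cI' : ContDiffOn ℝ ∞ (chartField x₀ fun y => -cIm (Z y)) (chartImage (E := E) x₀ U) :=
    ((cI.mono (chartImage_mono x₀ k1)).neg).congr fun e he => by
      rw [chartField, map_neg]; rfl
  have hmem : ∀ y ∈ U, Z y ∈ S.T10 y := fun y hy =>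
    (hZ y (k1 hy)).2.1 ▸ Submodule.mem_span_singleton_self _
  have hdT : EqOn (dirD (chartField x₀ θ.reeb) (f ∘ (extChartAt 𝓘(ℝ, E) x₀).symm))
      ((fun y => rDiff (E := E) f y (θ.reeb y)) ∘ (extChartAt 𝓘(ℝ, E) x₀).symm)
      (chartImage (E := E) x₀ U) := fun e he => dirD_chartField hU hfU θ.reeb he
  have hform : ∀ (y : M) (v : TangentSpace 𝓘(ℝ, E) y),
      θ.form y v = inner ℝ (rDiff f y v) (rDiff f y (θ.reeb y)) :=
    fun y v => (hf.inner_reeb hθ v).symm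
  have hd : ∀ y ∈ U, ∀ u v : TangentSpace 𝓘(ℝ, E) y, _ := fun y hy =>
    dForm_eq_inner hU hfU hnU hform hy
  -- The vector `df(T)` has constant length, so it is orthogonal to its derivatives.
  have hnn : ∀ X : ∀ y : M, TangentSpace 𝓘(ℝ, E) y, ∀ e ∈ chartImage (E := E) x₀ U,
      inner ℝ (rDiff f ((extChartAt 𝓘(ℝ, E) x₀).symm e) (θ.reeb ((extChartAt 𝓘(ℝ, E) x₀).symm e)))
        (rDiff (fun y => rDiff (E := E) f y (θ.reeb y)) ((extChartAt 𝓘(ℝ, E) x₀).symm e)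
          (X ((extChartAt 𝓘(ℝ, E) x₀).symm e))) = 0 := by
    intro X e he
    have h1 := inner_dirD_self (X := chartField x₀ X) hO (contDiffOn_comp_chart_symm x₀ hnU) (c := 1)
      (fun y hy => hf.inner_reeb_reeb hθ) he
    rwa [dirD_chartField hU hnU _ he] at h1
  refine ⟨U, hU, ⟨⟨hx₁, hx₂⟩, hx₃⟩, k1.trans hs₁, Z, g ∘ (extChartAt 𝓘(ℝ, E) x₀).symm,
    fun y hy => (hZ y (k1 hy)).2.1, hO, contDiffOn_comp_chart_symm x₀ hfU,
    contDiffOn_comp_chart_symm x₀ hgU, cR.mono (chartImage_mono x₀ k1), cI',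
    cT.mono (chartImage_mono x₀ k2), ?_, ?_, ?_, ?_, ?_, ?_, ?_, ?_, ?_, ?_, ?_⟩
  · intro e he
    rw [dirD_chartField hU hfU _ he, hf.inner_cRe_cRe (hmem _ he.2), (hZ _ (k1 he.2)).2.2]
  · intro e he
    rw [dirD_chartField hU hfU _ he, map_neg, inner_neg_neg, hf.inner_cIm_cIm (hmem _ he.2),
      (hZ _ (k1 he.2)).2.2]
  · intro e he
    rw [dirD_chartField hU hfU _ he, hf.inner_reeb_reeb hθ]
  · intro e he
    rw [dirD_chartField hU hfU _ he, dirD_chartField hU hfU _ he, map_neg, inner_neg_right,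
      hf.inner_cRe_cIm (hmem _ he.2), neg_zero]
  · intro e he
    rw [dirD_chartField hU hfU _ he, dirD_chartField hU hfU _ he, hf.inner_reeb hθ,
      (θ.form_of_mem (hmem _ he.2)).1]
  · intro e he
    rw [dirD_chartField hU hfU _ he, dirD_chartField hU hfU _ he, hf.inner_reeb hθ, map_neg,
      (θ.form_of_mem (hmem _ he.2)).2, neg_zero]
  · intro e he
    rw [dirD_chartField hU hfU _ he, dirD_chartField hU hgU _ he, map_neg, neg_neg,
      (hfg _ he.2.2 _ (hmem _ he.2)).1]
  · intro e he
    rw [dirD_chartField hU hfU _ he, dirD_chartField hU hgU _ he, map_neg,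
      (hfg _ he.2.2 _ (hmem _ he.2)).2, neg_neg]
  · intro e he
    rw [dirD_congr hO hdT he, dirD_congr hO hdT he, dirD_chartField hU hfU _ he,
      dirD_chartField hU hfU _ he, dirD_chartField hU hnU _ he, dirD_chartField hU hnU _ he,
      ← hd _ he.2, dForm_neg_right, (hZ _ (k1 he.2)).2.2]
  · intro e he
    have h1 := hd _ he.2 (θ.reeb _) (cRe (Z ((extChartAt 𝓘(ℝ, E) x₀).symm e)))
    rw [(θ.isReeb_reeb hθ _).2, hnn (fun y => cRe (Z y)) e he, sub_zero] at h1
    rw [dirD_congr hO hdT he, dirD_chartField hU hfU _ he, dirD_chartField hU hnU _ he, ← h1]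
  · intro e he
    have h1 := hd _ he.2 (θ.reeb _) (-cIm (Z ((extChartAt 𝓘(ℝ, E) x₀).symm e)))
    rw [(θ.isReeb_reeb hθ _).2, hnn (fun y => -cIm (Z y)) e he, sub_zero] at h1
    rw [dirD_congr hO hdT he, dirD_chartField hU hfU _ he, dirD_chartField hU hnU _ he, ← h1]

end IsIsometricImmersion
end PseudohermitianStructure
end ExistsAdaptedFrame

/-! ### One model for the whole connected manifold. -/

section GlobalModel

variable {E : Type*} [NormedAddCommGroup E] [NormedSpace ℝ E]
variable {M : Type*} [TopologicalSpace M] [ChartedSpace E M] [IsManifold 𝓘(ℝ, E) ∞ M]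

theorem rDiff_clm_sub_clm {F G : Type*} [NormedAddCommGroup F] [NormedSpace ℝ F]
    [NormedAddCommGroup G] [NormedSpace ℝ G] (P Q : F →L[ℝ] G) {f n : M → F}
    (hf : ContMDiff 𝓘(ℝ, E) 𝓘(ℝ, F) ∞ f) (hn : ContMDiff 𝓘(ℝ, E) 𝓘(ℝ, F) ∞ n) (x : M)
    (v : TangentSpace 𝓘(ℝ, E) x) :
    rDiff (fun y => P (f y) - Q (n y)) x v = P (rDiff f x v) - Q (rDiff n x v) := by
  have hs : x ∈ (extChartAt 𝓘(ℝ, E) x).source := mem_extChartAt_source x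
  have hu : ContMDiffOn 𝓘(ℝ, E) 𝓘(ℝ, G) ∞ (fun y => P (f y) - Q (n y)) univ :=
    ((P.contDiff.contMDiff.comp hf).sub (Q.contDiff.contMDiff.comp hn)).contMDiffOn
  have hx := mem_chartImage hs (mem_univ x)
  have hO := isOpen_chartImage (E := E) x isOpen_univ
  have df := (contDiffOn_comp_chart_symm x hf.contMDiffOn).differentiableAt_of_isOpen hO hx
  have dn := (contDiffOn_comp_chart_symm x hn.contMDiffOn).differentiableAt_of_isOpen hO hx
  rw [← fderiv_comp_chart_symm isOpen_univ hu (mem_univ x) hs v,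
    ← fderiv_comp_chart_symm isOpen_univ hf.contMDiffOn (mem_univ x) hs v,
    ← fderiv_comp_chart_symm isOpen_univ hn.contMDiffOn (mem_univ x) hs v]
  have h := (P.hasFDerivAt.comp _ df.hasFDerivAt).sub (Q.hasFDerivAt.comp _ dn.hasFDerivAt)
  exact DFunLike.congr_fun h.fderiv _

namespace PseudohermitianStructure

variable {S : CRStructure E 1 M} {θ : PseudohermitianStructure S} {n : ℕ}
  {f : M → EuclideanSpace ℝ (Fin n)}

/-- At the point `y` the differential of `f` is compatible with the complex structure `J`, and the
normal is infinitesimally that of the sphere or cylinder of radius `r`. -/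
structure IsModelAt (θ : PseudohermitianStructure S) (f : M → EuclideanSpace ℝ (Fin n))
    (J P : EuclideanSpace ℝ (Fin n) →L[ℝ] EuclideanSpace ℝ (Fin n)) (r : ℝ) (y : M) : Prop where
  map_cRe : ∀ Z ∈ S.T10 y, J (rDiff f y (cRe Z)) = -rDiff f y (cIm Z)
  map_normal : P (J (rDiff f y (θ.reeb y))) = J (rDiff f y (θ.reeb y))
  shape : ∀ v : TangentSpace 𝓘(ℝ, E) y, P (rDiff f y v) =
    r • J (rDiff (fun z => rDiff (E := E) f z (θ.reeb z)) y v)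

namespace IsModelAt

variable {J P J' P' : EuclideanSpace ℝ (Fin n) →L[ℝ] EuclideanSpace ℝ (Fin n)} {r r' : ℝ} {y : M}

theorem map_cIm (h : θ.IsModelAt f J P r y) {Z : CTangent E y} (hZ : Z ∈ S.T10 y) :
    J (rDiff f y (cIm Z)) = rDiff f y (cRe Z) := by
  have := h.map_cRe _ (Submodule.smul_mem _ (-Complex.I) hZ)
  rw [cRe_smul, cIm_smul] at this
  simpa using this

theorem orthonormal4 (h : θ.IsModelAt f J P r y) (hm : HypersurfaceModel J P r)
    (hf : θ.IsIsometricImmersion f) (hθ : θ.LeviPosDef) {Z : CTangent E y} (hZ : Z ∈ S.T10 y)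
    (h1 : dForm θ.form y (cRe Z) (cIm Z) = 1) :
    Orthonormal4 (rDiff f y (cRe Z)) (rDiff f y (cIm Z)) (rDiff f y (θ.reeb y))
      (J (rDiff f y (θ.reeb y))) := by
  have r1 := hf.inner_reeb hθ (cRe Z)
  have r2 := hf.inner_reeb hθ (cIm Z)
  rw [(θ.form_of_mem hZ).1] at r1
  rw [(θ.form_of_mem hZ).2] at r2
  refine ⟨?_, ?_, hf.inner_reeb_reeb hθ, ?_, hf.inner_cRe_cIm hZ, r1, ?_, r2, ?_, ?_⟩
  · rw [hf.inner_cRe_cRe hZ, h1]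
  · rw [hf.inner_cIm_cIm hZ, h1]
  · rw [hm.inner_J, hm.J_J, inner_neg_right, neg_neg, hf.inner_reeb_reeb hθ]
  · rw [real_inner_comm, hm.inner_J, h.map_cRe _ hZ, inner_neg_right, neg_neg, real_inner_comm, r2]
  · rw [real_inner_comm, hm.inner_J, h.map_cIm hZ, real_inner_comm, r1, neg_zero]
  · have := hm.inner_J (rDiff f y (θ.reeb y)) (rDiff f y (θ.reeb y))
    rw [real_inner_comm] at this
    linarith

end IsModelAt

theorem exists_isModelAt (hE : Module.finrank ℝ E = 3) {f : M → EuclideanSpace ℝ (Fin 4)}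
    (hf : θ.IsIsometricImmersion f) (hθ : θ.LeviPosDef) (hpl : S.IsCRPluriharmonic f) (x₀ : M) :
    ∃ U : Set M, IsOpen U ∧ x₀ ∈ U ∧
      ∃ (J P : EuclideanSpace ℝ (Fin 4) →L[ℝ] EuclideanSpace ℝ (Fin 4)) (r : ℝ),
        HypersurfaceModel J P r ∧ ∀ y ∈ U, θ.IsModelAt f J P r y := by
  obtain ⟨U, hU, hx, hs, Z, g, hZ, hA⟩ := hf.exists_adaptedFrame hθ hpl x₀
  obtain ⟨W, hWU, hW, hxW, J, P, r, hm, h⟩ :=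
    hA.exists_model hE (by simp) (mem_chartImage (hs hx) hx)
  have hfU := hf.1.contMDiffOn (s := U)
  have hn := hf.contMDiff_rDiff_reeb hθ
  refine ⟨U ∩ ((extChartAt 𝓘(ℝ, E) x₀).source ∩ extChartAt 𝓘(ℝ, E) x₀ ⁻¹' W),
    hU.inter ((continuousOn_extChartAt x₀).isOpen_inter_preimage (isOpen_extChartAt_source x₀) hW),
    ⟨hx, mem_extChartAt_source x₀, hxW⟩, J, P, r, hm, ?_⟩
  rintro y ⟨hyU, hys, hyW⟩
  obtain ⟨a1, a2, a3⟩ := h _ hyW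
  have he := hWU hyW
  have hT : EqOn (dirD (chartField x₀ θ.reeb) (f ∘ (extChartAt 𝓘(ℝ, E) x₀).symm))
      ((fun y => rDiff (E := E) f y (θ.reeb y)) ∘ (extChartAt 𝓘(ℝ, E) x₀).symm)
      (chartImage (E := E) x₀ U) := fun e he => dirD_chartField hU hfU θ.reeb he
  have hT' := hT he
  rw [Function.comp_apply, (extChartAt 𝓘(ℝ, E) x₀).left_inv hys] at hT'
  rw [dirD_chartField hU hfU _ he, dirD_chartField hU hfU _ he,
    (extChartAt 𝓘(ℝ, E) x₀).left_inv hys, map_neg] at a1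
  rw [hT'] at a2
  refine ⟨fun Z' hZ' => ?_, a2, fun v => ?_⟩
  · rw [hZ y hyU, Submodule.mem_span_singleton] at hZ'
    obtain ⟨c, rfl⟩ := hZ'
    have a1' := hm.J_J (rDiff f y (cRe (Z y)))
    rw [a1, map_neg, neg_inj] at a1'
    rw [cRe_smul, cIm_smul, map_sub, map_smul, map_smul, map_sub, map_smul, map_smul, a1, a1',
      map_add, map_smul, map_smul]
    module
  · have h1 := rDiff_clm_sub_clm P (r • J) hf.1 hn y v
    have hu : ContMDiffOn 𝓘(ℝ, E) 𝓘(ℝ, EuclideanSpace ℝ (Fin 4)) ∞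
        (fun y => P (f y) - (r • J) (rDiff (E := E) f y (θ.reeb y))) U :=
      ((P.contDiff.contMDiff.comp hf.1).sub ((r • J).contDiff.contMDiff.comp hn)).contMDiffOn
    have h2 := fderiv_comp_chart_symm hU hu hyU hys v
    have h3 : (fun y => P ((f ∘ (extChartAt 𝓘(ℝ, E) x₀).symm) y)
        - r • J (dirD (chartField x₀ θ.reeb) (f ∘ (extChartAt 𝓘(ℝ, E) x₀).symm) y))
        =ᶠ[nhds (extChartAt 𝓘(ℝ, E) x₀ y)]
        (fun y => P (f y) - (r • J) (rDiff (E := E) f y (θ.reeb y)))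
          ∘ (extChartAt 𝓘(ℝ, E) x₀).symm := by
      filter_upwards [(isOpen_chartImage x₀ hU).mem_nhds he] with e he
      rw [hT he]
      rfl
    rw [← h3.fderiv_eq, a3, h1] at h2
    exact sub_eq_zero.1 h2.symm

/-- The complex structure of the model is determined by the immersion. -/
theorem IsModelAt.unique (hE : Module.finrank ℝ E = 3) {f : M → EuclideanSpace ℝ (Fin 4)}
    (hf : θ.IsIsometricImmersion f) (hθ : θ.LeviPosDef) (hpl : S.IsCRPluriharmonic f)
    {J P J' P' : EuclideanSpace ℝ (Fin 4) →L[ℝ] EuclideanSpace ℝ (Fin 4)} {r r' : ℝ}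
    (hm : HypersurfaceModel J P r) (hm' : HypersurfaceModel J' P' r') {V : Set M} (hV : IsOpen V)
    (h : ∀ y ∈ V, θ.IsModelAt f J P r y) (h' : ∀ y ∈ V, θ.IsModelAt f J' P' r' y)
    {x : M} (hx : x ∈ V) : J = J' ∧ P = P' ∧ r = r' := by
  have hF : Module.finrank ℝ (EuclideanSpace ℝ (Fin 4)) = 4 := by simp
  -- On the open set `V` the two complex structures agree on the image of the contact plane, so `(J
  -- - J') ∘ f` has zero derivatives along `e₁` and `e₂`. The commutator of `e₁` and `e₂` carries
  -- this over to the Reeb direction.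
  have hnT : J (rDiff f x (θ.reeb x)) = J' (rDiff f x (θ.reeb x)) := by
    obtain ⟨U, hU, hxU, hs, Z, g, hZ, hA⟩ := hf.exists_adaptedFrame hθ hpl x
    have hfU := hf.1.contMDiffOn (s := U)
    set W := chartImage (E := E) x (U ∩ V)
    have hW : IsOpen W := isOpen_chartImage x (hU.inter hV)
    have hWU : W ⊆ chartImage x U := chartImage_mono x inter_subset_left
    have hB := hA.mono hW hWU
    have hxW : extChartAt 𝓘(ℝ, E) x x ∈ W := mem_chartImage (hs hxU) ⟨hxU, hx⟩
    have key : ∀ X : E → E, ∀ e ∈ W,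
        dirD X (fun e => (J - J') ((f ∘ (extChartAt 𝓘(ℝ, E) x).symm) e)) e =
          (J - J') (dirD X (f ∘ (extChartAt 𝓘(ℝ, E) x).symm) e) := fun X e he =>
      dirD_clm (J - J') (hB.smooth_f.differentiableAt_of_isOpen hW he)
    have hmem : ∀ e ∈ W, Z ((extChartAt 𝓘(ℝ, E) x).symm e) ∈
        S.T10 ((extChartAt 𝓘(ℝ, E) x).symm e) := fun e he =>
      hZ _ he.2.1 ▸ Submodule.mem_span_singleton_self _
    have k1 : EqOn (dirD (chartField x fun y => cRe (Z y))
        (fun e => (J - J') ((f ∘ (extChartAt 𝓘(ℝ, E) x).symm) e))) (fun _ => 0) W := fun e he => by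
      rw [key _ e he, dirD_chartField hU hfU _ (hWU he), sub_apply,
        (h _ he.2.2).map_cRe _ (hmem e he), (h' _ he.2.2).map_cRe _ (hmem e he), sub_self]
    have k2 : EqOn (dirD (chartField x fun y => -cIm (Z y))
        (fun e => (J - J') ((f ∘ (extChartAt 𝓘(ℝ, E) x).symm) e))) (fun _ => 0) W := fun e he => by
      rw [key _ e he, dirD_chartField hU hfU _ (hWU he), sub_apply, map_neg,
        map_neg, map_neg, (h _ he.2.2).map_cIm (hmem e he), (h' _ he.2.2).map_cIm (hmem e he),
        sub_self]
    have hc := hB.commutator_12 hE hxW ((J - J').contDiff.comp_contDiffOn hB.smooth_f)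
    change dirD _ (dirD _ (fun e => (J - J') ((f ∘ (extChartAt 𝓘(ℝ, E) x).symm) e))) _
      - dirD _ (dirD _ (fun e => (J - J') ((f ∘ (extChartAt 𝓘(ℝ, E) x).symm) e))) _
      = _ • dirD _ (fun e => (J - J') ((f ∘ (extChartAt 𝓘(ℝ, E) x).symm) e)) _
      + _ • dirD _ (fun e => (J - J') ((f ∘ (extChartAt 𝓘(ℝ, E) x).symm) e)) _
      + dirD _ (fun e => (J - J') ((f ∘ (extChartAt 𝓘(ℝ, E) x).symm) e)) _ at hc
    rw [dirD_congr hW k2 hxW, dirD_congr hW k1 hxW, k1 hxW, k2 hxW, dirD_const, dirD_const,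
      key _ _ hxW, dirD_chartField hU hfU θ.reeb (hWU hxW), extChartAt_to_inv] at hc
    simpa [sub_eq_zero] using hc.symm
  obtain ⟨U, -, hxU, -, Z, -, -, hZ⟩ := hf.exists_unit_generator hθ x
  obtain ⟨-, hspan, h1⟩ := hZ x hxU
  have hmem : Z x ∈ S.T10 x := hspan ▸ Submodule.mem_span_singleton_self _
  have hm4 := (h x hx).orthonormal4 hm hf hθ hmem h1
  have ext4 : ∀ A B : EuclideanSpace ℝ (Fin 4) →L[ℝ] EuclideanSpace ℝ (Fin 4),
      A (rDiff f x (cRe (Z x))) = B (rDiff f x (cRe (Z x))) →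
      A (rDiff f x (cIm (Z x))) = B (rDiff f x (cIm (Z x))) →
      A (rDiff f x (θ.reeb x)) = B (rDiff f x (θ.reeb x)) →
      A (J (rDiff f x (θ.reeb x))) = B (J (rDiff f x (θ.reeb x))) → A = B := by
    intro A B b1 b2 b3 b4
    ext1 v
    rw [hm4.expand hF v]
    simp only [map_add, map_smul, b1, b2, b3, b4]
  have hJ : J = J' := by
    refine ext4 _ _ ?_ ?_ hnT ?_
    · rw [(h x hx).map_cRe _ hmem, (h' x hx).map_cRe _ hmem]
    · rw [(h x hx).map_cIm hmem, (h' x hx).map_cIm hmem]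
    · rw [hm.J_J, hnT, hm'.J_J]
  subst hJ
  have hs : ∀ v : TangentSpace 𝓘(ℝ, E) x, r' • P (rDiff f x v) = r • P' (rDiff f x v) := fun v => by
    rw [(h x hx).shape, (h' x hx).shape, smul_comm]
  -- A sphere and a cylinder cannot both fit: `id = 2Q` would hold on tangent vectors for a
  -- projection `Q`, but `1/2` is not an eigenvalue of a projection.
  have hmix : ∀ Q : EuclideanSpace ℝ (Fin 4) →L[ℝ] EuclideanSpace ℝ (Fin 4), (∀ v, Q (Q v) = Q v) →
      (∀ v : TangentSpace 𝓘(ℝ, E) x, rDiff f x v = (2 : ℝ) • Q (rDiff f x v)) → False := by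
    intro Q hQ hv
    have b1 := hv (θ.reeb x)
    have b2 := congrArg Q b1
    rw [map_smul, hQ] at b2
    have b3 : Q (rDiff f x (θ.reeb x)) = 0 := by
      linear_combination (norm := module) -b2
    rw [b3, smul_zero] at b1
    have := hm4.cc
    rw [b1, inner_zero_left] at this
    exact zero_ne_one this
  rcases hm.sphere_or_cylinder with ⟨rfl, rfl⟩ | ⟨rfl, hPP, -, -⟩ <;>
    rcases hm'.sphere_or_cylinder with ⟨rfl, rfl⟩ | ⟨rfl, hPP', -, -⟩
  · exact ⟨rfl, rfl, rfl⟩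
  · exact (hmix P' hPP' fun v => by simpa using hs v).elim
  · exact (hmix P hPP fun v => by simpa using (hs v).symm).elim
  · refine ⟨rfl, ext4 _ _ ?_ ?_ ?_ ?_, rfl⟩
    · simpa using hs (cRe (Z x))
    · simpa using hs (cIm (Z x))
    · simpa using hs (θ.reeb x)
    · rw [(h x hx).map_normal, (h' x hx).map_normal]

/-- The model is the same at all points. -/
theorem exists_isModel [ConnectedSpace M] (hE : Module.finrank ℝ E = 3)
    {f : M → EuclideanSpace ℝ (Fin 4)}
    (hf : θ.IsIsometricImmersion f) (hθ : θ.LeviPosDef) (hpl : S.IsCRPluriharmonic f) :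
    ∃ (J P : EuclideanSpace ℝ (Fin 4) →L[ℝ] EuclideanSpace ℝ (Fin 4)) (r : ℝ),
      HypersurfaceModel J P r ∧ ∀ y, θ.IsModelAt f J P r y := by
  choose U hU hxU J P r hm h using fun x₀ => θ.exists_isModelAt hE hf hθ hpl x₀
  -- Uniqueness on overlaps makes the chosen data locally constant, hence constant by connectedness.
  have hloc : IsLocallyConstant fun x => (J x, P x, r x) := by
    rw [IsLocallyConstant.iff_eventually_eq]
    intro x
    filter_upwards [(hU x).mem_nhds (hxU x)] with y hy
    obtain ⟨a, b, c⟩ := IsModelAt.unique hE hf hθ hpl (hm y) (hm x) ((hU y).inter (hU x))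
      (fun z hz => h y z hz.1) (fun z hz => h x z hz.2) ⟨hxU y, hy⟩
    rw [a, b, c]
  obtain ⟨x₀⟩ : Nonempty M := inferInstance
  refine ⟨J x₀, P x₀, r x₀, hm x₀, fun y => ?_⟩
  have := hloc.apply_eq_of_preconnectedSpace x₀ y
  simp only [Prod.mk.injEq] at this
  rw [this.1, this.2.1, this.2.2]
  exact h y y (hxU y)

/-- A function with vanishing differential on a connected manifold is constant. -/
theorem _root_.eq_of_rDiff_eq_zero [PreconnectedSpace M] {F : Type*} [NormedAddCommGroup F]
    [NormedSpace ℝ F] {u : M → F} (hu : ContMDiff 𝓘(ℝ, E) 𝓘(ℝ, F) ∞ u)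
    (h : ∀ x, ∀ v : TangentSpace 𝓘(ℝ, E) x, rDiff u x v = 0) (x y : M) : u x = u y := by
  refine IsLocallyConstant.apply_eq_of_preconnectedSpace ?_ x y
  rw [IsLocallyConstant.iff_eventually_eq]
  intro x₀
  have hO := isOpen_chartImage (E := E) x₀ isOpen_univ
  have hx := mem_chartImage (E := E) (mem_extChartAt_source (I := 𝓘(ℝ, E)) x₀) (mem_univ x₀)
  obtain ⟨ε, hε, hball⟩ := Metric.isOpen_iff.1 hO _ hx
  have hd : ∀ e ∈ Metric.ball (extChartAt 𝓘(ℝ, E) x₀ x₀) ε,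
      fderiv ℝ (u ∘ (extChartAt 𝓘(ℝ, E) x₀).symm) e = 0 := by
    intro e he
    ext v
    have ht := (hball he).1
    have h1 := fderiv_comp_chart_symm (x₀ := x₀) isOpen_univ hu.contMDiffOn (mem_univ _)
      ((extChartAt 𝓘(ℝ, E) x₀).map_target ht)
      (mfderiv 𝓘(ℝ, E) 𝓘(ℝ, E) (extChartAt 𝓘(ℝ, E) x₀).symm e v)
    rw [mfderiv_chart_symm_apply ht, (extChartAt 𝓘(ℝ, E) x₀).right_inv ht, h] at h1
    exact h1
  have hc := (contDiffOn_comp_chart_symm x₀ (hu.contMDiffOn (s := univ))).mono hball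
  filter_upwards [(isOpen_extChartAt_source (I := 𝓘(ℝ, E)) x₀).mem_nhds (mem_extChartAt_source x₀),
    (continuousAt_extChartAt (I := 𝓘(ℝ, E)) x₀) (Metric.ball_mem_nhds _ hε)] with z hz hz'
  have := Metric.isOpen_ball.is_const_of_fderiv_eq_zero (convex_ball _ ε).isPreconnected
    (hc.differentiableOn (by simp)) hd hz' (Metric.mem_ball_self hε)
  simpa only [Function.comp_apply, (extChartAt 𝓘(ℝ, E) x₀).left_inv hz, extChartAt_to_inv] using this

/-- By `shape` the function `P f - r J df(T)` has zero differential. Its value `c` is fixed by `P`,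
because `P` is idempotent and fixes the normal `J df(T)`. -/
theorem exists_center [ConnectedSpace M] {f : M → EuclideanSpace ℝ (Fin n)}
    {J P : EuclideanSpace ℝ (Fin n) →L[ℝ] EuclideanSpace ℝ (Fin n)} {r : ℝ}
    (hf : θ.IsIsometricImmersion f) (hθ : θ.LeviPosDef) (hm : HypersurfaceModel J P r)
    (h : ∀ y, θ.IsModelAt f J P r y) :
    ∃ c, ∀ y, P (f y - c) = r • J (rDiff f y (θ.reeb y)) := by
  have hn := hf.contMDiff_rDiff_reeb hθ
  obtain ⟨x₀⟩ : Nonempty M := inferInstance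
  have hPP : ∀ v, P (P v) = P v := by
    rcases hm.sphere_or_cylinder with ⟨rfl, rfl⟩ | ⟨-, hPP, -, -⟩
    · exact fun v => rfl
    · exact hPP
  refine ⟨P (f x₀) - r • J (rDiff f x₀ (θ.reeb x₀)), fun y => ?_⟩
  have hu := (P.contDiff.contMDiff.comp hf.1).sub ((r • J).contDiff.contMDiff.comp hn)
  have := eq_of_rDiff_eq_zero hu (fun x v => by
    refine (rDiff_clm_sub_clm P (r • J) hf.1 hn x v).trans ?_
    rw [(h x).shape]
    exact sub_self _) x₀ y
  change P (f x₀) - r • J (rDiff f x₀ (θ.reeb x₀)) = P (f y) - r • J (rDiff f y (θ.reeb y)) at this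
  rw [this, map_sub, map_sub, hPP, map_smul, (h y).map_normal]
  abel

end PseudohermitianStructure
end GlobalModel

/-! ### Local inverses through a tubular neighbourhood. -/

section TubularInverse

variable {E : Type*} [NormedAddCommGroup E] [NormedSpace ℝ E]
variable {M : Type*} [TopologicalSpace M] [ChartedSpace E M] [IsManifold 𝓘(ℝ, E) ∞ M]
variable {F : Type*} [NormedAddCommGroup F] [InnerProductSpace ℝ F]

/-- An immersed hypersurface `h` with normal `P h`, where `P` is a projection and `P h` has constant
length `r`, has local inverses defined on open subsets of the ambient space. -/
theorem exists_local_inverse [FiniteDimensional ℝ E] [FiniteDimensional ℝ F]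
    (hdim : Module.finrank ℝ E + 1 = Module.finrank ℝ F) {h : M → F} {P : F →L[ℝ] F} {r : ℝ}
    (hh : ContMDiff 𝓘(ℝ, E) 𝓘(ℝ, F) ∞ h) (hP : ∀ v, P (P v) = P v) (hr : 0 < r)
    (hnorm : ∀ y, ‖P (h y)‖ = r)
    (hperp : ∀ y, ∀ v : TangentSpace 𝓘(ℝ, E) y, inner ℝ (P (h y)) (rDiff h y v) = 0)
    (hinj : ∀ y, Function.Injective (rDiff (E := E) h y)) (x : M) :
    ∃ (V : Set M) (O : Set F) (χ : F → M), IsOpen V ∧ x ∈ V ∧ IsOpen O ∧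
      ContMDiffOn 𝓘(ℝ, F) 𝓘(ℝ, E) ∞ χ O ∧ (∀ y ∈ V, h y ∈ O ∧ χ (h y) = y) ∧
      ∀ q ∈ O, ‖P q‖ = r → χ q ∈ V ∧ h (χ q) = q := by
  have : CompleteSpace E := FiniteDimensional.complete ℝ E
  set k : E → F := h ∘ (extChartAt 𝓘(ℝ, E) x).symm
  set D : Set E := chartImage x univ
  have hD : IsOpen D := isOpen_chartImage x isOpen_univ
  have hxs : x ∈ (extChartAt 𝓘(ℝ, E) x).source := mem_extChartAt_source x
  have hxD : extChartAt 𝓘(ℝ, E) x x ∈ D := mem_chartImage hxs (mem_univ x)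
  have sk : ContDiffOn ℝ ∞ k D := contDiffOn_comp_chart_symm x hh.contMDiffOn
  -- Displacement along the normal `P h` is added as a coordinate. The normal is orthogonal to the
  -- image of `dh`, so the differential of `Φ` at `z₀` is injective, and bijective by dimension.
  set Φ : E × ℝ → F := fun z => k z.1 + z.2 • P (k z.1)
  have hD2 : IsOpen (D ×ˢ (univ : Set ℝ)) := hD.prod isOpen_univ
  have sΦ : ContDiffOn ℝ ∞ Φ (D ×ˢ univ) := by
    have s1 : ContDiffOn ℝ ∞ (fun z : E × ℝ => k z.1) (D ×ˢ univ) :=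
      sk.comp contDiff_fst.contDiffOn fun z hz => hz.1
    exact s1.add (contDiff_snd.contDiffOn.smul (P.contDiff.comp_contDiffOn s1))
  set z₀ : E × ℝ := (extChartAt 𝓘(ℝ, E) x x, 0)
  have hz₀ : z₀ ∈ D ×ˢ (univ : Set ℝ) := ⟨hxD, mem_univ _⟩
  have hkx : k z₀.1 = h x := by
    change h _ = h x
    rw [extChartAt_to_inv]
  have hdk := (sk.differentiableAt_of_isOpen hD hxD).hasFDerivAt
  have hdΦ : ∀ w, fderiv ℝ Φ z₀ w = fderiv ℝ k z₀.1 w.1 + w.2 • P (k z₀.1) := by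
    intro w
    have d1 : HasFDerivAt (fun z : E × ℝ => k z.1) _ z₀ :=
      HasFDerivAt.comp z₀ (g := k) hdk hasFDerivAt_fst
    have d2 := d1.add ((hasFDerivAt_snd (𝕜 := ℝ) (p := z₀)).smul (P.hasFDerivAt.comp z₀ d1))
    refine (DFunLike.congr_fun d2.fderiv w).trans ?_
    simp [z₀]
  have hdkv : ∀ v, fderiv ℝ k z₀.1 v = rDiff h x (constField x v x) := by
    intro v
    have h1 := fderiv_comp_chart_symm isOpen_univ hh.contMDiffOn (mem_univ x) hxs (constField x v x)
    rw [← h1]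
    exact congrArg _ (chartField_constField v hxs).symm
  have hbij : ∃ L : (E × ℝ) ≃L[ℝ] F, (L : E × ℝ →L[ℝ] F) = fderiv ℝ Φ z₀ := by
    have hi : Function.Injective (fderiv ℝ Φ z₀).toLinearMap := by
      rw [← LinearMap.ker_eq_bot, LinearMap.ker_eq_bot']
      intro w hw
      change fderiv ℝ Φ z₀ w = 0 at hw
      rw [hdΦ, hkx, hdkv] at hw
      have h1 := congrArg (inner ℝ (P (h x))) hw
      rw [inner_add_right, hperp, inner_smul_right, real_inner_self_eq_norm_sq, hnorm, zero_add,
        inner_zero_right] at h1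
      have h2 : w.2 = 0 := by
        rcases mul_eq_zero.1 h1 with h2 | h2
        · exact h2
        · exact absurd h2 (by positivity)
      rw [h2, zero_smul, add_zero, ← map_zero (rDiff (E := E) h x)] at hw
      have h3 := chartField_constField w.1 hxs
      rw [hinj x hw] at h3
      refine Prod.ext ?_ h2
      rw [← h3]
      exact map_zero _
    have hfin : Module.finrank ℝ (E × ℝ) = Module.finrank ℝ F := by
      rw [Module.finrank_prod, Module.finrank_self, hdim]
    refine ⟨(LinearEquiv.ofInjectiveOfFinrankEq (fderiv ℝ Φ z₀).toLinearMap hi hfin).toContinuousLinearEquiv, ?_⟩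
    exact ContinuousLinearMap.ext fun w => rfl
  obtain ⟨L, hL⟩ := hbij
  have sΦ₀ : ContDiffAt ℝ ∞ Φ z₀ := sΦ.contDiffAt (hD2.mem_nhds hz₀)
  have hLd : HasFDerivAt Φ (L : E × ℝ →L[ℝ] F) z₀ := by
    rw [hL]
    exact (sΦ₀.differentiableAt (by simp)).hasFDerivAt
  set Ψ := sΦ₀.toOpenPartialHomeomorph Φ hLd (by simp)
  have hΨ : ∀ z, Ψ z = Φ z := fun z => rfl
  -- On `R` the differential of `Φ` stays invertible, which makes the inverse smooth on a whole open
  -- set and not only at one point.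
  set R : Set (E × ℝ) := (D ×ˢ univ) ∩ (fderiv ℝ Φ) ⁻¹' range ((↑) : ((E × ℝ) ≃L[ℝ] F) → _)
  have hR : IsOpen R := (sΦ.continuousOn_fderiv_of_isOpen hD2 (by simp)).isOpen_inter_preimage hD2
    ContinuousLinearEquiv.isOpen
  -- The bound `|t| < 1` keeps `1 + t` positive. As `P q = (1 + t) P k`, the condition `‖P q‖ = r`
  -- then forces `t = 0`, that is, `q` in the image of `h`.
  set B : Set (E × ℝ) := Ψ.source ∩ (R ∩ (univ ×ˢ Metric.ball 0 1))
  have hB : IsOpen B := Ψ.open_source.inter (hR.inter (isOpen_univ.prod Metric.isOpen_ball))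
  have hz₀B : z₀ ∈ B := ⟨sΦ₀.mem_toOpenPartialHomeomorph_source hLd (by simp), ⟨hz₀, ⟨L, hL⟩⟩,
    mem_univ _, Metric.mem_ball_self one_pos⟩
  set O : Set F := Ψ.target ∩ Ψ.symm ⁻¹' B
  have hO : IsOpen O := Ψ.isOpen_inter_preimage_symm hB
  set V : Set M := (extChartAt 𝓘(ℝ, E) x).source ∩
    extChartAt 𝓘(ℝ, E) x ⁻¹' ((fun e => (e, (0 : ℝ))) ⁻¹' B)
  have hV : IsOpen V := (continuousOn_extChartAt x).isOpen_inter_preimage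
    (isOpen_extChartAt_source x) (hB.preimage (by fun_prop))
  refine ⟨V, O, fun q => (extChartAt 𝓘(ℝ, E) x).symm (Ψ.symm q).1, hV, ⟨hxs, hz₀B⟩, hO, ?_, ?_, ?_⟩
  · have h1 : ContDiffOn ℝ ∞ (fun q => (Ψ.symm q).1) O := fun q hq => by
      obtain ⟨L', hL'⟩ := hq.2.2.1.2
      have hs := sΦ.contDiffAt (hD2.mem_nhds hq.2.2.1.1)
      refine (ContDiffAt.fst (Ψ.contDiffAt_symm hq.1 (f₀' := L') ?_ hs)).contDiffWithinAt
      rw [hL']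
      exact (hs.differentiableAt (by simp)).hasFDerivAt
    exact (contMDiffOn_extChartAt_symm x).comp (contMDiffOn_iff_contDiffOn.2 h1)
      fun q hq => hq.2.2.1.1.1.1
  · rintro y ⟨hys, hyB⟩
    have h1 : Ψ (extChartAt 𝓘(ℝ, E) x y, 0) = h y := by
      rw [hΨ]
      simp only [Φ, k, zero_smul, add_zero, Function.comp_apply]
      rw [(extChartAt 𝓘(ℝ, E) x).left_inv hys]
    have h2 : Ψ.symm (h y) = (extChartAt 𝓘(ℝ, E) x y, 0) := by
      rw [← h1]
      exact Ψ.left_inv hyB.1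
    refine ⟨⟨h1 ▸ Ψ.map_source hyB.1, ?_⟩, ?_⟩
    · rw [mem_preimage, h2]
      exact hyB
    · simp only [h2]
      exact (extChartAt 𝓘(ℝ, E) x).left_inv hys
  · rintro q ⟨hqt, hqB⟩ hq
    have h1 : k (Ψ.symm q).1 + (Ψ.symm q).2 • P (k (Ψ.symm q).1) = q := Ψ.right_inv hqt
    have hts := (extChartAt 𝓘(ℝ, E) x).right_inv hqB.2.1.1.1.1
    have h2 : P q = (1 + (Ψ.symm q).2) • P (k (Ψ.symm q).1) := by
      conv_lhs => rw [← h1]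
      rw [map_add, map_smul, hP]
      module
    have ht : |(Ψ.symm q).2| < 1 := by simpa using hqB.2.2.2
    have h3 := congrArg norm h2
    rw [hq, norm_smul, show ‖P (k (Ψ.symm q).1)‖ = r from hnorm _, Real.norm_eq_abs,
      abs_of_pos (by linarith [(abs_lt.1 ht).1])] at h3
    have h4 : (Ψ.symm q).2 = 0 := by
      have : (Ψ.symm q).2 * r = 0 := by linarith
      exact (mul_eq_zero.1 this).resolve_right hr.ne'
    rw [h4, zero_smul, add_zero] at h1
    refine ⟨⟨(extChartAt 𝓘(ℝ, E) x).map_target hqB.2.1.1.1.1, ?_⟩, h1⟩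
    rw [mem_preimage, mem_preimage, hts, ← h4]
    exact hqB

end TubularInverse

/-! ### Isometries of `ℂ²` adapted to a model. -/

section ModelIsometry

variable {F : Type*} [NormedAddCommGroup F] [InnerProductSpace ℝ F]

namespace HypersurfaceModel

variable {J P : F →L[ℝ] F} {r : ℝ}

theorem P_P (h : HypersurfaceModel J P r) (v : F) : P (P v) = P v := by
  rcases h.sphere_or_cylinder with ⟨rfl, -⟩ | ⟨-, hPP, -, -⟩
  · rfl
  · exact hPP v

theorem inner_P (h : HypersurfaceModel J P r) (u v : F) : inner ℝ (P u) v = inner ℝ u (P v) := by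
  rcases h.sphere_or_cylinder with ⟨rfl, -⟩ | ⟨-, -, hP, -⟩
  · rfl
  · exact hP u v

theorem r_pos (h : HypersurfaceModel J P r) : 0 < r := by
  rcases h.sphere_or_cylinder with ⟨-, rfl⟩ | ⟨rfl, -⟩ <;> norm_num

theorem inner_J_J (h : HypersurfaceModel J P r) (u v : F) : inner ℝ (J u) (J v) = inner ℝ u v := by
  rw [h.inner_J, h.J_J, inner_neg_right, neg_neg]

theorem inner_J_self (h : HypersurfaceModel J P r) (v : F) : inner ℝ v (J v) = 0 := by
  have := h.inner_J v v
  rw [real_inner_comm] at this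
  linarith

theorem orthonormal4 (h : HypersurfaceModel J P r) {a b : F} (ha : inner ℝ a a = 1)
    (hb : inner ℝ b b = 1) (hab : inner ℝ a b = 0) (hab' : inner ℝ a (J b) = 0) :
    Orthonormal4 a (J a) b (J b) := by
  refine ⟨ha, ?_, hb, ?_, h.inner_J_self a, hab, hab', ?_, ?_, h.inner_J_self b⟩
  · rw [h.inner_J_J, ha]
  · rw [h.inner_J_J, hb]
  · rw [h.inner_J, hab', neg_zero]
  · rw [h.inner_J_J, hab]

/-- The range of the projection of a cylinder model is spanned by a basis which is orthonormal for
the Hermitian structure. -/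
theorem exists_basis_of_cylinder {a b : F} (h : HypersurfaceModel J P r)
    (hP : ∀ v, P v - J (P (J v)) = v) (ha : inner ℝ a a = 1)
    (hb : inner ℝ b b = 1) (hPb : P b = b) (hab : inner ℝ a b = 0) (hab' : inner ℝ (J a) b = 0) :
    ∃ a, Orthonormal4 a (J a) b (J b) ∧ P a = a ∧ P (J a) = 0 ∧ P (J b) = 0 := by
  have hPJ : ∀ v, P v = v → P (J v) = 0 := fun v hv => by
    have h1 := hP v
    rw [hv, sub_eq_self] at h1
    have h2 := h.J_J (P (J v))
    rw [h1, map_zero, zero_eq_neg] at h2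
    exact h2
  -- Both `a` and `J a` are orthogonal to `b`, and `a = P a - J (P (J a))` is nonzero, so at least
  -- one of them has a nonzero projection.
  obtain ⟨w, hw, hwb⟩ : ∃ w, P w ≠ 0 ∧ inner ℝ w b = 0 := by
    by_cases h0 : P a = 0
    · refine ⟨J a, fun h1 => ?_, hab'⟩
      have h2 := hP a
      rw [h0, h1, map_zero, sub_zero] at h2
      rw [← h2, inner_zero_left] at ha
      exact zero_ne_one ha
    · exact ⟨a, h0, hab⟩
  have hPa : P (‖P w‖⁻¹ • P w) = ‖P w‖⁻¹ • P w := by rw [map_smul, h.P_P]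
  refine ⟨‖P w‖⁻¹ • P w, h.orthonormal4 ?_ hb ?_ ?_, hPa, hPJ _ hPa, hPJ b hPb⟩
  · rw [inner_smul_left, inner_smul_right, real_inner_self_eq_norm_sq, RCLike.conj_to_real]
    have := norm_ne_zero_iff.2 hw
    field_simp
  · rw [inner_smul_left, h.inner_P, hPb, hwb, mul_zero]
  · rw [inner_smul_left, h.inner_P, hPJ b hPb, inner_zero_right, mul_zero]

end HypersurfaceModel

/-- The real linear map `ℂ² → F` which maps the standard basis to `a`, `b` and intertwines
multiplication by `i` with `J`. -/
def complexSpan (J : F →L[ℝ] F) (a b : F) : EuclideanSpace ℂ (Fin 2) →ₗ[ℝ] F where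
  toFun p := (p 0).re • a + (p 0).im • J a + (p 1).re • b + (p 1).im • J b
  map_add' p q := by simp only [PiLp.add_apply, Complex.add_re, Complex.add_im]; module
  map_smul' c p := by
    simp only [PiLp.smul_apply, Complex.real_smul, Complex.re_ofReal_mul, Complex.im_ofReal_mul,
      RingHom.id_apply]
    module

theorem complexSpan_apply (J : F →L[ℝ] F) (a b : F) (p : EuclideanSpace ℂ (Fin 2)) :
    complexSpan J a b p = (p 0).re • a + (p 0).im • J a + (p 1).re • b + (p 1).im • J b := rfl

/-- The isometry `ℂ² ≃ F` which maps the standard basis to `a`, `b`. -/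
def complexIsometry {J : F →L[ℝ] F} {a b : F} (h : Orthonormal4 a (J a) b (J b))
    (hF : Module.finrank ℝ F = 4) : EuclideanSpace ℂ (Fin 2) ≃ₗᵢ[ℝ] F :=
  haveI : FiniteDimensional ℝ F := Module.finite_of_finrank_pos (by omega)
  LinearIsometry.toLinearIsometryEquiv
    { toLinearMap := complexSpan J a b
      norm_map' := fun p => by
        rw [← sq_eq_sq₀ (norm_nonneg _) (norm_nonneg _), EuclideanSpace.norm_sq_eq,
          ← real_inner_self_eq_norm_sq, complexSpan_apply]
        simp only [inner_add_left, inner_add_right, inner_smul_left, inner_smul_right,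
          RCLike.conj_to_real, h.aa, h.bb, h.cc, h.dd, h.ab, h.ac, h.ad, h.bc, h.bd, h.cd, h.ba,
          h.ca, h.da, h.cb, h.db, h.dc, Fin.sum_univ_two, Complex.sq_norm, Complex.normSq_apply]
        ring }
    (by rw [hF, ← Module.finrank_mul_finrank ℝ ℂ (EuclideanSpace ℂ (Fin 2)),
      Complex.finrank_real_complex, finrank_euclideanSpace_fin])

theorem complexIsometry_apply {J : F →L[ℝ] F} {a b : F} (h : Orthonormal4 a (J a) b (J b))
    (hF : Module.finrank ℝ F = 4) (p : EuclideanSpace ℂ (Fin 2)) :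
    complexIsometry h hF p = (p 0).re • a + (p 0).im • J a + (p 1).re • b + (p 1).im • J b := rfl

theorem complexIsometry_I_smul {J : F →L[ℝ] F} {a b : F} (h : Orthonormal4 a (J a) b (J b))
    (hF : Module.finrank ℝ F = 4) (hJ : ∀ v, J (J v) = -v) (p : EuclideanSpace ℂ (Fin 2)) :
    complexIsometry h hF (Complex.I • p) = J (complexIsometry h hF p) := by
  simp only [complexIsometry_apply, map_add, map_smul, hJ, PiLp.smul_apply, smul_eq_mul,
    Complex.mul_re, Complex.mul_im, Complex.I_re, Complex.I_im]
  module

theorem norm_sq_complexIsometry {J : F →L[ℝ] F} {a b : F} (h : Orthonormal4 a (J a) b (J b))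
    (hF : Module.finrank ℝ F = 4) (p : EuclideanSpace ℂ (Fin 2)) :
    ‖complexIsometry h hF p‖ ^ 2 = ‖p 0‖ ^ 2 + ‖p 1‖ ^ 2 := by
  rw [LinearIsometryEquiv.norm_map, EuclideanSpace.norm_sq_eq, Fin.sum_univ_two]

theorem norm_sq_proj_complexIsometry {J P : F →L[ℝ] F} {a b : F}
    (h : Orthonormal4 a (J a) b (J b)) (hF : Module.finrank ℝ F = 4) (ha : P a = a)
    (hb : P b = b) (ha' : P (J a) = 0) (hb' : P (J b) = 0) (p : EuclideanSpace ℂ (Fin 2)) :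
    ‖P (complexIsometry h hF p)‖ ^ 2 = (p 0).re ^ 2 + (p 1).re ^ 2 := by
  rw [← real_inner_self_eq_norm_sq, complexIsometry_apply]
  simp only [map_add, map_smul, ha, hb, ha', hb', smul_zero, add_zero, inner_add_left,
    inner_add_right, inner_smul_left, inner_smul_right, RCLike.conj_to_real, h.aa, h.cc, h.ac, h.ca]
  ring

end ModelIsometry

/-! ### From the model to local CR diffeomorphisms. -/

section CRDiffeo

variable {E : Type*} [NormedAddCommGroup E] [NormedSpace ℝ E]
variable {M : Type*} [TopologicalSpace M] [ChartedSpace E M] [IsManifold 𝓘(ℝ, E) ∞ M]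
  {S : CRStructure E 1 M} {θ : PseudohermitianStructure S}

theorem rDiff_clm_sub_const {F G : Type*} [NormedAddCommGroup F] [NormedSpace ℝ F]
    [NormedAddCommGroup G] [NormedSpace ℝ G] (P : F →L[ℝ] G) {f : M → F}
    (hf : ContMDiff 𝓘(ℝ, E) 𝓘(ℝ, F) ∞ f) (c : F) (x : M) (v : TangentSpace 𝓘(ℝ, E) x) :
    rDiff (fun y => P (f y - c)) x v = P (rDiff f x v) := by
  have h := rDiff_clm_sub_clm P P hf (contMDiff_const (c := c)) x v
  have h0 : rDiff (E := E) (fun _ : M => c) x = 0 := mfderiv_const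
  rw [h0] at h
  simp only [← map_sub] at h
  rw [h]
  exact congrArg P (sub_zero _)

namespace CRStructure

theorem isCRDiffeo_of_isOpen {ρ : EuclideanSpace ℂ (Fin 2) → ℝ}
    {ψ : M → EuclideanSpace ℂ (Fin 2)} {V : Set M} {O : Set (EuclideanSpace ℂ (Fin 2))}
    (hψ : ContMDiff 𝓘(ℝ, E) 𝓘(ℝ, EuclideanSpace ℂ (Fin 2)) ∞ ψ) (hρ : ∀ y, ρ (ψ y) = 0)
    (hT : ∀ x, (S.T10 x).map (cDiff ψ x) = hypersurfaceT10 ρ (ψ x))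
    (hV : IsOpen V) (hO : IsOpen O) (hVO : MapsTo ψ V O) {χ : EuclideanSpace ℂ (Fin 2) → M}
    (hχ : ContMDiffOn 𝓘(ℝ, EuclideanSpace ℂ (Fin 2)) 𝓘(ℝ, E) ∞ χ (O ∩ {p | ρ p = 0}))
    (h1 : ∀ y ∈ V, χ (ψ y) = y) (h2 : ∀ p ∈ O, ρ p = 0 → χ p ∈ V ∧ ψ (χ p) = p) :
    S.IsCRDiffeo ρ ψ V (O ∩ {p | ρ p = 0}) :=
  ⟨hV, ⟨O, hO, rfl⟩, hψ.contMDiffOn, fun y hy => ⟨hVO hy, hρ y⟩,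
    ⟨χ, hχ, fun p hp => (h2 p hp.1 hp.2).1, h1, fun p hp => (h2 p hp.1 hp.2).2⟩, fun x _ => hT x⟩

/-- A map into a hypersurface with local inverses defined on open subsets of `ℂ²` is a local CR
diffeomorphism onto an open subset, and a CR diffeomorphism if it is injective. -/
theorem isLocalCRDiffeoOnto_of_local_inverse [Nonempty M] {ρ : EuclideanSpace ℂ (Fin 2) → ℝ}
    {ψ : M → EuclideanSpace ℂ (Fin 2)}
    (hψ : ContMDiff 𝓘(ℝ, E) 𝓘(ℝ, EuclideanSpace ℂ (Fin 2)) ∞ ψ) (hρ : ∀ y, ρ (ψ y) = 0)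
    (hT : ∀ x, (S.T10 x).map (cDiff ψ x) = hypersurfaceT10 ρ (ψ x))
    (hloc : ∀ x, ∃ (V : Set M) (O : Set (EuclideanSpace ℂ (Fin 2)))
      (χ : EuclideanSpace ℂ (Fin 2) → M), IsOpen V ∧ x ∈ V ∧ IsOpen O ∧
      ContMDiffOn 𝓘(ℝ, EuclideanSpace ℂ (Fin 2)) 𝓘(ℝ, E) ∞ χ O ∧
      (∀ y ∈ V, ψ y ∈ O ∧ χ (ψ y) = y) ∧ ∀ q ∈ O, ρ q = 0 → χ q ∈ V ∧ ψ (χ q) = q) :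
    S.IsLocalCRDiffeoOnto ρ ψ (range ψ) ∧
      (Function.Injective ψ → S.IsCRDiffeo ρ ψ univ (range ψ)) := by
  choose V O χ hV hxV hO hχ h1 h2 using hloc
  -- Every point of the hypersurface in some `O x` is attained, so the image is open in the
  -- hypersurface.
  have hrange : range ψ = (⋃ x, O x) ∩ {p | ρ p = 0} := by
    ext p
    constructor
    · rintro ⟨y, rfl⟩
      exact ⟨mem_iUnion.2 ⟨y, (h1 y y (hxV y)).1⟩, hρ y⟩
    · rintro ⟨hp, hp0⟩
      obtain ⟨x, hx⟩ := mem_iUnion.1 hp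
      exact ⟨_, (h2 x p hx hp0).2⟩
  have hOU : IsOpen (⋃ x, O x) := isOpen_iUnion hO
  refine ⟨⟨⟨_, hOU, hrange⟩, rfl, fun x => ⟨V x, hxV x, _,
    isCRDiffeo_of_isOpen hψ hρ hT (hV x) (hO x) (fun y hy => (h1 x y hy).1)
      ((hχ x).mono inter_subset_left) (fun y hy => (h1 x y hy).2) (h2 x)⟩⟩, fun hinj => ?_⟩
  have hleft := Function.leftInverse_invFun hinj
  rw [hrange]
  refine isCRDiffeo_of_isOpen hψ hρ hT isOpen_univ hOU
    (fun y _ => mem_iUnion.2 ⟨y, (h1 y y (hxV y)).1⟩) (χ := Function.invFun ψ) ?_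
    (fun y _ => hleft y) fun p hp hp0 => ⟨mem_univ _, ?_⟩
  · rintro p ⟨hp, hp0⟩
    obtain ⟨x, hx⟩ := mem_iUnion.1 hp
    -- The global inverse coincides on each piece with the local inverse there, and so inherits its
    -- smoothness.
    have heq : ∀ q ∈ O x ∩ {p | ρ p = 0}, Function.invFun ψ q = χ x q := fun q hq => by
      conv_lhs => rw [← (h2 x q hq.1 hq.2).2]
      exact hleft _
    refine (((hχ x).contMDiffAt ((hO x).mem_nhds hx)).contMDiffWithinAt).congr_of_eventuallyEq ?_
      (heq p ⟨hx, hp0⟩)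
    filter_upwards [mem_nhdsWithin_of_mem_nhds ((hO x).mem_nhds hx), self_mem_nhdsWithin] with q hq hq'
    exact heq q ⟨hq, hq'.2⟩
  · have : p ∈ range ψ := hrange ▸ ⟨hp, hp0⟩
    exact Function.invFun_eq this

end CRStructure

namespace PseudohermitianStructure

variable {f : M → EuclideanSpace ℝ (Fin 4)}
  {J P : EuclideanSpace ℝ (Fin 4) →L[ℝ] EuclideanSpace ℝ (Fin 4)} {r : ℝ}

theorem IsModelAt.inner_normal {y : M} (h : θ.IsModelAt f J P r y) (hm : HypersurfaceModel J P r)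
    (hf : θ.IsIsometricImmersion f) (hθ : θ.LeviPosDef) (v : TangentSpace 𝓘(ℝ, E) y) :
    inner ℝ (J (rDiff f y (θ.reeb y))) (rDiff f y v) = 0 := by
  obtain ⟨Z, hZ, hv⟩ := θ.exists_of_form_eq_zero (x := y) (v := v - θ.form y v • θ.reeb y) (by
    rw [map_sub, map_smul, (θ.isReeb_reeb hθ y).1]; simp)
  have h1 : inner ℝ (J (rDiff f y (θ.reeb y))) (rDiff f y (cRe Z)) = 0 := by
    rw [hm.inner_J, h.map_cRe _ hZ, inner_neg_right, neg_neg, real_inner_comm, hf.inner_reeb hθ,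
      (θ.form_of_mem hZ).2]
  rw [← hv, map_sub, map_smul, inner_sub_right, inner_smul_right,
    real_inner_comm (rDiff f y (θ.reeb y)), hm.inner_J_self, mul_zero, sub_zero] at h1
  exact h1

/-- An immersion with the infinitesimal model of a sphere or cylinder is a local CR diffeomorphism
onto an open subset of it, followed by an isometry. -/
theorem exists_factorization [Nonempty M] (hE : Module.finrank ℝ E = 3)
    (hf : θ.IsIsometricImmersion f) (hθ : θ.LeviPosDef) (hm : HypersurfaceModel J P r)
    (h : ∀ y, θ.IsModelAt f J P r y) {c : EuclideanSpace ℝ (Fin 4)}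
    (hc : ∀ y, P (f y - c) = r • J (rDiff f y (θ.reeb y)))
    (A : EuclideanSpace ℂ (Fin 2) ≃ₗᵢ[ℝ] EuclideanSpace ℝ (Fin 4))
    (hA : ∀ p, A (Complex.I • p) = J (A p)) {ρ : EuclideanSpace ℂ (Fin 2) → ℝ}
    (hρ : ∀ p, ρ p = ‖P (A p)‖ ^ 2 - r ^ 2) :
    ∃ (ψ : M → EuclideanSpace ℂ (Fin 2)) (U : Set (EuclideanSpace ℂ (Fin 2)))
        (φ : EuclideanSpace ℂ (Fin 2) ≃ᵢ EuclideanSpace ℝ (Fin 4)),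
      S.IsLocalCRDiffeoOnto ρ ψ U ∧
        (Function.Injective f → S.IsCRDiffeo ρ ψ Set.univ U) ∧ f = φ ∘ ψ := by
  have : FiniteDimensional ℝ E := Module.finite_of_finrank_pos (by omega)
  have hr := hm.r_pos
  set A' : EuclideanSpace ℝ (Fin 4) →L[ℝ] EuclideanSpace ℂ (Fin 2) :=
    A.symm.toContinuousLinearEquiv.toContinuousLinearMap
  have hAA' : ∀ v, A (A' v) = v := A.apply_symm_apply
  have hA'A : ∀ p, A' (A p) = p := A.symm_apply_apply
  set ψ : M → EuclideanSpace ℂ (Fin 2) := fun y => A' (f y - c)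
  have hAψ : ∀ y, A (ψ y) = f y - c := fun y => hAA' _
  have hfc : ContMDiff 𝓘(ℝ, E) 𝓘(ℝ, EuclideanSpace ℝ (Fin 4)) ∞ fun y => f y - c :=
    hf.1.sub contMDiff_const
  have hψ : ContMDiff 𝓘(ℝ, E) 𝓘(ℝ, EuclideanSpace ℂ (Fin 2)) ∞ ψ :=
    A'.contDiff.contMDiff.comp hfc
  have hnorm : ∀ y, ‖P (f y - c)‖ = r := fun y => by
    have h1 : inner ℝ (J (rDiff f y (θ.reeb y))) (J (rDiff f y (θ.reeb y))) = 1 := by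
      rw [hm.inner_J_J, hf.inner_reeb_reeb hθ]
    rw [real_inner_self_eq_norm_sq, pow_eq_one_iff_of_nonneg (norm_nonneg _) two_ne_zero] at h1
    rw [hc, norm_smul, h1, mul_one, Real.norm_of_nonneg hr.le]
  have hρψ : ∀ y, ρ (ψ y) = 0 := fun y => by rw [hρ, hAψ, hnorm, sub_self]
  have hdψ : ∀ (x : M) (v : TangentSpace 𝓘(ℝ, E) x), rDiff ψ x v = A' (rDiff f x v) :=
    rDiff_clm_sub_const A' hf.1 c
  -- The gradient of `ρ` along the image corresponds under `A` to `2r` times the unit normal `J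
  -- df(T)`.
  have hdρ : ∀ y w, fderiv ℝ ρ (ψ y) w = 2 * r * inner ℝ (J (rDiff f y (θ.reeb y))) (A w) := by
    intro y w
    have h1 := ((P.comp A.toContinuousLinearEquiv.toContinuousLinearMap).hasFDerivAt
      (x := ψ y)).norm_sq.sub_const (r ^ 2)
    have h2 : ρ = fun p => ‖(P.comp A.toContinuousLinearEquiv.toContinuousLinearMap) p‖ ^ 2 - r ^ 2 :=
      funext hρ
    rw [h2, h1.fderiv]
    change (2 • inner ℝ (P (A (ψ y))) (P (A w))) = _
    rw [hAψ, hc, ← hm.inner_P, map_smul, (h y).map_normal, inner_smul_left, RCLike.conj_to_real,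
      nsmul_eq_mul]
    push_cast
    ring
  have hT : ∀ x, (S.T10 x).map (cDiff ψ x) = hypersurfaceT10 ρ (ψ x) := by
    intro x
    obtain ⟨U, -, hxU, -, Z, -, -, hZ⟩ := hf.exists_unit_generator hθ x
    obtain ⟨-, hspan, h1⟩ := hZ x hxU
    have hmem : Z x ∈ S.T10 x := hspan ▸ Submodule.mem_span_singleton_self _
    have hm4 := (h x).orthonormal4 hm hf hθ hmem h1
    have hRe : ∀ Z', cRe (cDiff ψ x Z') = A' (rDiff f x (cRe Z')) := fun Z' =>
      (cRe_baseChange _ _).trans (hdψ x _)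
    have hIm : ∀ Z', cIm (cDiff ψ x Z') = A' (rDiff f x (cIm Z')) := fun Z' =>
      (cIm_baseChange _ _).trans (hdψ x _)
    have hol : ∀ Z' ∈ S.T10 x, cDiff ψ x Z' ∈ holTangent (EuclideanSpace ℂ (Fin 2)) := by
      intro Z' hZ'
      rw [mem_holTangent_iff, hRe, hIm]
      apply A.injective
      rw [map_neg, hA, hAA', hAA', (h x).map_cRe _ hZ', neg_neg]
    apply le_antisymm
    · rintro _ ⟨Z', hZ', rfl⟩
      refine ⟨(baseChange_eq_zero_iff _ _).2 ⟨?_, ?_⟩, hol Z' hZ'⟩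
      all_goals
        change fderiv ℝ ρ (ψ x) _ = 0
        rw [hdρ]
      · rw [hRe, hAA', (h x).inner_normal hm hf hθ, mul_zero]
      · rw [hIm, hAA', (h x).inner_normal hm hf hθ, mul_zero]
    -- Put `u = A (Re W)`. Tangency of `Re W` and of `Im W = -i Re W` makes `u` orthogonal to `J
    -- df(T)` and to `df(T)`. So `u = a df(Re Z) + b df(Im Z)`, which is the image of the real part
    -- of `(a - i b) Z`.
    · rintro W ⟨hW1, hW2⟩
      obtain ⟨k1, k2⟩ := (baseChange_eq_zero_iff _ _).1 hW1
      replace hW2 := (mem_holTangent_iff W).1 hW2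
      change fderiv ℝ ρ (ψ x) _ = 0 at k1 k2
      rw [hdρ, mul_eq_zero_iff_left (by positivity)] at k1 k2
      rw [hW2, map_neg, hA, inner_neg_right, hm.inner_J_J, neg_eq_zero] at k2
      have hw := hm4.expand (by simp) (A (cRe W))
      rw [k1, k2, zero_smul, zero_smul, add_zero, add_zero] at hw
      set a := inner ℝ (rDiff f x (cRe (Z x))) (A (cRe W))
      set b := inner ℝ (rDiff f x (cIm (Z x))) (A (cRe W))
      have hZ' : (⟨a, -b⟩ : ℂ) • Z x ∈ S.T10 x := Submodule.smul_mem _ _ hmem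
      have e1 : cRe (cDiff ψ x ((⟨a, -b⟩ : ℂ) • Z x)) = cRe W := by
        apply A.injective
        rw [hRe, hAA', hw, cRe_smul]
        simp
      refine ⟨_, hZ', complexification_ext e1 ?_⟩
      rw [(mem_holTangent_iff _).1 (hol _ hZ'), e1, hW2]
  have hloc : ∀ x, ∃ (V : Set M) (O : Set (EuclideanSpace ℂ (Fin 2)))
      (χ : EuclideanSpace ℂ (Fin 2) → M), IsOpen V ∧ x ∈ V ∧ IsOpen O ∧
      ContMDiffOn 𝓘(ℝ, EuclideanSpace ℂ (Fin 2)) 𝓘(ℝ, E) ∞ χ O ∧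
      (∀ y ∈ V, ψ y ∈ O ∧ χ (ψ y) = y) ∧ ∀ q ∈ O, ρ q = 0 → χ q ∈ V ∧ ψ (χ q) = q := by
    intro x
    have hd : ∀ (y : M) (v : TangentSpace 𝓘(ℝ, E) y),
        rDiff (fun y => f y - c) y v = rDiff f y v :=
      rDiff_clm_sub_const (ContinuousLinearMap.id ℝ _) hf.1 c
    obtain ⟨V, O, χ, hV, hxV, hO, hχ, h1, h2⟩ := exists_local_inverse (by simp [hE]) hfc hm.P_P hr
      hnorm (fun y v => by
        rw [hd, hc, inner_smul_left, (h y).inner_normal hm hf hθ, mul_zero])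
      (fun y => by
        have : (rDiff (E := E) (fun y => f y - c) y) = rDiff f y := by
          ext1 v; exact hd y v
        rw [this]
        exact hf.2.1 y) x
    refine ⟨V, A ⁻¹' O, fun q => χ (A q), hV, hxV, hO.preimage A.continuous, ?_, ?_, ?_⟩
    · exact hχ.comp A.toContinuousLinearEquiv.contDiff.contMDiff.contMDiffOn fun q hq => hq
    · intro y hy
      change A (ψ y) ∈ O ∧ χ (A (ψ y)) = y
      rw [hAψ]
      exact h1 y hy
    · intro q hq hq0
      rw [hρ, sub_eq_zero, sq_eq_sq₀ (norm_nonneg _) hr.le] at hq0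
      obtain ⟨b1, b2⟩ := h2 (A q) hq hq0
      refine ⟨b1, ?_⟩
      change A' (f (χ (A q)) - c) = q
      rw [b2, hA'A]
  obtain ⟨a1, a2⟩ := CRStructure.isLocalCRDiffeoOnto_of_local_inverse hψ hρψ hT hloc
  have hfψ : f = (A.toIsometryEquiv.trans (IsometryEquiv.addRight c)) ∘ ψ := by
    funext y
    change f y = A (ψ y) + c
    rw [hAψ, sub_add_cancel]
  refine ⟨ψ, range ψ, A.toIsometryEquiv.trans (IsometryEquiv.addRight c), a1, fun hinj => a2 ?_, hfψ⟩
  rw [hfψ] at hinj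
  exact hinj.of_comp

end PseudohermitianStructure
end CRDiffeo

end

/-! ### The classification. -/

theorem mainTheorem1 {M : Type*} [TopologicalSpace M] [T2Space M] [SecondCountableTopology M]
    [ConnectedSpace M] [ChartedSpace (EuclideanSpace ℝ (Fin 3)) M]
    [IsManifold 𝓘(ℝ, EuclideanSpace ℝ (Fin 3)) ∞ M]
    (S : CRStructure (EuclideanSpace ℝ (Fin 3)) 1 M) (θ : PseudohermitianStructure S)
    (hθ : θ.LeviPosDef) (f : M → EuclideanSpace ℝ (Fin 4))
    (hf : θ.IsIsometricImmersion f) (hpl : S.IsCRPluriharmonic f) :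
    (∃ (ψ : M → EuclideanSpace ℂ (Fin 2)) (U : Set (EuclideanSpace ℂ (Fin 2)))
        (φ : EuclideanSpace ℂ (Fin 2) ≃ᵢ EuclideanSpace ℝ (Fin 4)),
      S.IsLocalCRDiffeoOnto cylinderFn ψ U ∧
        (Function.Injective f → S.IsCRDiffeo cylinderFn ψ Set.univ U) ∧ f = φ ∘ ψ) ∨
    (∃ (ψ : M → EuclideanSpace ℂ (Fin 2)) (U : Set (EuclideanSpace ℂ (Fin 2)))
        (φ : EuclideanSpace ℂ (Fin 2) ≃ᵢ EuclideanSpace ℝ (Fin 4)),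
      S.IsLocalCRDiffeoOnto sphereFn ψ U ∧
        (Function.Injective f → S.IsCRDiffeo sphereFn ψ Set.univ U) ∧ f = φ ∘ ψ) := by
  have hE : Module.finrank ℝ (EuclideanSpace ℝ (Fin 3)) = 3 := by simp
  have hF : Module.finrank ℝ (EuclideanSpace ℝ (Fin 4)) = 4 := by simp
  obtain ⟨J, P, r, hm, h⟩ := θ.exists_isModel hE hf hθ hpl
  obtain ⟨c, hc⟩ := θ.exists_center hf hθ hm h
  obtain ⟨x⟩ : Nonempty M := inferInstance
  obtain ⟨U, -, hx, -, Z, -, -, hZ⟩ := hf.exists_unit_generator hθ x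
  obtain ⟨-, hspan, h1⟩ := hZ x hx
  have hmem : Z x ∈ S.T10 x := hspan ▸ Submodule.mem_span_singleton_self _
  have hm4 := (h x).orthonormal4 hm hf hθ hmem h1
  rcases hm.sphere_or_cylinder with ⟨rfl, rfl⟩ | ⟨rfl, -, -, hP⟩
  · right
    -- For the sphere any unitary basis would do; `df(Re Z)` and `df(T)` form one.
    have hb := hm.orthonormal4 hm4.aa hm4.cc hm4.ac hm4.ad
    refine θ.exists_factorization hE hf hθ hm h hc (complexIsometry hb hF)
      (complexIsometry_I_smul hb hF hm.J_J) fun p => ?_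
    rw [ContinuousLinearMap.id_apply, norm_sq_complexIsometry, sphereFn]
    norm_num
  · left
    -- For the cylinder the basis must span the range of `P`. One vector is the normal `J df(T)`,
    -- which `P` fixes; the other is obtained from `df(Re Z)`, which is Hermitian orthogonal to it.
    obtain ⟨a, hb, ha, ha', hb'⟩ := hm.exists_basis_of_cylinder hP hm4.aa hm4.dd (h x).map_normal
      hm4.ad (by rw [hm.inner_J_J, hm4.ac])
    refine θ.exists_factorization hE hf hθ hm h hc (complexIsometry hb hF)
      (complexIsometry_I_smul hb hF hm.J_J) fun p => ?_
    rw [norm_sq_proj_complexIsometry hb hF ha (h x).map_normal ha' hb', cylinderFn]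
    norm_num
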